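/- Let $n=2$ or $n=3$, let $V\in C^2(\mathbb R^n)$ be a real-valued function, and let $H$ be continuous on $\mathbb R^n$, with values in $\mathbb R$ if $n=2$ and $H=(H_1,H_2,H_3)$ with values in $\mathbb R^3$ if $n=3$. Write $\langle\cdot\rangle=(1+|\cdot|^2)^{1/2}$, and for $(x,y)\in\mathbb R^{2n}=\mathbb R^n_x\times\mathbb R^n_y$ consider the Fokker–Planck operator $$P=y\cdot\partial_x-\partial_xV(x)\cdot\partial_y-H(x)\cdot(y\wedge\partial_y)-\Delta_y+\frac{|y|^2}{4}-\frac n2,$$ where $y\wedge\partial_y=y_1\partial_{y_2}-y_2\partial_{y_1}$ if $n=2$, and $y\wedge\partial_y=(y_2\partial_{y_3}-y_3\partial_{y_2},\;y_3\partial_{y_1}-y_1\partial_{y_3},\;y_1\partial_{y_2}-y_2\partial_{y_1})$ if $n=3$. For $r\in\mathbb R$ let $\langle D_x\rangle^r=(1-\Delta_x)^{r/2}$ be the Fourier multiplier in $x$ with symbol $\langle\xi\rangle^r$. Let $\|\cdot\|_{L^2}$ be the norm of the complex space $L^2(\mathbb R^{2n})$, and let $C_0^\infty(\mathbb R^{2n})$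 be the set of complex-valued smooth compactly supported functions. Suppose that there are constants $C_0$, $\delta<2/3$ and $s<4/3$ such that for all $x\in\mathbb R^n$ $$|H(x)|\le C_0\langle\partial_xV(x)\rangle^{\delta}\qquad\text{and}\qquad|\partial_x^\alpha V(x)|\le C_0\langle\partial_xV(x)\rangle^{s}\quad\text{for all }|\alpha|=2 .$$ Then there is a constant $C$, depending only on $n$, $C_0$ and $s$, such that $$\|\langle\partial_xV\rangle^{2/3}u\|_{L^2}\le C\big(\|Pu\|_{L^2}+\|u\|_{L^2}\big)\qquad\text{for all }u\in C_0^\infty(\mathbb R^{2n}).$$ If moreover $H\in C^1(\mathbb R^n)$ and $|\partial_xH(x)|\le C_0\langle\partial_xV(x)\rangle^{s/2}$ for all $x\in\mathbb R^n$, where $|\partial_xH(x)|$ is the operator norm of the derivative of $H$ at $x$, then also, with $C$ depending only on $n$, $C_0$ and $s$, $$\|\langle D_x\rangle^{\tau}u\|_{L^2}\le C\big(\|Pu\|_{L^2}+\|u\|_{L^2}\big)\qquad\text{for all }u\in C_0^\infty(\mathbb R^{2n}),$$ where $$\tau=\begin{cases}2/3,&s\le 2/3,\\(4-3s)/3,&2/3<s\le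 10/9,\\(4-3s)/6,&10/9<s<4/3.\end{cases}$$ -/

import Mathlib

open MeasureTheory
open scoped ContDiff FourierTransform NNReal

noncomputable section

/-- `ℝⁿ` with its Euclidean norm and Lebesgue measure. -/
abbrev Rn (n : ℕ) : Type := EuclideanSpace ℝ (Fin n)

/-- The phase space `ℝ²ⁿ = ℝⁿ_x × ℝⁿ_y`. (Only its smooth structure and its Lebesgue measure
are used below, not the norm of the product.) -/
abbrev PhaseSpace (n : ℕ) : Type := Rn n × Rn n

/-- The standard basis vector `e_j` of `ℝⁿ`. -/
abbrev stdVec {n : ℕ} (j : Fin n) : Rn n := EuclideanSpace.single j (1 : ℝ)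

/-- The Japanese bracket `⟨v⟩ = (1 + |v|²)^{1/2}`. -/
def japaneseBracket {n : ℕ} (v : Rn n) : ℝ := Real.sqrt (1 + ‖v‖ ^ 2)

/-- The weight `⟨∂ₓV(x)⟩`. -/
def gradWeight {n : ℕ} (V : Rn n → ℝ) (x : Rn n) : ℝ := japaneseBracket (gradient V x)

/-- The second order partial derivative `∂_{x_i} ∂_{x_j} V (x)`. -/
def secondPartial {n : ℕ} (V : Rn n → ℝ) (i j : Fin n) (x : Rn n) : ℝ :=
  fderiv ℝ (fun z => fderiv ℝ V z (stdVec j)) x (stdVec i)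

/-- The partial derivative `∂_{x_j} u`. -/
def partialX {n : ℕ} (j : Fin n) (u : PhaseSpace n → ℂ) (p : PhaseSpace n) : ℂ :=
  fderiv ℝ u p (stdVec j, 0)

/-- The partial derivative `∂_{y_j} u`. -/
def partialY {n : ℕ} (j : Fin n) (u : PhaseSpace n → ℂ) (p : PhaseSpace n) : ℂ :=
  fderiv ℝ u p (0, stdVec j)

/-- The component `(y_i ∂_{y_j} - y_j ∂_{y_i}) u` of `(y ∧ ∂_y) u`. -/
def rotationY {n : ℕ} (i j : Fin n) (u : PhaseSpace n → ℂ) (p : PhaseSpace n) : ℂ :=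
  (p.2 i : ℂ) * partialY j u p - (p.2 j : ℂ) * partialY i u p

/-- `H(x) · (y ∧ ∂_y) u` for `n = 2`, where `H` is a scalar function. -/
def magneticTerm2 (H : Rn 2 → ℝ) (u : PhaseSpace 2 → ℂ) (p : PhaseSpace 2) : ℂ :=
  (H p.1 : ℂ) * rotationY 0 1 u p

/-- `H(x) · (y ∧ ∂_y) u` for `n = 3`, where `H = (H₁, H₂, H₃)` is a vector field. -/
def magneticTerm3 (H : Rn 3 → Rn 3) (u : PhaseSpace 3 → ℂ) (p : PhaseSpace 3) : ℂ :=
  (H p.1 0 : ℂ) * rotationY 1 2 u p + (H p.1 1 : ℂ) * rotationY 2 0 u p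
    + (H p.1 2 : ℂ) * rotationY 0 1 u p

/-- The Fokker-Planck operator without magnetic term,
`K u = y · ∂ₓu - ∂ₓV(x) · ∂_y u - Δ_y u + (|y|² / 4) u - (n / 2) u`. -/
def fokkerPlanckElectric {n : ℕ} (V : Rn n → ℝ) (u : PhaseSpace n → ℂ) (p : PhaseSpace n) : ℂ :=
  (∑ j, (p.2 j : ℂ) * partialX j u p) - (∑ j, (gradient V p.1 j : ℂ) * partialY j u p)
    - (∑ j, partialY j (partialY j u) p) + ((‖p.2‖ ^ 2 / 4 : ℝ) : ℂ) * u p - ((n : ℂ) / 2) * u p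

/-- The operator `P = K - H(x) · (y ∧ ∂_y)` for `n = 2`. -/
def fokkerPlanck2 (V : Rn 2 → ℝ) (H : Rn 2 → ℝ) (u : PhaseSpace 2 → ℂ) (p : PhaseSpace 2) : ℂ :=
  fokkerPlanckElectric V u p - magneticTerm2 H u p

/-- The operator `P = K - H(x) · (y ∧ ∂_y)` for `n = 3`. -/
def fokkerPlanck3 (V : Rn 3 → ℝ) (H : Rn 3 → Rn 3) (u : PhaseSpace 3 → ℂ) (p : PhaseSpace 3) :
    ℂ :=
  fokkerPlanckElectric V u p - magneticTerm3 H u p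

/-- The Fourier multiplier `⟨D_x⟩^r = (1 - Δ_x)^{r/2}`, acting in the variable `x` only.
The Fourier transform used here has kernel `exp (-2πi x·ξ)`, so that `-i∂_{x_j}` corresponds to
`2πξ_j` and the symbol reads `⟨2πξ⟩^r`. -/
def besselX {n : ℕ} (r : ℝ) (u : PhaseSpace n → ℂ) (p : PhaseSpace n) : ℂ :=
  𝓕⁻ (fun ξ : Rn n =>
    ((japaneseBracket ((2 * Real.pi) • ξ) ^ r : ℝ) : ℂ) * 𝓕 (fun x : Rn n => u (x, p.2)) ξ) p.1

/-- `u ∈ C₀^∞(ℝ²ⁿ)`, complex-valued. -/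
def IsTestFunction {n : ℕ} (u : PhaseSpace n → ℂ) : Prop :=
  ContDiff ℝ ∞ u ∧ HasCompactSupport u

/-- The norm of `L²(ℝ²ⁿ)`, with value in `[0, ∞]`. -/
def normL2 {n : ℕ} (f : PhaseSpace n → ℂ) : ENNReal := eLpNorm f 2 volume

/-- The exponent `τ` of the subelliptic estimate, as a function of `s < 4/3`. -/
def subellipticExponent (s : ℝ) : ℝ :=
  if s ≤ 2 / 3 then 2 / 3 else if s ≤ 10 / 9 then (4 - 3 * s) / 3 else (4 - 3 * s) / 6

end

/-! Write W for the gradient of V, J for the skew matrix through which the magnetic field acts on y,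
Λ = ⟨W⟩, and X = y·∂_x - (W + Jy)·∂_y. Both estimates are positive commutator arguments resting on
one energy identity: for a C¹ weight w, the real pairing of wu with Pu equals w|∂_y u|² + (∂_y
w)·Re(ū ∂_y u) + (|y|²/4 - n/2) w|u|² - ½(Xw)|u|² up to a divergence. X is divergence free because J
is skew.

Force estimate (`exists_weighted_estimate`). Three weights are used. The weight Λ^{2/3} controls
Λ^{2/3}(|∂_y u|² + |y|²|u|²); its error XΛ^{2/3} is O(Λ^{s-1/3}|y|), which is absorbed because s <
4/3. The weight |y|² controls |y|²(|∂_y u|² + |y|²|u|²); its error y·W is shared between Λ^{2/3}|y|²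
and a small multiple of Λ^{4/3}. The weight -Λ^{-2/3} W·y has transport derivative Λ^{4/3} up to
controlled errors, and so produces Λ^{4/3}|u|². A suitable choice of small constants closes the
system.

Derivative estimate with constant coefficients (`exists_frozen_subelliptic_estimate`). With W and J
frozen, the Fourier transform in x turns y·∂_x into multiplication by iξ·y. Its commutator with
ξ·∂_y is i|ξ|². The multiplier |ξ|^{-2/3} iξ·∂_y, together with energy estimates for f and for ∂f,
yields |ξ|^{4/3}‖f‖² ≤ C(‖P_ξ f‖² + Λ^{4/3}‖f‖²), uniformly in the frozen force.

Variable coefficients (`AdmissibleField.localized_density_le`, `IsSlowRadius.gagliardo_le`). Cut off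
to balls of radius ρ comparable to Λ^{-s/2}. There W moves by O(Λ^{s/2}), J by O(1), and the cutoff
has derivative O(Λ^{s/2}), so the error is O(Λ^{s/2})(|∂_y u| + |y||u|) + |y||∂_y u|. Its square
times Λ^{2/3-s} is exactly what the force estimate controls. The price is the weight Λ^{2/3-s} in
front of |ξ|^{4/3}; the inequality |ξ|^{2τ} ≤ Λ^{2/3-s}|ξ|^{4/3} + Λ^{4/3}
(`rpow_le_weight_mul_add`) removes it when τ ≤ 4/3 - s. Since ρ varies with the point, the pieces
are glued through Gagliardo seminorms, which are built from differences; the gluing error is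
ρ^{-2τ}|u|² = O(Λ^{4/3}|u|²).

The argument reaches τ = (4-3s)/3 for all 2/3 ≤ s < 4/3, so the smaller exponent of the last range
follows as well. -/

open scoped RealInnerProductSpace

noncomputable section

/-! ### Pointwise energy identity for a transport-diffusion operator -/

section Pointwise

variable {E : Type*} [NormedAddCommGroup E] [NormedSpace ℝ E]

/-- The operator `b · ∂ + iθ - ∑ ∂_{e_j}² + q`. -/
def kineticOp {m : ℕ} (b : E → E)
    (θ q : E → ℝ) (e : Fin m → E) (u : E → ℂ) (x : E) : ℂ :=
  fderiv ℝ u x (b x) + (θ x : ℂ) * Complex.I * u x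
    - (∑ j, fderiv ℝ (fun z => fderiv ℝ u z (e j)) x (e j)) + (q x : ℂ) * u x

/-- The integrand of the energy identity of `kineticOp` with weight `w`. -/
def energyDefect {m : ℕ} (b : E → E)
    (θ q : E → ℝ) (e : Fin m → E) (w : E → ℝ) (u : E → ℂ) (x : E) : ℝ :=
  w x * ⟪u x, kineticOp b θ q e u x⟫ - (w x * ∑ j, ‖fderiv ℝ u x (e j)‖ ^ 2
    + ∑ j, fderiv ℝ w x (e j) * ⟪u x, fderiv ℝ u x (e j)⟫ + q x * w x * ‖u x‖ ^ 2
    - 1 / 2 * fderiv ℝ w x (b x) * ‖u x‖ ^ 2)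

/-- The real inner product of ℂ is Re(z̄w), for which multiplication by an imaginary number is skew.
Hence the phase θ disappears from every energy identity. -/
theorem real_inner_I_mul_self (t : ℝ) (z : ℂ) : ⟪z, (t : ℂ) * Complex.I * z⟫ = 0 := by
  simp [Complex.inner]; ring

theorem contDiff_fderiv_apply_const {F : Type*} [NormedAddCommGroup F] [NormedSpace ℝ F]
    {u : E → F} (hu : ContDiff ℝ ∞ u) (v : E) : ContDiff ℝ ∞ fun x => fderiv ℝ u x v :=
  (hu.fderiv_right (m := ∞) (by simp)).clm_apply contDiff_const

/-- The product rule shows the defect to be a pure divergence: a transport derivative of w|u|²/2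
minus derivatives of w⟨u, ∂_j u⟩ in constant directions. -/
theorem energyDefect_eq {m : ℕ} {b : E → E} {θ q : E → ℝ} {e : Fin m → E} {w : E → ℝ} {u : E → ℂ}
    (hw : ContDiff ℝ 1 w) (hu : ContDiff ℝ ∞ u) (x : E) :
    energyDefect b θ q e w u x = fderiv ℝ (fun z => 1 / 2 * (w z * ⟪u z, u z⟫)) x (b x)
      - ∑ j, fderiv ℝ (fun z => w z * ⟪u z, fderiv ℝ u z (e j)⟫) x (e j) := by
  have hw' := (hw.differentiable one_ne_zero x).hasFDerivAt
  have hu' := (hu.differentiable (by simp) x).hasFDerivAt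
  have h1 := (hw'.mul (hu'.inner ℝ hu')).const_mul (1 / 2)
  have h2 := fun j => hw'.mul (hu'.inner ℝ
    (((contDiff_fderiv_apply_const hu (e j)).differentiable (by simp) x).hasFDerivAt))
  have e1 : fderiv ℝ (fun z => 1 / 2 * (w z * ⟪u z, u z⟫)) x (b x)
      = w x * ⟪u x, fderiv ℝ u x (b x)⟫ + 1 / 2 * fderiv ℝ w x (b x) * ‖u x‖ ^ 2 := by
    erw [h1.fderiv]
    simp [real_inner_comm (u x)]
    ring
  have e2 : ∀ j, fderiv ℝ (fun z => w z * ⟪u z, fderiv ℝ u z (e j)⟫) x (e j)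
      = w x * ‖fderiv ℝ u x (e j)‖ ^ 2
        + w x * ⟪u x, fderiv ℝ (fun z => fderiv ℝ u z (e j)) x (e j)⟫
        + fderiv ℝ w x (e j) * ⟪u x, fderiv ℝ u x (e j)⟫ := by
    intro j
    erw [(h2 j).fderiv]
    simp
    ring
  rw [e1, Finset.sum_congr rfl fun j _ => e2 j]
  have h3 : ⟪u x, (q x : ℂ) * u x⟫ = q x * ‖u x‖ ^ 2 := by
    rw [← real_inner_self_eq_norm_sq, ← real_inner_smul_right]; rfl
  simp only [energyDefect, kineticOp, inner_add_right, inner_sub_right, real_inner_I_mul_self, h3,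
    inner_sum, Finset.sum_add_distrib, ← Finset.mul_sum]
  ring

theorem fderiv_eq_zero_off_tsupport {F G : Type*} [NormedAddCommGroup F] [NormedSpace ℝ F]
    [NormedAddCommGroup G] [NormedSpace ℝ G] {u : F → G} {x : F} (hx : x ∉ tsupport u) :
    fderiv ℝ u x = 0 :=
  image_eq_zero_of_notMem_tsupport fun h => hx (tsupport_fderiv_subset ℝ h)

theorem fderiv_fderiv_apply_eq_zero_off_tsupport {F G : Type*} [NormedAddCommGroup F]
    [NormedSpace ℝ F] [NormedAddCommGroup G] [NormedSpace ℝ G] {u : F → G} {x : F}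
    (hx : x ∉ tsupport u) (v : F) : fderiv ℝ (fun z => fderiv ℝ u z v) x = 0 :=
  fderiv_eq_zero_off_tsupport fun h => hx (tsupport_fderiv_apply_subset ℝ v h)

theorem kineticOp_eq_zero_off_tsupport {m : ℕ} {b : E → E} {θ q : E → ℝ} {e : Fin m → E}
    {u : E → ℂ} {x : E} (hx : x ∉ tsupport u) : kineticOp b θ q e u x = 0 := by
  simp [kineticOp, image_eq_zero_of_notMem_tsupport hx, fderiv_eq_zero_off_tsupport hx,
    fderiv_fderiv_apply_eq_zero_off_tsupport hx]

theorem continuous_kineticOp {m : ℕ} {b : E → E} (hbc : Continuous b) {θ q : E → ℝ}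
    (hθ : Continuous θ) (hq : Continuous q) {e : Fin m → E} {u : E → ℂ} (hu : ContDiff ℝ ∞ u) :
    Continuous (kineticOp b θ q e u) := by
  have h1 := hu.continuous
  have h2 := hu.continuous_fderiv (by simp)
  have h3 := fun j => (contDiff_fderiv_apply_const hu (e j)).continuous_fderiv (by simp)
  unfold kineticOp
  fun_prop

theorem energyDefect_eq_zero_off_tsupport {m : ℕ} {b : E → E} {θ q : E → ℝ} {e : Fin m → E}
    {w : E → ℝ} {u : E → ℂ} {x : E} (hx : x ∉ tsupport u) : energyDefect b θ q e w u x = 0 := by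
  simp [energyDefect, image_eq_zero_of_notMem_tsupport hx, fderiv_eq_zero_off_tsupport hx]

theorem continuous_energyDefect {m : ℕ} {b : E → E} (hbc : Continuous b) {θ q : E → ℝ}
    (hθ : Continuous θ) (hq : Continuous q) {e : Fin m → E} {w : E → ℝ} (hw : ContDiff ℝ 1 w)
    {u : E → ℂ} (hu : ContDiff ℝ ∞ u) : Continuous (energyDefect b θ q e w u) := by
  have h0 := continuous_kineticOp hbc hθ hq (e := e) hu
  have h1 := hu.continuous
  have h2 := hu.continuous_fderiv (by simp)
  have h3 := hw.continuous
  have h4 := hw.continuous_fderiv one_ne_zero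
  unfold energyDefect
  fun_prop

end Pointwise

/-! ### Divergence-free fields and integrated energy identities -/

section Energy

variable {E : Type*} [NormedAddCommGroup E] [NormedSpace ℝ E] [MeasurableSpace E] [BorelSpace E]
  [FiniteDimensional ℝ E] (μ : Measure E) [μ.IsAddHaarMeasure]

/-- A continuous function that vanishes off the support of `u` is integrable. -/
theorem integrable_of_eq_zero_off_tsupport {X F G : Type*} [TopologicalSpace X] [R1Space X] [MeasurableSpace X]
    [OpensMeasurableSpace X] [NormedAddCommGroup F] [Zero G] {μ : Measure X}
    [IsFiniteMeasureOnCompacts μ]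
    {u : X → G} (hu : HasCompactSupport u) {f : X → F} [SecondCountableTopologyEither X F]
    (hf : Continuous f) (h0 : ∀ x, x ∉ tsupport u → f x = 0) : Integrable f μ :=
  hf.integrable_of_hasCompactSupport (HasCompactSupport.intro hu h0)

/-- Integration by parts in the direction v alone: c needs a derivative only along v. This lets
merely continuous coefficients in x multiply derivatives in y. -/
theorem integral_mul_fderiv_eq_zero {c : E → ℝ} {g : E → ℝ} {v : E} (hc : Continuous c)
    (hcv : ∀ x, HasLineDerivAt ℝ c 0 x v) (hg : ContDiff ℝ 1 g) (hgs : HasCompactSupport g) :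
    ∫ x, c x * fderiv ℝ g x v ∂μ = 0 := by
  have hg' : Continuous fun x => fderiv ℝ g x v :=
    (hg.continuous_fderiv one_ne_zero).clm_apply continuous_const
  have hgs' : HasCompactSupport fun x => fderiv ℝ g x v := hgs.fderiv_apply ℝ v
  have h := integral_bilinear_hasLineDerivAt_right_eq_neg_left_of_integrable (μ := μ)
    (f := c) (f' := fun _ => 0) (g := g) (g' := fun x => fderiv ℝ g x v) (v := v)
    (B := ContinuousLinearMap.mul ℝ ℝ) (by simp)
    ((hc.mul hg').integrable_of_hasCompactSupport (hgs'.mul_left))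
    ((hc.mul hg.continuous).integrable_of_hasCompactSupport (hgs.mul_left))
    (fun x _ => hcv x)
    (fun x _ => ((hg.differentiable one_ne_zero x).hasFDerivAt).hasLineDerivAt v)
  simpa using h

theorem integral_fderiv_const_eq_zero {g : E → ℝ} (v : E) (hg : ContDiff ℝ 1 g)
    (hgs : HasCompactSupport g) : ∫ x, fderiv ℝ g x v ∂μ = 0 := by
  have := integral_mul_fderiv_eq_zero μ (c := fun _ => 1) (v := v) continuous_const
    (fun x => by simpa using (hasFDerivAt_const (1 : ℝ) x).hasLineDerivAt v) hg hgs
  simpa using this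

/-- The vector field `b` is divergence free in the sense of distributions. -/
def DivergenceFree (b : E → E) : Prop :=
  ∀ g : E → ℝ, ContDiff ℝ 1 g → HasCompactSupport g → ∫ x, fderiv ℝ g x (b x) ∂μ = 0

/-- Each coefficient is constant along its own direction, so the summands integrate to zero one at a
time, without differentiability of b. -/
theorem divergenceFree_of_sum {ι : Type*} [Fintype ι] {b : E → E} (c : ι → E → ℝ) (v : ι → E)
    (hb : ∀ x, b x = ∑ i, c i x • v i) (hc : ∀ i, Continuous (c i))
    (hcv : ∀ i x, HasLineDerivAt ℝ (c i) 0 x (v i)) : DivergenceFree μ b := by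
  intro g hg hgs
  have : ∀ x, fderiv ℝ g x (b x) = ∑ i, c i x * fderiv ℝ g x (v i) := by
    intro x; simp [hb]
  simp_rw [this]
  rw [integral_finsetSum]
  · exact Finset.sum_eq_zero fun i _ => integral_mul_fderiv_eq_zero μ (hc i) (hcv i) hg hgs
  · intro i _
    exact ((hc i).mul ((hg.continuous_fderiv one_ne_zero).clm_apply
      continuous_const)).integrable_of_hasCompactSupport ((hgs.fderiv_apply ℝ (v i)).mul_left)

theorem integral_energyDefect {m : ℕ} {b : E → E} (hb : DivergenceFree μ b) (hbc : Continuous b)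
    {θ q : E → ℝ} {e : Fin m → E} {w : E → ℝ} {u : E → ℂ}
    (hw : ContDiff ℝ 1 w) (hu : ContDiff ℝ ∞ u) (hus : HasCompactSupport u) :
    ∫ x, energyDefect b θ q e w u x ∂μ = 0 := by
  simp_rw [energyDefect_eq hw hu]
  have hu1 : ContDiff ℝ 1 u := hu.of_le (by simp)
  have c1 : ContDiff ℝ 1 fun z => 1 / 2 * (w z * ⟪u z, u z⟫) :=
    contDiff_const.mul (hw.mul (hu1.inner ℝ hu1))
  have c2 : ∀ j, ContDiff ℝ 1 fun z => w z * ⟪u z, fderiv ℝ u z (e j)⟫ := fun j =>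
    hw.mul (hu1.inner ℝ ((contDiff_fderiv_apply_const hu (e j)).of_le (by simp)))
  have s1 : HasCompactSupport fun z => 1 / 2 * (w z * ⟪u z, u z⟫) :=
    HasCompactSupport.intro hus fun x hx => by simp [image_eq_zero_of_notMem_tsupport hx]
  have s2 : ∀ j, HasCompactSupport fun z => w z * ⟪u z, fderiv ℝ u z (e j)⟫ := fun j =>
    HasCompactSupport.intro hus fun x hx => by simp [image_eq_zero_of_notMem_tsupport hx]
  have i2 : ∀ j, Integrable (fun x => fderiv ℝ (fun z => w z * ⟪u z, fderiv ℝ u z (e j)⟫) x (e j))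
      μ := fun j => (((c2 j).continuous_fderiv one_ne_zero).clm_apply
        continuous_const).integrable_of_hasCompactSupport ((s2 j).fderiv_apply ℝ _)
  rw [integral_sub, integral_finsetSum, hb _ c1 s1, Finset.sum_eq_zero, sub_zero]
  · exact fun j _ => integral_fderiv_const_eq_zero μ _ (c2 j) (s2 j)
  · exact fun j _ => i2 j
  · refine ((c1.continuous_fderiv one_ne_zero).clm_apply hbc).integrable_of_hasCompactSupport ?_
    exact (s1.fderiv ℝ).mono' fun x hx => subset_closure fun h0 => hx
      (DFunLike.congr_fun h0 (b x))
  · exact integrable_finsetSum _ fun j _ => i2 j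

/-- A pointwise bound up to an energy defect integrates to a bound. -/
theorem integral_le_of_le_add_energyDefect {m : ℕ} {b : E → E} (hb : DivergenceFree μ b)
    (hbc : Continuous b) {θ q : E → ℝ} (hθ : Continuous θ) (hq : Continuous q) {e : Fin m → E}
    {w : E → ℝ} (hw : ContDiff ℝ 1 w) {u : E → ℂ} (hu : ContDiff ℝ ∞ u)
    (hus : HasCompactSupport u) {f g : E → ℝ} (hf : Integrable f μ) (hg : Integrable g μ)
    (c : ℝ) (h : ∀ x, f x ≤ g x + c * energyDefect b θ q e w u x) :
    ∫ x, f x ∂μ ≤ ∫ x, g x ∂μ := by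
  have hi : Integrable (energyDefect b θ q e w u) μ :=
    integrable_of_eq_zero_off_tsupport hus (continuous_energyDefect hbc hθ hq hw hu)
      fun x hx => energyDefect_eq_zero_off_tsupport hx
  calc ∫ x, f x ∂μ ≤ ∫ x, g x + c * energyDefect b θ q e w u x ∂μ :=
        integral_mono hf (hg.add (hi.const_mul c)) h
    _ = ∫ x, g x ∂μ := by
        rw [integral_add hg (hi.const_mul c), integral_const_mul,
          integral_energyDefect μ hb hbc hw hu hus]; simp

end Energy

end

noncomputable section

/-! ### Powers of the Japanese bracket -/

section Bracket

variable {n : ℕ}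

theorem one_le_japaneseBracket (v : Rn n) : 1 ≤ japaneseBracket v := by
  rw [japaneseBracket, Real.one_le_sqrt]; nlinarith [sq_nonneg ‖v‖]

theorem japaneseBracket_pos (v : Rn n) : 0 < japaneseBracket v :=
  one_pos.trans_le (one_le_japaneseBracket v)

theorem japaneseBracket_sq (v : Rn n) : japaneseBracket v ^ 2 = 1 + ‖v‖ ^ 2 :=
  Real.sq_sqrt (by positivity)

theorem norm_le_japaneseBracket (v : Rn n) : ‖v‖ ≤ japaneseBracket v :=
  Real.le_sqrt_of_sq_le (by linarith)

theorem japaneseBracket_rpow (v : Rn n) (r : ℝ) :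
    japaneseBracket v ^ r = (1 + ‖v‖ ^ 2) ^ (r / 2) := by
  rw [japaneseBracket, Real.sqrt_eq_rpow, ← Real.rpow_mul (by positivity)]; ring_nf

theorem contDiff_japaneseBracket_rpow {E : Type*} [NormedAddCommGroup E] [NormedSpace ℝ E]
    {W : E → Rn n} {k : WithTop ℕ∞} (hW : ContDiff ℝ k W) (r : ℝ) :
    ContDiff ℝ k fun x => japaneseBracket (W x) ^ r := by
  simp_rw [japaneseBracket_rpow]
  exact (contDiff_const.add (hW.norm_sq ℝ)).rpow_const_of_ne fun x => by positivity

theorem hasFDerivAt_japaneseBracket_rpow {E : Type*} [NormedAddCommGroup E] [NormedSpace ℝ E]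
    {W : E → Rn n} {W' : E →L[ℝ] Rn n} {x : E} (hW : HasFDerivAt W W' x) (r : ℝ) :
    HasFDerivAt (fun x => japaneseBracket (W x) ^ r)
      ((r * japaneseBracket (W x) ^ (r - 2)) • (innerSL ℝ (W x)).comp W') x := by
  simp_rw [japaneseBracket_rpow]
  have h := ((hW.norm_sq.const_add 1).rpow_const (p := r / 2)
    (Or.inl (by positivity : (1 + ‖W x‖ ^ 2 : ℝ) ≠ 0)))
  convert! h using 1
  ext v
  simp
  rw [show (r - 2) / 2 = r / 2 - 1 by ring]
  ring

/-- Cauchy–Schwarz and |w| ≤ ⟨w⟩: differentiating costs one power of the bracket and gains the size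
of W'. -/
theorem abs_fderiv_japaneseBracket_rpow_le {E : Type*} [NormedAddCommGroup E] [NormedSpace ℝ E]
    (W' : E →L[ℝ] Rn n) (w : Rn n) (r : ℝ) (v : E) :
    |((r * japaneseBracket w ^ (r - 2)) • (innerSL ℝ w).comp W') v|
      ≤ |r| * japaneseBracket w ^ (r - 1) * (‖W'‖ * ‖v‖) := by
  have h1 : |⟪w, W' v⟫| ≤ japaneseBracket w * (‖W'‖ * ‖v‖) :=
    (abs_real_inner_le_norm _ _).trans (mul_le_mul (norm_le_japaneseBracket w) (W'.le_opNorm v)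
      (norm_nonneg _) (japaneseBracket_pos w).le)
  have h2 : japaneseBracket w ^ (r - 1) = japaneseBracket w ^ (r - 2) * japaneseBracket w := by
    rw [← Real.rpow_add_one (japaneseBracket_pos w).ne']; ring_nf
  have h3 : 0 ≤ japaneseBracket w ^ (r - 2) := Real.rpow_nonneg (japaneseBracket_pos w).le _
  simp only [FunLike.coe_smul, Pi.smul_apply, ContinuousLinearMap.comp_apply,
    innerSL_apply_apply, smul_eq_mul, abs_mul, abs_of_nonneg h3]
  rw [h2]
  calc |r| * japaneseBracket w ^ (r - 2) * |⟪w, W' v⟫|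
      ≤ |r| * japaneseBracket w ^ (r - 2) * (japaneseBracket w * (‖W'‖ * ‖v‖)) := by gcongr
    _ = _ := by ring

/-- Lower powers are absorbed by higher powers. -/
theorem exists_rpow_le_mul_rpow_add {p q : ℝ} (hpq : p < q) {ε : ℝ} (hε : 0 < ε) :
    ∃ C : ℝ, 0 ≤ C ∧ ∀ t : ℝ, 1 ≤ t → t ^ p ≤ ε * t ^ q + C := by
  have h := (tendsto_rpow_neg_atTop (sub_pos.2 hpq)).eventually (gt_mem_nhds hε)
  obtain ⟨R, hR⟩ := Filter.eventually_atTop.1 h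
  have hR1 : (1 : ℝ) ≤ max R 1 := le_max_right _ _
  -- The absolute value in the exponent makes the constant valid for negative p too.
  refine ⟨(max R 1) ^ |p|, by positivity, fun t ht => ?_⟩
  have ht0 : 0 < t := one_pos.trans_le ht
  rcases le_total R t with h1 | h1
  · have h2 : t ^ p = t ^ (-(q - p)) * t ^ q := by rw [← Real.rpow_add ht0]; ring_nf
    rw [h2]
    have := mul_le_mul_of_nonneg_right (hR t h1).le (Real.rpow_nonneg ht0.le q)
    have : 0 ≤ (max R 1) ^ |p| := by positivity
    linarith
  · have : t ^ p ≤ (max R 1) ^ |p| :=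
      (Real.rpow_le_rpow_of_exponent_le ht (le_abs_self p)).trans
        (Real.rpow_le_rpow ht0.le (h1.trans (le_max_left _ _)) (abs_nonneg p))
    have : 0 ≤ ε * t ^ q := by positivity
    linarith

end Bracket

/-! ### The Fokker–Planck operator on phase space -/

section PhaseSpaceOperator

variable {n : ℕ}

/-- The Hamiltonian vector field `(y, -W(x) - J(x) y)` on phase space. -/
def transportField (W : Rn n → Rn n) (J : Rn n → Rn n →L[ℝ] Rn n) (p : PhaseSpace n) :
    PhaseSpace n := (p.2, -W p.1 - J p.1 p.2)

/-- The potential `|y|² / 4 - n / 2`. -/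
def oscillatorPotential (n : ℕ) (y : Rn n) : ℝ := ‖y‖ ^ 2 / 4 - n / 2

/-- The Fokker-Planck operator with force field `W` and magnetic matrix `J`. -/
def fokkerPlanckOp (W : Rn n → Rn n) (J : Rn n → Rn n →L[ℝ] Rn n) (u : PhaseSpace n → ℂ) :
    PhaseSpace n → ℂ :=
  kineticOp (transportField W J) 0 (fun p => oscillatorPotential n p.2)
    (fun j : Fin n => ((0, stdVec j) : PhaseSpace n)) u

/-- `|∂_y u|²`. -/
def gradYSq (u : PhaseSpace n → ℂ) (p : PhaseSpace n) : ℝ := ∑ j, ‖partialY j u p‖ ^ 2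

theorem gradYSq_nonneg (u : PhaseSpace n → ℂ) (p : PhaseSpace n) : 0 ≤ gradYSq u p := by
  unfold gradYSq; positivity

theorem sum_smul_stdVec (y : Rn n) : ∑ j, y j • stdVec j = y := by
  ext i; simp [stdVec, Pi.single_apply]

instance : (volume : Measure (PhaseSpace n)).IsAddHaarMeasure :=
  Measure.prod.instIsAddHaarMeasure volume volume

theorem continuous_transportField {W : Rn n → Rn n} {J : Rn n → Rn n →L[ℝ] Rn n}
    (hW : Continuous W) (hJ : Continuous J) : Continuous (transportField W J) := by
  unfold transportField; fun_prop

/-- In the standard frame, y_j does not vary along x_j, and the j-th force component does not vary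
along y_j since J has zero diagonal. Continuity of J is therefore enough. -/
theorem divergenceFree_transportField {W : Rn n → Rn n} {J : Rn n → Rn n →L[ℝ] Rn n}
    (hW : Continuous W) (hJ : Continuous J) (hskew : ∀ x y, ⟪J x y, y⟫ = 0) :
    DivergenceFree volume (transportField W J) := by
  refine divergenceFree_of_sum volume (ι := Fin n ⊕ Fin n)
    (Sum.elim (fun j p => p.2 j) (fun j p => (-W p.1 - J p.1 p.2) j))
    (Sum.elim (fun j => (stdVec j, 0)) (fun j => (0, stdVec j))) ?_ ?_ ?_
  · intro p
    rw [Fintype.sum_sum_type]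
    simp only [Sum.elim_inl, Sum.elim_inr]
    ext1
    · simpa [transportField, Prod.fst_sum] using (sum_smul_stdVec p.2).symm
    · simpa [transportField, Prod.snd_sum] using (sum_smul_stdVec (-W p.1 - J p.1 p.2)).symm
  · rintro (j | j)
    · simp only [Sum.elim_inl]; fun_prop
    · simp only [Sum.elim_inr]; fun_prop
  · rintro (j | j) p
    · simp [HasLineDerivAt, hasDerivAt_const]
    -- Skewness tested on a basis vector gives the vanishing diagonal entry.
    · have : (J p.1 (stdVec j)) j = 0 := by
        have := hskew p.1 (stdVec j)
        rw [stdVec, EuclideanSpace.inner_single_right] at this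
        simpa using this
      simp [HasLineDerivAt, this, hasDerivAt_const]

/-- The hypotheses on the force field `W` and the magnetic matrix `J` for the weighted estimate. -/
structure AdmissibleField (K s : ℝ) (W : Rn n → Rn n) (J : Rn n → Rn n →L[ℝ] Rn n) : Prop where
  one_le : 1 ≤ K
  contDiff : ContDiff ℝ 1 W
  continuous : Continuous J
  skew : ∀ x y, ⟪J x y, y⟫ = 0
  norm_fderiv_le : ∀ x, ‖fderiv ℝ W x‖ ≤ K * japaneseBracket (W x) ^ s
  norm_le : ∀ x, ‖J x‖ ≤ K * japaneseBracket (W x) ^ (2 / 3 : ℝ)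

end PhaseSpaceOperator

end

noncomputable section

/-! ### Scalar inequalities behind the three multipliers -/

section ScalarInequalities

theorem two_mul_le_div_add_mul {ε : ℝ} (hε : 0 < ε) (a b : ℝ) :
    2 * (a * b) ≤ ε * a ^ 2 + b ^ 2 / ε := by
  have h : ε * a ^ 2 + b ^ 2 / ε - 2 * (a * b) = (ε * a - b) ^ 2 / ε := by
    field_simp; ring
  have : 0 ≤ (ε * a - b) ^ 2 / ε := by positivity
  linarith

-- At a point of phase space: l = Λ^{1/3}, m = Λ^{s-2/3}, Y = |y|, N = |u|, p = |Pu|, g = |∂_y u|²,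
-- and I is the real pairing of u with Pu. D is the transport derivative of the weight, S the term
-- with ∂_y of the weight, and d the energy defect, which integrates to zero.
variable {ε K m l Y N p g I D S d : ℝ}

/-- The algebra behind the multiplier `⟨W⟩^{2/3}`. -/
theorem weight_multiplier_bound {n : ℕ} {C₁ : ℝ} (hC₁ : 0 ≤ C₁) (hε : 0 < ε) (hK : 1 ≤ K)
    (hl : 1 ≤ l) (hg : 0 ≤ g) (hI : |I| ≤ N * p)
    (hD : |D| ≤ K * m * l * Y)
    (hm1 : m ^ 2 ≤ ε / (8 * K ^ 2) * l ^ 4 + C₁)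
    (hd : d = l ^ 2 * I - (l ^ 2 * g + 0 + (Y ^ 2 / 4 - n / 2) * l ^ 2 * N ^ 2
      - 1 / 2 * D * N ^ 2)) :
    1 / 2 * (l ^ 2 * (g + Y ^ 2 * N ^ 2)) ≤ ε * (l ^ 4 * N ^ 2)
      + (16 / ε + 2 * K ^ 2 * C₁ + 4 * (n : ℝ) ^ 2 / ε) * (p ^ 2 + N ^ 2) + (-4) * d := by
  have h1 : 4 * (l ^ 2 * I) ≤ ε / 4 * (l ^ 4 * N ^ 2) + 16 / ε * p ^ 2 := by
    have := two_mul_le_div_add_mul (show 0 < ε / 4 by positivity) (l ^ 2 * N) (2 * p)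
    have h2 : l ^ 2 * I ≤ l ^ 2 * (N * p) := by
      gcongr; exact (le_abs_self _).trans hI
    have h3 : (2 * p) ^ 2 / (ε / 4) = 16 / ε * p ^ 2 := by field_simp; ring
    rw [h3] at this
    linarith
  -- The transport error is split between the good term l²Y²N² and K²m²N²; the hypothesis on m²
  -- turns the latter into a small multiple of l⁴N².
  have h2 : 2 * (D * N ^ 2) ≤ 1 / 2 * (l ^ 2 * Y ^ 2 * N ^ 2)
      + (ε / 4 * (l ^ 4 * N ^ 2) + 2 * K ^ 2 * C₁ * N ^ 2) := by
    have h3 : D * N ^ 2 ≤ (K * m * l * Y) * N ^ 2 := by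
      gcongr; exact (le_abs_self _).trans hD
    have h4 : 2 * ((l * Y * N) * (K * m * N)) ≤ 1 / 2 * (l * Y * N) ^ 2 + 2 * (K * m * N) ^ 2 := by
      linarith [sq_nonneg (l * Y * N - 2 * (K * m * N))]
    have h5 : 2 * (K * m * N) ^ 2 ≤ 2 * K ^ 2 * N ^ 2 * (ε / (8 * K ^ 2) * l ^ 4 + C₁) := by
      rw [show 2 * (K * m * N) ^ 2 = 2 * K ^ 2 * N ^ 2 * m ^ 2 by ring]
      gcongr
    have h6 : 2 * K ^ 2 * N ^ 2 * (ε / (8 * K ^ 2) * l ^ 4 + C₁)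
        = ε / 4 * (l ^ 4 * N ^ 2) + 2 * K ^ 2 * C₁ * N ^ 2 := by
      have : K ≠ 0 := by positivity
      field_simp
      ring
    linarith
  have h3 : 2 * n * l ^ 2 * N ^ 2 ≤ ε / 4 * (l ^ 4 * N ^ 2) + 4 * (n : ℝ) ^ 2 / ε * N ^ 2 := by
    have := two_mul_le_div_add_mul (show 0 < ε / 4 by positivity) (l ^ 2 * N) (n * N)
    have h3 : (n * N) ^ 2 / (ε / 4) = 4 * (n : ℝ) ^ 2 / ε * N ^ 2 := by field_simp
    rw [h3] at this
    linarith
  have h4 : 0 ≤ l ^ 2 * g := by positivity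
  have h5 : 0 ≤ l ^ 4 * N ^ 2 := by positivity
  have hC : 0 ≤ 2 * K ^ 2 * C₁ * p ^ 2 := by positivity
  have h8 : 0 ≤ ε / 4 * (l ^ 4 * N ^ 2) := by positivity
  have h6 : 0 ≤ 16 / ε * N ^ 2 := by positivity
  have h7 : 0 ≤ 4 * (n : ℝ) ^ 2 / ε * p ^ 2 := by positivity
  rw [hd]
  linarith

/-- The algebra behind the multiplier `|y|²`. -/
theorem sq_multiplier_bound {n : ℕ} (hε : 0 < ε) (hl : 1 ≤ l)
    (hg : 0 ≤ g) (hI : |I| ≤ N * p) (hS : |S| ≤ Y ^ 2 * N ^ 2 + g) (hD : |D| ≤ 2 * (l ^ 3 * Y))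
    (hd : d = Y ^ 2 * I - (Y ^ 2 * g + S + (Y ^ 2 / 4 - n / 2) * Y ^ 2 * N ^ 2
      - 1 / 2 * D * N ^ 2)) :
    1 / 2 * (Y ^ 2 * (g + Y ^ 2 * N ^ 2)) ≤ ε * (l ^ 4 * N ^ 2)
      + (4 / ε + 2 * n + 4) * (l ^ 2 * (g + Y ^ 2 * N ^ 2)) + 8 * (p ^ 2 + N ^ 2) + (-4) * d := by
  have h1 : 4 * (Y ^ 2 * I) ≤ 1 / 2 * (Y ^ 2 * (Y ^ 2 * N ^ 2)) + 8 * p ^ 2 := by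
    have h2 : Y ^ 2 * I ≤ Y ^ 2 * (N * p) := by
      gcongr; exact (le_abs_self _).trans hI
    linarith [sq_nonneg (Y ^ 2 * N - 4 * p)]
  have hl2 : 1 ≤ l ^ 2 := one_le_pow₀ hl
  have h2 : -S ≤ l ^ 2 * (g + Y ^ 2 * N ^ 2) := by
    have h3 : -S ≤ Y ^ 2 * N ^ 2 + g := (neg_le_abs _).trans hS
    have h4 := mul_le_mul_of_nonneg_right hl2 (show 0 ≤ g + Y ^ 2 * N ^ 2 by positivity)
    linarith
  have h3 : Y ^ 2 * N ^ 2 ≤ l ^ 2 * (g + Y ^ 2 * N ^ 2) := by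
    have h4 := mul_le_mul_of_nonneg_right hl2 (show 0 ≤ Y ^ 2 * N ^ 2 by positivity)
    have h5 : 0 ≤ l ^ 2 * g := by positivity
    linarith
  have h4 : 2 * (D * N ^ 2) ≤ ε * (l ^ 4 * N ^ 2) + 4 / ε * (l ^ 2 * (g + Y ^ 2 * N ^ 2)) := by
    have h5 : D * N ^ 2 ≤ 2 * (l ^ 3 * Y) * N ^ 2 := by
      gcongr; exact (le_abs_self _).trans hD
    have h6 := two_mul_le_div_add_mul hε (l ^ 2 * N) (2 * (l * Y * N))
    have h7 : (2 * (l * Y * N)) ^ 2 / ε = 4 / ε * (l ^ 2 * (Y ^ 2 * N ^ 2)) := by ring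
    have h8 : 4 / ε * (l ^ 2 * (Y ^ 2 * N ^ 2)) ≤ 4 / ε * (l ^ 2 * (g + Y ^ 2 * N ^ 2)) := by
      gcongr; linarith
    rw [h7] at h6
    linarith
  have h5 : 0 ≤ Y ^ 2 * g := by positivity
  have h6 : (2 * n : ℝ) * (Y ^ 2 * N ^ 2) ≤ 2 * n * (l ^ 2 * (g + Y ^ 2 * N ^ 2)) := by gcongr
  linarith [sq_nonneg N]

/-- The algebra behind the multiplier `-⟨W⟩^{-2/3} W · y`. -/
theorem force_multiplier_bound {n : ℕ} {w R : ℝ} (hK : 1 ≤ K) (hl : 1 ≤ l) (hY : 0 ≤ Y)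
    (hg : 0 ≤ g) (hI : |I| ≤ N * p) (hw : |w| ≤ l * Y)
    (hS : |S| ≤ 1 / 2 * (l ^ 2 * N ^ 2 + g))
    (hR : |R| ≤ 2 * K * (l ^ 2 * Y ^ 2) + K * (l ^ 3 * Y))
    (hD : l ^ 4 - 1 + R ≤ D)
    (hd : d = w * I - (w * g + S + (Y ^ 2 / 4 - n / 2) * w * N ^ 2 - 1 / 2 * D * N ^ 2)) :
    1 / 4 * (l ^ 4 * N ^ 2) ≤ (4 + 4 * K ^ 2 + n) * (l ^ 2 * (g + Y ^ 2 * N ^ 2)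
      + Y ^ 2 * (g + Y ^ 2 * N ^ 2) + (p ^ 2 + N ^ 2)) + 1 * d := by
  have hwl : w ≤ l * Y := (le_abs_self _).trans hw
  have hwl' : -w ≤ l * Y := (neg_le_abs _).trans hw
  have h1 : -(w * I) ≤ l ^ 2 * (Y ^ 2 * N ^ 2) + p ^ 2 := by
    have h2 : |w * I| ≤ (l * Y) * (N * p) := by rw [abs_mul]; gcongr
    have := neg_le_abs (w * I)
    linarith [sq_nonneg (l * Y * N - p), sq_nonneg (l * Y * N + p)]
  have h2 : w * g ≤ l ^ 2 * g + Y ^ 2 * g := by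
    have : w * g ≤ (l * Y) * g := by gcongr
    have h3 : 0 ≤ (l - Y) ^ 2 * g := by positivity
    have h4 : 0 ≤ l ^ 2 * g + Y ^ 2 * g := by positivity
    linarith
  have h3 : Y ^ 2 / 4 * (w * N ^ 2) ≤ l ^ 2 * (Y ^ 2 * N ^ 2) + Y ^ 2 * (Y ^ 2 * N ^ 2) := by
    have h4 : Y ^ 2 / 4 * (w * N ^ 2) ≤ Y ^ 2 / 4 * ((l * Y) * N ^ 2) := by gcongr
    have h5 : 0 ≤ (l - Y) ^ 2 * (Y ^ 2 * N ^ 2) := by positivity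
    have h6 : 0 ≤ l ^ 2 * (Y ^ 2 * N ^ 2) + Y ^ 2 * (Y ^ 2 * N ^ 2) := by positivity
    linarith
  have h4 : (n : ℝ) / 2 * (-(w * N ^ 2)) ≤ n * (l ^ 2 * (Y ^ 2 * N ^ 2) + N ^ 2) := by
    have h5 : -(w * N ^ 2) ≤ 2 * (l ^ 2 * (Y ^ 2 * N ^ 2) + N ^ 2) := by
      have h6 : -w * N ^ 2 ≤ (l * Y) * N ^ 2 := by gcongr
      have h7 : 0 ≤ (l * Y - 1) ^ 2 * N ^ 2 := by positivity
      have h8 : 0 ≤ l ^ 2 * (Y ^ 2 * N ^ 2) + N ^ 2 := by positivity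
      linarith
    have h6 := mul_le_mul_of_nonneg_left h5 (Nat.cast_nonneg (α := ℝ) n)
    linarith
  have h5 : -R * N ^ 2 ≤ (2 * K + 2 * K ^ 2) * (l ^ 2 * (Y ^ 2 * N ^ 2))
      + 1 / 8 * (l ^ 4 * N ^ 2) := by
    have h6 : -R * N ^ 2 ≤ (2 * K * (l ^ 2 * Y ^ 2) + K * (l ^ 3 * Y)) * N ^ 2 := by
      gcongr; exact (neg_le_abs _).trans hR
    -- This square says K l³Y ≤ l⁴/8 + 2K²l²Y², which disposes of the magnetic part of R.
    have h7 : 0 ≤ (l ^ 2 - 4 * (K * l * Y)) ^ 2 * N ^ 2 := by positivity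
    linarith
  have h6 : l ^ 2 * N ^ 2 ≤ 1 / 8 * (l ^ 4 * N ^ 2) + 2 * N ^ 2 := by
    have h7 : 0 ≤ (l ^ 2 - 4) ^ 2 * N ^ 2 := by positivity
    linarith
  have h7 : S ≤ 1 / 2 * (l ^ 2 * N ^ 2 + g) := (le_abs_self _).trans hS
  have h8 : (l ^ 4 - 1 + R) * N ^ 2 ≤ D * N ^ 2 := by gcongr
  have h9 : g ≤ l ^ 2 * g := le_mul_of_one_le_left hg (one_le_pow₀ hl)
  have e1 : 0 ≤ l ^ 2 * g := by positivity
  have e2 : 0 ≤ Y ^ 2 * g := by positivity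
  have e3 : 0 ≤ l ^ 2 * (Y ^ 2 * N ^ 2) := by positivity
  have e4 : 0 ≤ Y ^ 2 * (Y ^ 2 * N ^ 2) := by positivity
  have e5 : 0 ≤ p ^ 2 := by positivity
  have e6 : 0 ≤ N ^ 2 := by positivity
  have e7 : 0 ≤ l ^ 4 * N ^ 2 := by positivity
  have hKK : K ≤ K ^ 2 := le_self_pow₀ hK two_ne_zero
  have main : 1 / 4 * (l ^ 4 * N ^ 2) ≤ 3 * (l ^ 2 * g) + Y ^ 2 * g
      + (2 + n + 2 * K + K ^ 2) * (l ^ 2 * (Y ^ 2 * N ^ 2)) + Y ^ 2 * (Y ^ 2 * N ^ 2) + p ^ 2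
      + (2 + n) * N ^ 2 + d := by
    have e8 : 0 ≤ K * (l ^ 2 * (Y ^ 2 * N ^ 2)) := by positivity
    have e9 : 0 ≤ n * N ^ 2 := by positivity
    rw [hd]
    linarith
  have hn : (0 : ℝ) ≤ n := by positivity
  have hc : 3 ≤ 4 + 4 * K ^ 2 + (n : ℝ) := by linarith [sq_nonneg K]
  have hc2 : 2 + n + 2 * K + K ^ 2 ≤ 4 + 4 * K ^ 2 + (n : ℝ) := by linarith [sq_nonneg K]
  have hc3 : 2 + n ≤ 4 + 4 * K ^ 2 + (n : ℝ) := by linarith [sq_nonneg K]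
  have hc4 : 1 ≤ 4 + 4 * K ^ 2 + (n : ℝ) := by linarith [sq_nonneg K]
  have f1 := mul_le_mul_of_nonneg_right hc e1
  have f2 := mul_le_mul_of_nonneg_right hc4 e2
  have f3 := mul_le_mul_of_nonneg_right hc2 e3
  have f4 := mul_le_mul_of_nonneg_right hc4 e4
  have f5 := mul_le_mul_of_nonneg_right hc4 e5
  have f6 := mul_le_mul_of_nonneg_right hc3 e6
  linarith

end ScalarInequalities

end

noncomputable section

/-! ### The weighted force estimate -/

section WeightedEstimate

variable {n : ℕ} {K s : ℝ} {W : Rn n → Rn n} {J : Rn n → Rn n →L[ℝ] Rn n} {u : PhaseSpace n → ℂ}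

theorem rpow_third_pow {t : ℝ} (ht : 0 < t) (k : ℕ) : (t ^ (1 / 3 : ℝ)) ^ k = t ^ (k / 3 : ℝ) := by
  rw [← Real.rpow_natCast, ← Real.rpow_mul ht.le]; ring_nf

theorem continuous_fokkerPlanckOp (hA : AdmissibleField K s W J) (hu : IsTestFunction u) :
    Continuous (fokkerPlanckOp W J u) :=
  continuous_kineticOp (continuous_transportField hA.contDiff.continuous hA.continuous)
    continuous_zero (by unfold oscillatorPotential; fun_prop) hu.1

theorem continuous_gradYSq (hu : IsTestFunction u) : Continuous (gradYSq u) :=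
  continuous_finsetSum _ fun _ _ =>
    (((hu.1.continuous_fderiv (by simp)).clm_apply continuous_const).norm).pow 2

theorem gradYSq_eq_zero_off_tsupport {p : PhaseSpace n} (hp : p ∉ tsupport u) :
    gradYSq u p = 0 := by
  simp [gradYSq, partialY, fderiv_eq_zero_off_tsupport hp]

theorem continuous_japaneseBracket_rpow (hW : Continuous W) (r : ℝ) :
    Continuous fun p : PhaseSpace n => japaneseBracket (W p.1) ^ r :=
  (contDiff_japaneseBracket_rpow (k := 0) (contDiff_zero.2 hW) r).continuous.comp continuous_fst

theorem integrable_weight_mul_norm_sq (hu : IsTestFunction u) {w : PhaseSpace n → ℝ}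
    (hw : Continuous w) : Integrable fun p => w p * ‖u p‖ ^ 2 :=
  integrable_of_eq_zero_off_tsupport hu.2 (hw.mul (hu.1.continuous.norm.pow 2)) fun p hp => by
    simp [image_eq_zero_of_notMem_tsupport hp]

theorem integrable_weight_mul_energy (hu : IsTestFunction u) {w : PhaseSpace n → ℝ}
    (hw : Continuous w) :
    Integrable fun p => w p * (gradYSq u p + ‖p.2‖ ^ 2 * ‖u p‖ ^ 2) :=
  integrable_of_eq_zero_off_tsupport hu.2 (hw.mul ((continuous_gradYSq hu).add
    ((continuous_snd.norm.pow 2).mul (hu.1.continuous.norm.pow 2)))) fun p hp => by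
    simp [image_eq_zero_of_notMem_tsupport hp, gradYSq_eq_zero_off_tsupport hp]

theorem integrable_norm_sq_add (hA : AdmissibleField K s W J) (hu : IsTestFunction u) :
    Integrable fun p => ‖fokkerPlanckOp W J u p‖ ^ 2 + ‖u p‖ ^ 2 :=
  integrable_of_eq_zero_off_tsupport hu.2 (((continuous_fokkerPlanckOp hA hu).norm.pow 2).add
    (hu.1.continuous.norm.pow 2)) fun p hp => by
    simp [image_eq_zero_of_notMem_tsupport hp, fokkerPlanckOp, kineticOp_eq_zero_off_tsupport hp]

/-- Integration of a pointwise bound that involves an energy defect of `fokkerPlanckOp`. -/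
theorem integral_le_of_fokkerPlanck_energyDefect (hA : AdmissibleField K s W J)
    (hu : IsTestFunction u) {w : PhaseSpace n → ℝ} (hw : ContDiff ℝ 1 w)
    {f g : PhaseSpace n → ℝ} (hf : Integrable f) (hg : Integrable g) (c : ℝ)
    (h : ∀ p, f p ≤ g p + c * energyDefect (transportField W J) 0
      (fun p => oscillatorPotential n p.2) (fun j : Fin n => ((0, stdVec j) : PhaseSpace n)) w u p) :
    ∫ p, f p ≤ ∫ p, g p :=
  integral_le_of_le_add_energyDefect volume
    (divergenceFree_transportField hA.contDiff.continuous hA.continuous hA.skew)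
    (continuous_transportField hA.contDiff.continuous hA.continuous) continuous_zero
    (by unfold oscillatorPotential; fun_prop) hw hu.1 hu.2 hf hg c h

theorem AdmissibleField.norm_fderiv_le_mul (hA : AdmissibleField K s W J) (x : Rn n) :
    ‖fderiv ℝ W x‖ ≤ K * (japaneseBracket (W x) ^ (s - 2 / 3)
      * (japaneseBracket (W x) ^ (1 / 3 : ℝ)) ^ 2) := by
  refine (hA.norm_fderiv_le x).trans_eq ?_
  rw [rpow_third_pow (japaneseBracket_pos _), ← Real.rpow_add (japaneseBracket_pos _)]
  norm_num

theorem one_le_japaneseBracket_rpow (v : Rn n) {r : ℝ} (hr : 0 ≤ r) : 1 ≤ japaneseBracket v ^ r :=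
  Real.one_le_rpow (one_le_japaneseBracket v) hr

theorem AdmissibleField.hasFDerivAt (hA : AdmissibleField K s W J) (x : Rn n) :
    HasFDerivAt W (fderiv ℝ W x) x := (hA.contDiff.differentiable one_ne_zero x).hasFDerivAt

/-- Multiplier Λ^{2/3}. It depends on x alone, so the only error is its transport derivative; a
small fraction of the Λ^{4/3} norm is left on the right, to be absorbed later. -/
theorem exists_weight_estimate (n : ℕ) {K s : ℝ} (hK : 1 ≤ K) (hs : s < 4 / 3) {ε : ℝ}
    (hε : 0 < ε) : ∃ C : ℝ, 0 ≤ C ∧ ∀ (W : Rn n → Rn n) (J : Rn n → Rn n →L[ℝ] Rn n),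
      AdmissibleField K s W J → ∀ u : PhaseSpace n → ℂ, IsTestFunction u →
      ∫ p, japaneseBracket (W p.1) ^ (2 / 3 : ℝ) * (gradYSq u p + ‖p.2‖ ^ 2 * ‖u p‖ ^ 2)
        ≤ ε * (∫ p, japaneseBracket (W p.1) ^ (4 / 3 : ℝ) * ‖u p‖ ^ 2)
          + C * ∫ p, (‖fokkerPlanckOp W J u p‖ ^ 2 + ‖u p‖ ^ 2) := by
  have hε2 : 0 < ε / 2 := by positivity
  -- This is where s < 4/3 has to be strict: it makes the exponent 2s - 4/3 of m² smaller than 4/3.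
  obtain ⟨C₁, hC₁, hm⟩ := exists_rpow_le_mul_rpow_add (p := 2 * s - 4 / 3) (q := 4 / 3)
    (by linarith) (ε := (ε / 2) / (8 * K ^ 2)) (by positivity)
  refine ⟨2 * (16 / (ε / 2) + 2 * K ^ 2 * C₁ + 4 * (n : ℝ) ^ 2 / (ε / 2)), by positivity,
    fun W J hA u hu => ?_⟩
  have hWc := hA.contDiff.continuous
  have iA := integrable_weight_mul_norm_sq hu (continuous_japaneseBracket_rpow hWc (4 / 3))
  have iB := integrable_weight_mul_energy hu (continuous_japaneseBracket_rpow hWc (2 / 3))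
  have iF := integrable_norm_sq_add hA hu
  have key := integral_le_of_fokkerPlanck_energyDefect hA hu
    (w := fun p => japaneseBracket (W p.1) ^ (2 / 3 : ℝ))
    (contDiff_japaneseBracket_rpow (hA.contDiff.comp contDiff_fst) _)
    (iB.const_mul (1 / 2)) ((iA.const_mul (ε / 2)).add (iF.const_mul
      (16 / (ε / 2) + 2 * K ^ 2 * C₁ + 4 * (n : ℝ) ^ 2 / (ε / 2)))) (-4) ?_
  · simp only [Pi.add_apply] at key
    rw [integral_add (iA.const_mul _) (iF.const_mul _), integral_const_mul, integral_const_mul,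
      integral_const_mul] at key
    linarith
  · intro p
    have hΛ := japaneseBracket_pos (W p.1)
    have hw : HasFDerivAt (fun p : PhaseSpace n => japaneseBracket (W p.1) ^ (2 / 3 : ℝ)) _ p :=
      hasFDerivAt_japaneseBracket_rpow ((hA.hasFDerivAt p.1).comp p hasFDerivAt_fst) (2 / 3)
    have h2 := rpow_third_pow hΛ 2
    have h4 := rpow_third_pow hΛ 4
    push_cast at h2 h4
    simp only [Pi.add_apply]
    rw [← h2, ← h4]
    refine weight_multiplier_bound hC₁ hε2 hA.one_le
      (one_le_japaneseBracket_rpow _ (by norm_num)) (gradYSq_nonneg u p)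
      (I := ⟪u p, fokkerPlanckOp W J u p⟫) (abs_real_inner_le_norm _ _)
      (m := japaneseBracket (W p.1) ^ (s - 2 / 3)) (Y := ‖p.2‖)
      (D := fderiv ℝ (fun p : PhaseSpace n => japaneseBracket (W p.1) ^ (2 / 3 : ℝ)) p
        (transportField W J p)) ?_ ?_ ?_
    · rw [hw.fderiv]
      have e1 := abs_fderiv_japaneseBracket_rpow_le (fderiv ℝ W p.1) (W p.1) (2 / 3) p.2
      refine le_trans (le_of_eq ?_) (e1.trans ?_)
      · simp [transportField]
      · have e2 := hA.norm_fderiv_le_mul p.1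
        set Λ := japaneseBracket (W p.1)
        have e3 : Λ ^ (2 / 3 - 1 : ℝ) * (Λ ^ (1 / 3 : ℝ)) ^ 2 = Λ ^ (1 / 3 : ℝ) := by
          rw [rpow_third_pow hΛ, ← Real.rpow_add hΛ]; norm_num
        calc |(2 / 3 : ℝ)| * Λ ^ (2 / 3 - 1 : ℝ) * (‖fderiv ℝ W p.1‖ * ‖p.2‖)
            ≤ 1 * Λ ^ (2 / 3 - 1 : ℝ) * (K * (Λ ^ (s - 2 / 3) * (Λ ^ (1 / 3 : ℝ)) ^ 2) * ‖p.2‖) := by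
              gcongr
              rw [abs_of_nonneg] <;> norm_num
          _ = K * Λ ^ (s - 2 / 3) * (Λ ^ (2 / 3 - 1 : ℝ) * (Λ ^ (1 / 3 : ℝ)) ^ 2) * ‖p.2‖ := by ring
          _ = _ := by rw [e3]
    · have e1 := hm _ (one_le_japaneseBracket (W p.1))
      have e2 : (japaneseBracket (W p.1) ^ (s - 2 / 3)) ^ 2
          = japaneseBracket (W p.1) ^ (2 * s - 4 / 3) := by
        rw [← Real.rpow_natCast, ← Real.rpow_mul hΛ.le]; ring_nf
      rw [e2, h4]; exact e1
    -- No derivative in y falls on a weight that depends only on x.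
    · have e0 : ∑ j : Fin n, fderiv ℝ (fun p : PhaseSpace n => japaneseBracket (W p.1) ^ (2 / 3 : ℝ))
          p ((0, stdVec j) : PhaseSpace n) * ⟪u p, fderiv ℝ u p ((0, stdVec j) : PhaseSpace n)⟫
          = 0 := by
        rw [hw.fderiv]; simp
      rw [energyDefect, e0, h2]
      simp only [oscillatorPotential, gradYSq, partialY, fokkerPlanckOp]

/-- Multiplier |y|². The magnetic field rotates y and preserves |y|², so the transport derivative is
-2y·W, bounded by 2l³Y and split between l⁴ and l²Y². -/
theorem exists_sq_estimate (n : ℕ) {K s : ℝ} {ε : ℝ}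
    (hε : 0 < ε) : ∃ C : ℝ, 0 ≤ C ∧ ∀ (W : Rn n → Rn n) (J : Rn n → Rn n →L[ℝ] Rn n),
      AdmissibleField K s W J → ∀ u : PhaseSpace n → ℂ, IsTestFunction u →
      ∫ p, ‖p.2‖ ^ 2 * (gradYSq u p + ‖p.2‖ ^ 2 * ‖u p‖ ^ 2)
        ≤ ε * (∫ p, japaneseBracket (W p.1) ^ (4 / 3 : ℝ) * ‖u p‖ ^ 2)
          + C * (∫ p, japaneseBracket (W p.1) ^ (2 / 3 : ℝ)
            * (gradYSq u p + ‖p.2‖ ^ 2 * ‖u p‖ ^ 2))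
          + C * ∫ p, (‖fokkerPlanckOp W J u p‖ ^ 2 + ‖u p‖ ^ 2) := by
  have hε2 : 0 < ε / 2 := by positivity
  refine ⟨max (2 * (4 / (ε / 2) + 2 * n + 4)) 16, by positivity, fun W J hA u hu => ?_⟩
  have hWc := hA.contDiff.continuous
  have iA := integrable_weight_mul_norm_sq hu (continuous_japaneseBracket_rpow hWc (4 / 3))
  have iB := integrable_weight_mul_energy hu (continuous_japaneseBracket_rpow hWc (2 / 3))
  have iD := integrable_weight_mul_energy hu
    (show Continuous fun p : PhaseSpace n => ‖p.2‖ ^ 2 by fun_prop)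
  have iF := integrable_norm_sq_add hA hu
  have key := integral_le_of_fokkerPlanck_energyDefect hA hu
    (w := fun p => ‖p.2‖ ^ 2) (contDiff_snd.norm_sq ℝ)
    (iD.const_mul (1 / 2)) (((iA.const_mul (ε / 2)).add (iB.const_mul
      (4 / (ε / 2) + 2 * n + 4))).add (iF.const_mul 8)) (-4) ?_
  · rw [integral_add' ((iA.const_mul _).add (iB.const_mul _)) (iF.const_mul _),
      integral_add' (iA.const_mul _) (iB.const_mul _), integral_const_mul, integral_const_mul,
      integral_const_mul, integral_const_mul] at key
    have pB : 0 ≤ ∫ p, japaneseBracket (W p.1) ^ (2 / 3 : ℝ)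
        * (gradYSq u p + ‖p.2‖ ^ 2 * ‖u p‖ ^ 2) := integral_nonneg fun p =>
      mul_nonneg (Real.rpow_nonneg (japaneseBracket_pos _).le _)
        (add_nonneg (gradYSq_nonneg u p) (by positivity))
    have pF : 0 ≤ ∫ p, (‖fokkerPlanckOp W J u p‖ ^ 2 + ‖u p‖ ^ 2) :=
      integral_nonneg fun p => by positivity
    have := mul_le_mul_of_nonneg_right (le_max_left (2 * (4 / (ε / 2) + 2 * n + 4)) 16) pB
    have := mul_le_mul_of_nonneg_right (le_max_right (2 * (4 / (ε / 2) + 2 * n + 4)) 16) pF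
    linarith
  · intro p
    have hΛ := japaneseBracket_pos (W p.1)
    have hw : HasFDerivAt (fun p : PhaseSpace n => ‖p.2‖ ^ 2) _ p := hasFDerivAt_snd.norm_sq
    have h2 := rpow_third_pow hΛ 2
    have h3 := rpow_third_pow hΛ 3
    have h4 := rpow_third_pow hΛ 4
    push_cast at h2 h3 h4
    simp only [Pi.add_apply]
    rw [← h2, ← h4]
    refine sq_multiplier_bound hε2
      (one_le_japaneseBracket_rpow _ (by norm_num)) (gradYSq_nonneg u p)
      (I := ⟪u p, fokkerPlanckOp W J u p⟫) (abs_real_inner_le_norm _ _)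
      (Y := ‖p.2‖) (S := ∑ j : Fin n, fderiv ℝ (fun p : PhaseSpace n => ‖p.2‖ ^ 2)
          p ((0, stdVec j) : PhaseSpace n) * ⟪u p, fderiv ℝ u p ((0, stdVec j) : PhaseSpace n)⟫)
      (D := fderiv ℝ (fun p : PhaseSpace n => ‖p.2‖ ^ 2) p (transportField W J p)) ?_ ?_ ?_
    · rw [hw.fderiv, EuclideanSpace.norm_sq_eq p.2, Finset.sum_mul, gradYSq,
        ← Finset.sum_add_distrib]
      refine (Finset.abs_sum_le_sum_abs _ _).trans (Finset.sum_le_sum fun j _ => ?_)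
      have e1 := abs_real_inner_le_norm (u p) (fderiv ℝ u p ((0, stdVec j) : PhaseSpace n))
      have e2 : (2 • (innerSL ℝ p.2).comp (ContinuousLinearMap.snd ℝ (Rn n) (Rn n)))
          ((0, stdVec j) : PhaseSpace n) = 2 * p.2 j := by
        simp [stdVec, EuclideanSpace.inner_single_right]
      rw [e2, abs_mul, abs_mul, abs_two, partialY, Real.norm_eq_abs]
      calc 2 * |p.2 j| * |⟪u p, fderiv ℝ u p ((0, stdVec j) : PhaseSpace n)⟫|
          ≤ 2 * |p.2 j| * (‖u p‖ * ‖fderiv ℝ u p ((0, stdVec j) : PhaseSpace n)‖) := by gcongr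
        _ ≤ _ := by nlinarith [sq_nonneg (|p.2 j| * ‖u p‖
            - ‖fderiv ℝ u p ((0, stdVec j) : PhaseSpace n)‖)]
    · rw [hw.fderiv]
      have e2 : (2 • (innerSL ℝ p.2).comp (ContinuousLinearMap.snd ℝ (Rn n) (Rn n)))
          (transportField W J p) = -(2 * ⟪p.2, W p.1⟫) := by
        -- Skewness of J: rotations leave |y|² invariant.
        have : ⟪p.2, J p.1 p.2⟫ = 0 := by rw [real_inner_comm]; exact hA.skew p.1 p.2
        simp [transportField, inner_sub_right, this]
      rw [e2, abs_neg, abs_mul, abs_two, h3]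
      have e3 := abs_real_inner_le_norm p.2 (W p.1)
      have e4 := norm_le_japaneseBracket (W p.1)
      have e5 : ‖p.2‖ * ‖W p.1‖ ≤ ‖p.2‖ * japaneseBracket (W p.1) := by gcongr
      norm_num
      linarith
    · rw [energyDefect]
      simp only [oscillatorPotential, gradYSq, partialY, fokkerPlanckOp]

/-- Multiplier -Λ^{-2/3} W·y. The transport field contains -W·∂_y, so the derivative of the
multiplier contains Λ^{-2/3}|W|², which is Λ^{4/3} up to a bounded term. This is the positive
commutator that yields the force norm. -/
theorem exists_force_estimate (n : ℕ) {K s : ℝ} (hK : 1 ≤ K) (hs : s < 4 / 3) :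
    ∃ C : ℝ, 0 ≤ C ∧ ∀ (W : Rn n → Rn n) (J : Rn n → Rn n →L[ℝ] Rn n),
      AdmissibleField K s W J → ∀ u : PhaseSpace n → ℂ, IsTestFunction u →
      ∫ p, japaneseBracket (W p.1) ^ (4 / 3 : ℝ) * ‖u p‖ ^ 2
        ≤ C * ((∫ p, japaneseBracket (W p.1) ^ (2 / 3 : ℝ)
            * (gradYSq u p + ‖p.2‖ ^ 2 * ‖u p‖ ^ 2))
          + (∫ p, ‖p.2‖ ^ 2 * (gradYSq u p + ‖p.2‖ ^ 2 * ‖u p‖ ^ 2))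
          + ∫ p, (‖fokkerPlanckOp W J u p‖ ^ 2 + ‖u p‖ ^ 2)) := by
  refine ⟨4 * (4 + 4 * K ^ 2 + n), by positivity, fun W J hA u hu => ?_⟩
  have hWc := hA.contDiff.continuous
  have iA := integrable_weight_mul_norm_sq hu (continuous_japaneseBracket_rpow hWc (4 / 3))
  have iB := integrable_weight_mul_energy hu (continuous_japaneseBracket_rpow hWc (2 / 3))
  have iD := integrable_weight_mul_energy hu
    (show Continuous fun p : PhaseSpace n => ‖p.2‖ ^ 2 by fun_prop)
  have iF := integrable_norm_sq_add hA hu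
  have cΛ := contDiff_japaneseBracket_rpow
    (hA.contDiff.comp (contDiff_fst (E := Rn n) (F := Rn n))) (-(2 / 3))
  have key := integral_le_of_fokkerPlanck_energyDefect hA hu
    (w := fun p => -(japaneseBracket (W p.1) ^ (-(2 / 3) : ℝ) * ⟪W p.1, p.2⟫))
    (cΛ.mul ((hA.contDiff.comp contDiff_fst).inner ℝ contDiff_snd)).neg
    (iA.const_mul (1 / 4)) (((iB.add iD).add iF).const_mul (4 + 4 * K ^ 2 + n)) 1 ?_
  · rw [integral_const_mul, integral_const_mul, integral_add' (iB.add iD) iF,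
      integral_add' iB iD] at key
    linarith
  · intro p
    have hΛ := japaneseBracket_pos (W p.1)
    have hWp := (hA.hasFDerivAt p.1).comp p hasFDerivAt_fst
    have hw := ((hasFDerivAt_japaneseBracket_rpow hWp (-(2 / 3))).mul
      (hWp.inner ℝ (hasFDerivAt_snd (𝕜 := ℝ) (p := p)))).neg
    have hw' : ∀ v : PhaseSpace n,
        fderiv ℝ (fun p : PhaseSpace n => -(japaneseBracket (W p.1) ^ (-(2 / 3) : ℝ)
          * ⟪W p.1, p.2⟫)) p v
        = -(((-(2 / 3) * japaneseBracket (W p.1) ^ (-(2 / 3) - 2 : ℝ)) •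
            (innerSL ℝ (W p.1)).comp (fderiv ℝ W p.1)) v.1 * ⟪W p.1, p.2⟫)
          - japaneseBracket (W p.1) ^ (-(2 / 3) : ℝ) * ⟪fderiv ℝ W p.1 v.1, p.2⟫
          - japaneseBracket (W p.1) ^ (-(2 / 3) : ℝ) * ⟪W p.1, v.2⟫ := by
      intro v
      erw [hw.fderiv]
      simp
      ring
    have h1 : japaneseBracket (W p.1) ^ (-(2 / 3) : ℝ)
        * (japaneseBracket (W p.1) ^ (1 / 3 : ℝ)) ^ 2 = 1 := by
      rw [rpow_third_pow hΛ, ← Real.rpow_add hΛ]; norm_num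
    have h2 := rpow_third_pow hΛ 2
    have h3 := rpow_third_pow hΛ 3
    have h4 := rpow_third_pow hΛ 4
    push_cast at h2 h3 h4
    norm_num at h3
    have hWn : ‖W p.1‖ ≤ (japaneseBracket (W p.1) ^ (1 / 3 : ℝ)) ^ 3 :=
      (norm_le_japaneseBracket (W p.1)).trans_eq h3.symm
    have hDW := hA.norm_fderiv_le_mul p.1
    have hJ := hA.norm_le p.1
    -- Since s - 2/3 ≤ 2/3, the derivative of W is at most K l⁴, which is affordable against the
    -- weight l^{-2}.
    have hm : japaneseBracket (W p.1) ^ (s - 2 / 3)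
        ≤ (japaneseBracket (W p.1) ^ (1 / 3 : ℝ)) ^ 2 := by
      rw [h2]
      exact Real.rpow_le_rpow_of_exponent_le (one_le_japaneseBracket _) (by linarith)
    have hl := one_le_japaneseBracket_rpow (W p.1) (show (0 : ℝ) ≤ 1 / 3 by norm_num)
    have hLp : 0 < japaneseBracket (W p.1) ^ (-(2 / 3) : ℝ) := Real.rpow_pos_of_pos hΛ _
    have hK0 : 0 ≤ K := zero_le_one.trans hA.one_le
    have hΛ2 : ‖W p.1‖ ^ 2 = (japaneseBracket (W p.1) ^ (1 / 3 : ℝ)) ^ 6 - 1 := by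
      have := japaneseBracket_sq (W p.1)
      have h5 : (japaneseBracket (W p.1) ^ (1 / 3 : ℝ)) ^ 6 = japaneseBracket (W p.1) ^ 2 := by
          calc (japaneseBracket (W p.1) ^ (1 / 3 : ℝ)) ^ 6
            = ((japaneseBracket (W p.1) ^ (1 / 3 : ℝ)) ^ 3) ^ 2 := by ring
          _ = _ := by rw [h3]
      linarith
    have hr := abs_fderiv_japaneseBracket_rpow_le (fderiv ℝ W p.1) (W p.1) (-(2 / 3)) p.2
    have h53 : japaneseBracket (W p.1) ^ (-(2 / 3) - 1 : ℝ)
        * (japaneseBracket (W p.1) ^ (1 / 3 : ℝ)) ^ 3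
        = japaneseBracket (W p.1) ^ (-(2 / 3) : ℝ) := by
      rw [rpow_third_pow hΛ, ← Real.rpow_add hΛ]; norm_num
    have h53p : 0 < japaneseBracket (W p.1) ^ (-(2 / 3) - 1 : ℝ) := Real.rpow_pos_of_pos hΛ _
    simp only [Pi.add_apply]
    rw [← h2, ← h4]
    rw [← h2] at hJ
    refine force_multiplier_bound
      (w := -(japaneseBracket (W p.1) ^ (-(2 / 3) : ℝ) * ⟪W p.1, p.2⟫))
      (R := -((-(2 / 3) * japaneseBracket (W p.1) ^ (-(2 / 3) - 2 : ℝ)) •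
            (innerSL ℝ (W p.1)).comp (fderiv ℝ W p.1)) p.2 * ⟪W p.1, p.2⟫
          - japaneseBracket (W p.1) ^ (-(2 / 3) : ℝ) * ⟪fderiv ℝ W p.1 p.2, p.2⟫
          + japaneseBracket (W p.1) ^ (-(2 / 3) : ℝ) * ⟪W p.1, J p.1 p.2⟫) hA.one_le
      hl (norm_nonneg p.2) (gradYSq_nonneg u p)
      (I := ⟪u p, fokkerPlanckOp W J u p⟫) (abs_real_inner_le_norm _ _)
      (S := ∑ j : Fin n, fderiv ℝ (fun p : PhaseSpace n =>
          -(japaneseBracket (W p.1) ^ (-(2 / 3) : ℝ) * ⟪W p.1, p.2⟫))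
          p ((0, stdVec j) : PhaseSpace n) * ⟪u p, fderiv ℝ u p ((0, stdVec j) : PhaseSpace n)⟫)
      (D := fderiv ℝ (fun p : PhaseSpace n =>
          -(japaneseBracket (W p.1) ^ (-(2 / 3) : ℝ) * ⟪W p.1, p.2⟫)) p (transportField W J p))
      ?_ ?_ ?_ ?_ ?_
    · rw [abs_neg, abs_mul, abs_of_pos hLp]
      generalize japaneseBracket (W p.1) ^ (1 / 3 : ℝ) = l at *
      calc japaneseBracket (W p.1) ^ (-(2 / 3) : ℝ) * |⟪W p.1, p.2⟫|
          ≤ japaneseBracket (W p.1) ^ (-(2 / 3) : ℝ) * (l ^ 3 * ‖p.2‖) := by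
            gcongr; exact (abs_real_inner_le_norm _ _).trans (by gcongr)
        _ = (japaneseBracket (W p.1) ^ (-(2 / 3) : ℝ) * l ^ 2) * (l * ‖p.2‖) := by ring
        _ = l * ‖p.2‖ := by rw [h1, one_mul]
    · have e1 : ∀ j : Fin n, fderiv ℝ (fun p : PhaseSpace n =>
          -(japaneseBracket (W p.1) ^ (-(2 / 3) : ℝ) * ⟪W p.1, p.2⟫))
          p ((0, stdVec j) : PhaseSpace n)
          = -(japaneseBracket (W p.1) ^ (-(2 / 3) : ℝ) * W p.1 j) := by
        intro j; rw [hw']; simp [stdVec, EuclideanSpace.inner_single_right]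
      simp_rw [e1]
      have e2 : ∑ j, (japaneseBracket (W p.1) ^ (-(2 / 3) : ℝ) * W p.1 j) ^ 2
          ≤ (japaneseBracket (W p.1) ^ (1 / 3 : ℝ)) ^ 2 := by
        simp_rw [mul_pow]
        rw [← Finset.mul_sum]
        have e3 : ∑ j, W p.1 j ^ 2 = ‖W p.1‖ ^ 2 := by
          rw [EuclideanSpace.norm_sq_eq]; simp
        rw [e3, hΛ2]
        generalize japaneseBracket (W p.1) ^ (1 / 3 : ℝ) = l at *
        generalize japaneseBracket (W p.1) ^ (-(2 / 3) : ℝ) = r at *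
        calc r ^ 2 * (l ^ 6 - 1) ≤ r ^ 2 * l ^ 6 := by gcongr; linarith
          _ = (r * l ^ 2) ^ 2 * l ^ 2 := by ring
          _ = l ^ 2 := by rw [h1]; ring
      calc _ ≤ ∑ j, |-(japaneseBracket (W p.1) ^ (-(2 / 3) : ℝ) * W p.1 j)
                * ⟪u p, fderiv ℝ u p ((0, stdVec j) : PhaseSpace n)⟫| :=
            Finset.abs_sum_le_sum_abs _ _
        _ ≤ ∑ j, 1 / 2 * ((japaneseBracket (W p.1) ^ (-(2 / 3) : ℝ) * W p.1 j) ^ 2 * ‖u p‖ ^ 2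
              + ‖partialY j u p‖ ^ 2) := by
            refine Finset.sum_le_sum fun j _ => ?_
            rw [abs_mul, abs_neg]
            have e4 : |⟪u p, fderiv ℝ u p ((0, stdVec j) : PhaseSpace n)⟫|
              ≤ ‖u p‖ * ‖partialY j u p‖ := abs_real_inner_le_norm _ _
            have e5 := mul_le_mul_of_nonneg_left e4
              (abs_nonneg (japaneseBracket (W p.1) ^ (-(2 / 3) : ℝ) * W p.1 j))
            rw [← sq_abs (japaneseBracket (W p.1) ^ (-(2 / 3) : ℝ) * W p.1 j)]
            nlinarith [sq_nonneg (|japaneseBracket (W p.1) ^ (-(2 / 3) : ℝ) * W p.1 j| * ‖u p‖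
              - ‖partialY j u p‖)]
        _ ≤ _ := by
            rw [← Finset.mul_sum, Finset.sum_add_distrib, ← Finset.sum_mul, gradYSq]
            gcongr
    · have e1 : |⟪W p.1, p.2⟫| ≤ (japaneseBracket (W p.1) ^ (1 / 3 : ℝ)) ^ 3 * ‖p.2‖ :=
        (abs_real_inner_le_norm _ _).trans (by gcongr)
      have e2 : |⟪fderiv ℝ W p.1 p.2, p.2⟫| ≤ ‖fderiv ℝ W p.1‖ * ‖p.2‖ * ‖p.2‖ :=
        (abs_real_inner_le_norm _ _).trans (by gcongr; exact ContinuousLinearMap.le_opNorm _ _)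
      have e3 : |⟪W p.1, J p.1 p.2⟫| ≤ (japaneseBracket (W p.1) ^ (1 / 3 : ℝ)) ^ 3
          * (‖J p.1‖ * ‖p.2‖) :=
        (abs_real_inner_le_norm _ _).trans (by gcongr; exact ContinuousLinearMap.le_opNorm _ _)
      generalize ((-(2 / 3) * japaneseBracket (W p.1) ^ (-(2 / 3) - 2 : ℝ)) •
            (innerSL ℝ (W p.1)).comp (fderiv ℝ W p.1)) p.2 = R₀ at *
      generalize japaneseBracket (W p.1) ^ (1 / 3 : ℝ) = l at *
      generalize japaneseBracket (W p.1) ^ (-(2 / 3) : ℝ) = r at *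
      generalize japaneseBracket (W p.1) ^ (-(2 / 3) - 1 : ℝ) = r₁ at *
      have hl0 : 0 ≤ l := zero_le_one.trans hl
      have hDW' : ‖fderiv ℝ W p.1‖ ≤ K * (l ^ 2 * l ^ 2) := hDW.trans (by gcongr)
      have e4 : |-R₀ * ⟪W p.1, p.2⟫| ≤ K * (l ^ 2 * ‖p.2‖ ^ 2) := by
        rw [abs_mul, abs_neg]
        calc |R₀| * |⟪W p.1, p.2⟫|
            ≤ (1 * r₁ * (K * (l ^ 2 * l ^ 2) * ‖p.2‖)) * (l ^ 3 * ‖p.2‖) := by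
              gcongr
              refine hr.trans ?_
              gcongr
              rw [abs_neg, abs_of_nonneg] <;> norm_num
          _ = (r₁ * l ^ 3) * l ^ 2 * (K * (l ^ 2 * ‖p.2‖ ^ 2)) := by ring
          _ = _ := by rw [h53, h1, one_mul]
      have e5 : |r * ⟪fderiv ℝ W p.1 p.2, p.2⟫| ≤ K * (l ^ 2 * ‖p.2‖ ^ 2) := by
        rw [abs_mul, abs_of_pos hLp]
        calc r * |⟪fderiv ℝ W p.1 p.2, p.2⟫| ≤ r * ((K * (l ^ 2 * l ^ 2)) * ‖p.2‖ * ‖p.2‖) := by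
              gcongr; exact e2.trans (by gcongr)
          _ = (r * l ^ 2) * (K * (l ^ 2 * ‖p.2‖ ^ 2)) := by ring
          _ = _ := by rw [h1, one_mul]
      have e6 : |r * ⟪W p.1, J p.1 p.2⟫| ≤ K * (l ^ 3 * ‖p.2‖) := by
        rw [abs_mul, abs_of_pos hLp]
        calc r * |⟪W p.1, J p.1 p.2⟫| ≤ r * (l ^ 3 * ((K * l ^ 2) * ‖p.2‖)) := by
              gcongr; exact e3.trans (by gcongr)
          _ = (r * l ^ 2) * (K * (l ^ 3 * ‖p.2‖)) := by ring
          _ = _ := by rw [h1, one_mul]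
      refine (abs_add_le _ _).trans ?_
      have := abs_sub (-R₀ * ⟪W p.1, p.2⟫) (r * ⟪fderiv ℝ W p.1 p.2, p.2⟫)
      linarith
    -- With r = Λ^{-2/3} = l^{-2}, the main term is r|W|² = r(l⁶ - 1) = l⁴ - r ≥ l⁴ - 1.
    · rw [hw']
      simp only [transportField, inner_sub_right, inner_neg_right, real_inner_self_eq_norm_sq, hΛ2]
      generalize japaneseBracket (W p.1) ^ (1 / 3 : ℝ) = l at *
      generalize japaneseBracket (W p.1) ^ (-(2 / 3) : ℝ) = r at *
      have e1 : r * l ^ 6 = l ^ 4 := by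
        calc r * l ^ 6 = (r * l ^ 2) * l ^ 4 := by ring
          _ = _ := by rw [h1, one_mul]
      have e2 : r ≤ 1 := by
        have : 1 ≤ l ^ 2 := one_le_pow₀ hl
        nlinarith
      linarith
    · rw [energyDefect]
      simp only [oscillatorPotential, gradYSq, partialY, fokkerPlanckOp]

/-- The weighted estimate: all quantities controlled by `P u` and `u`. -/
theorem exists_weighted_estimate (n : ℕ) {K s : ℝ} (hK : 1 ≤ K) (hs : s < 4 / 3) :
    ∃ C : ℝ, 0 ≤ C ∧ ∀ (W : Rn n → Rn n) (J : Rn n → Rn n →L[ℝ] Rn n),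
      AdmissibleField K s W J → ∀ u : PhaseSpace n → ℂ, IsTestFunction u →
      (∫ p, japaneseBracket (W p.1) ^ (4 / 3 : ℝ) * ‖u p‖ ^ 2)
        + (∫ p, japaneseBracket (W p.1) ^ (2 / 3 : ℝ)
            * (gradYSq u p + ‖p.2‖ ^ 2 * ‖u p‖ ^ 2))
        + (∫ p, ‖p.2‖ ^ 2 * (gradYSq u p + ‖p.2‖ ^ 2 * ‖u p‖ ^ 2))
        ≤ C * ∫ p, (‖fokkerPlanckOp W J u p‖ ^ 2 + ‖u p‖ ^ 2) := by
  obtain ⟨C₁, hC₁, h1⟩ := exists_force_estimate n hK hs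
  -- The constants are chosen in this order: first C₁, then ε = 1/(4(C₁+1)) for |y|², then
  -- 1/(4(C₁+1)(C₂+1)) for Λ^{2/3}. After insertion, at most half of the Λ^{4/3} norm returns on the
  -- right.
  obtain ⟨C₂, hC₂, h2⟩ := exists_sq_estimate n (K := K) (s := s)
    (show 0 < 1 / (4 * (C₁ + 1)) by positivity)
  obtain ⟨C₃, hC₃, h3⟩ := exists_weight_estimate n hK hs
    (show 0 < 1 / (4 * (C₁ + 1) * (C₂ + 1)) by positivity)
  refine ⟨(4 * C₁ + 1) * ((C₂ + 1) * (C₃ + 1)), by positivity, fun W J hA u hu => ?_⟩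
  have e1 := h1 W J hA u hu
  have e2 := h2 W J hA u hu
  have e3 := h3 W J hA u hu
  have pA : 0 ≤ ∫ p, japaneseBracket (W p.1) ^ (4 / 3 : ℝ) * ‖u p‖ ^ 2 :=
    integral_nonneg fun p =>
      mul_nonneg (Real.rpow_nonneg (japaneseBracket_pos _).le _) (by positivity)
  have pF : 0 ≤ ∫ p, (‖fokkerPlanckOp W J u p‖ ^ 2 + ‖u p‖ ^ 2) :=
    integral_nonneg fun p => by positivity
  generalize (∫ p, japaneseBracket (W p.1) ^ (4 / 3 : ℝ) * ‖u p‖ ^ 2) = a at *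
  generalize (∫ p, japaneseBracket (W p.1) ^ (2 / 3 : ℝ)
    * (gradYSq u p + ‖p.2‖ ^ 2 * ‖u p‖ ^ 2)) = b at *
  generalize (∫ p, ‖p.2‖ ^ 2 * (gradYSq u p + ‖p.2‖ ^ 2 * ‖u p‖ ^ 2)) = d at *
  generalize (∫ p, (‖fokkerPlanckOp W J u p‖ ^ 2 + ‖u p‖ ^ 2)) = f at *
  have e4 : b + d + f ≤ 1 / (2 * (C₁ + 1)) * a + (C₂ + 1) * (C₃ + 1) * f := by
    have e5 := mul_le_mul_of_nonneg_left e3 (show 0 ≤ C₂ + 1 by positivity)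
    have e6 : (C₂ + 1) * (1 / (4 * (C₁ + 1) * (C₂ + 1)) * a + C₃ * f)
        = 1 / (4 * (C₁ + 1)) * a + (C₂ + 1) * C₃ * f := by field_simp
    have e7 : 1 / (2 * (C₁ + 1)) * a = 2 * (1 / (4 * (C₁ + 1)) * a) := by field_simp; ring
    rw [e7]
    linarith
  have e5 : C₁ * (1 / (2 * (C₁ + 1)) * a) ≤ 1 / 2 * a := by
    rw [← mul_assoc]
    gcongr
    rw [mul_one_div, div_le_div_iff₀ (by positivity) (by norm_num)]
    linarith
  have e6 : 1 / (2 * (C₁ + 1)) * a ≤ a := by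
    refine mul_le_of_le_one_left pA ?_
    rw [div_le_one (by positivity)]
    linarith
  have e7 := mul_le_mul_of_nonneg_left e4 hC₁
  linarith

end WeightedEstimate

end

noncomputable section

/-! ### Commutation with directional derivatives -/

section DirectionalDerivative

variable {E : Type*} [NormedAddCommGroup E] [NormedSpace ℝ E] {f : E → ℂ}

/-- The derivative of `f` in the direction `v`. -/
def dirDeriv (v : E) (f : E → ℂ) (x : E) : ℂ := fderiv ℝ f x v

theorem contDiff_dirDeriv (hf : ContDiff ℝ ∞ f) (v : E) : ContDiff ℝ ∞ (dirDeriv v f) :=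
  contDiff_fderiv_apply_const hf v

theorem hasCompactSupport_dirDeriv (hf : HasCompactSupport f) (v : E) :
    HasCompactSupport (dirDeriv v f) := hf.fderiv_apply ℝ v

theorem hasFDerivAt_dirDeriv_field (hf : ContDiff ℝ ∞ f) {b : E → E} {b' : E →L[ℝ] E} {x : E}
    (hb : HasFDerivAt b b' x) :
    HasFDerivAt (fun z => fderiv ℝ f z (b z))
      ((fderiv ℝ f x).comp b' + (fderiv ℝ (fderiv ℝ f) x).flip (b x)) x :=
  (((hf.fderiv_right (m := ∞) (by simp)).differentiable (by simp) x).hasFDerivAt).clm_apply hb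

theorem fderiv_dirDeriv (hf : ContDiff ℝ ∞ f) (v w x : E) :
    fderiv ℝ (dirDeriv v f) x w = fderiv ℝ (fderiv ℝ f) x w v := by
  have := hasFDerivAt_dirDeriv_field hf (hasFDerivAt_const v x)
  have h2 : HasFDerivAt (dirDeriv v f) _ x := this
  rw [h2.fderiv]; simp

theorem fderiv_fderiv_comm (hf : ContDiff ℝ ∞ f) (v w x : E) :
    fderiv ℝ (fderiv ℝ f) x v w = fderiv ℝ (fderiv ℝ f) x w v :=
  (hf.contDiffAt.isSymmSndFDerivAt (by
    simp only [minSmoothness_of_isRCLikeNormedField]; exact WithTop.coe_le_coe.2 le_top)).eq v w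

theorem dirDeriv_comm (hf : ContDiff ℝ ∞ f) (v w : E) :
    dirDeriv v (dirDeriv w f) = dirDeriv w (dirDeriv v f) := by
  ext x
  simp only [dirDeriv]
  exact (fderiv_dirDeriv hf w v x).trans
    ((fderiv_fderiv_comm hf v w x).trans (fderiv_dirDeriv hf v w x).symm)

theorem hasFDerivAt_ofReal_comp {q : E → ℝ} {q' : E →L[ℝ] ℝ} {x : E} (hq : HasFDerivAt q q' x) :
    HasFDerivAt (fun z => (q z : ℂ)) (Complex.ofRealCLM.comp q') x :=
  Complex.ofRealCLM.hasFDerivAt.comp x hq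

/-- Commutation of `kineticOp` with a directional derivative. -/
theorem fderiv_kineticOp {m : ℕ} {b : E → E} {θ q : E → ℝ} {e : Fin m → E} (hf : ContDiff ℝ ∞ f)
    {x : E} {b' : E →L[ℝ] E} {θ' q' : E →L[ℝ] ℝ} (hb : HasFDerivAt b b' x)
    (hθ : HasFDerivAt θ θ' x) (hq : HasFDerivAt q q' x) (v : E) :
    fderiv ℝ (kineticOp b θ q e f) x v = kineticOp b θ q e (dirDeriv v f) x
      + fderiv ℝ f x (b' v) + (θ' v : ℂ) * Complex.I * f x + (q' v : ℂ) * f x := by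
  have hf' := (hf.differentiable (by simp) x).hasFDerivAt
  have h1 := hasFDerivAt_dirDeriv_field hf hb
  have h2 := ((hasFDerivAt_ofReal_comp hθ).mul_const Complex.I).mul hf'
  have h3 : HasFDerivAt (fun z => ∑ j, dirDeriv (e j) (dirDeriv (e j) f) z)
      (∑ j, fderiv ℝ (dirDeriv (e j) (dirDeriv (e j) f)) x) x :=
    HasFDerivAt.fun_sum fun j _ =>
      ((contDiff_dirDeriv (contDiff_dirDeriv hf _) _).differentiable (by simp) x).hasFDerivAt
  have h4 := (hasFDerivAt_ofReal_comp hq).mul hf'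
  have h : HasFDerivAt (kineticOp b θ q e f) _ x := ((h1.add h2).sub h3).add h4
  rw [h.fderiv]
  have h5 : ∀ j, fderiv ℝ (dirDeriv (e j) (dirDeriv (e j) f)) x v
      = dirDeriv (e j) (dirDeriv (e j) (dirDeriv v f)) x := fun j => by
    rw [← dirDeriv_comm hf v (e j), ← dirDeriv_comm (contDiff_dirDeriv hf (e j)) v (e j)]
    rfl
  have h6 : fderiv ℝ (dirDeriv v f) x (b x) = fderiv ℝ (fderiv ℝ f) x v (b x) := by
    rw [fderiv_dirDeriv hf, fderiv_fderiv_comm hf]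
  have h7 : (∑ j, fderiv ℝ (fun z => fderiv ℝ (dirDeriv v f) z (e j)) x (e j))
      = ∑ j, dirDeriv (e j) (dirDeriv (e j) (dirDeriv v f)) x := rfl
  have h8 : fderiv ℝ f x v = dirDeriv v f x := rfl
  simp only [kineticOp, h7, h6]
  simp [h5, h8]
  ring

end DirectionalDerivative

/-! ### The constant coefficient operator on the Fourier side -/

section FrozenOperator

variable {n : ℕ} {f : Rn n → ℂ}

/-- The operator `i ξ · y - (E + M y) · ∂_y - Δ_y + |y|² / 4 - n / 2` with constant coefficients. -/
def frozenOp (ξ E : Rn n) (M : Rn n →L[ℝ] Rn n) (f : Rn n → ℂ) : Rn n → ℂ :=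
  kineticOp (fun y => -E - M y) (fun y => ⟪ξ, y⟫) (oscillatorPotential n)
    (fun j : Fin n => stdVec j) f

/-- `|∂f|²`. -/
def gradSq (f : Rn n → ℂ) (y : Rn n) : ℝ := ∑ j, ‖dirDeriv (stdVec j) f y‖ ^ 2

/-- `|∂²f|²`. -/
def hessSq (f : Rn n → ℂ) (y : Rn n) : ℝ := ∑ k, gradSq (dirDeriv (stdVec k) f) y

theorem gradSq_nonneg (f : Rn n → ℂ) (y : Rn n) : 0 ≤ gradSq f y := by
  unfold gradSq; positivity

theorem hessSq_nonneg (f : Rn n → ℂ) (y : Rn n) : 0 ≤ hessSq f y :=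
  Finset.sum_nonneg fun _ _ => gradSq_nonneg _ _

theorem divergenceFree_affine (E : Rn n) {M : Rn n →L[ℝ] Rn n} (hM : ∀ y, ⟪M y, y⟫ = 0) :
    DivergenceFree volume fun y => -E - M y := by
  refine divergenceFree_of_sum volume (fun j y => (-E - M y) j) (fun j => stdVec j) ?_ ?_ ?_
  · intro y; exact (sum_smul_stdVec _).symm
  · intro j; fun_prop
  · intro j y
    have : (M (stdVec j)) j = 0 := by
      have := hM (stdVec j)
      rw [stdVec, EuclideanSpace.inner_single_right] at this
      simpa using this
    simp [HasLineDerivAt, this, hasDerivAt_const]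

theorem continuous_oscillatorPotential : Continuous (oscillatorPotential n) := by
  unfold oscillatorPotential; fun_prop

theorem hasFDerivAt_oscillatorPotential (y : Rn n) :
    HasFDerivAt (oscillatorPotential n) ((1 / 2 : ℝ) • innerSL ℝ y) y := by
  have h := (((hasFDerivAt_id y).norm_sq).const_mul (1 / 4)).sub_const ((n : ℝ) / 2)
  convert! h using 1
  · ext z; simp [oscillatorPotential]; ring
  · ext v; simp; ring

theorem norm_fderiv_apply_le_sqrt (f : Rn n → ℂ) (y v : Rn n) :
    ‖fderiv ℝ f y v‖ ≤ ‖v‖ * Real.sqrt (gradSq f y) := by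
  have h1 : fderiv ℝ f y v = ∑ j, v j • dirDeriv (stdVec j) f y := by
    conv_lhs => rw [← sum_smul_stdVec v]
    simp [dirDeriv]
  rw [h1]
  calc ‖∑ j, v j • dirDeriv (stdVec j) f y‖ ≤ ∑ j, |v j| * ‖dirDeriv (stdVec j) f y‖ := by
        refine (norm_sum_le _ _).trans_eq ?_
        simp
    _ ≤ Real.sqrt (∑ j, |v j| ^ 2) * Real.sqrt (∑ j, ‖dirDeriv (stdVec j) f y‖ ^ 2) :=
        Real.sum_mul_le_sqrt_mul_sqrt _ _ _
    _ = _ := by rw [EuclideanSpace.norm_eq]; simp [gradSq]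

/-- The Laplacian. -/
def laplace (f : Rn n → ℂ) (y : Rn n) : ℂ := ∑ j, dirDeriv (stdVec j) (dirDeriv (stdVec j) f) y

theorem norm_laplace_sq_le (f : Rn n → ℂ) (y : Rn n) : ‖laplace f y‖ ^ 2 ≤ n * hessSq f y := by
  calc ‖laplace f y‖ ^ 2 ≤ (∑ j, ‖dirDeriv (stdVec j) (dirDeriv (stdVec j) f) y‖) ^ 2 := by
        gcongr; exact norm_sum_le _ _
    _ ≤ n * ∑ j, ‖dirDeriv (stdVec j) (dirDeriv (stdVec j) f) y‖ ^ 2 := by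
        simpa using sq_sum_le_card_mul_sum_sq (s := Finset.univ)
          (f := fun j => ‖dirDeriv (stdVec j) (dirDeriv (stdVec j) f) y‖)
    _ ≤ _ := by
        unfold hessSq gradSq
        gcongr with k
        exact Finset.single_le_sum (f := fun j => ‖dirDeriv (stdVec j) (dirDeriv (stdVec k) f) y‖ ^ 2)
          (fun j _ => by positivity) (Finset.mem_univ k)

theorem frozenOp_eq (ξ E : Rn n) (M : Rn n →L[ℝ] Rn n) (f : Rn n → ℂ) (y : Rn n) :
    frozenOp ξ E M f y = fderiv ℝ f y (-E - M y) + (⟪ξ, y⟫ : ℝ) * Complex.I * f y - laplace f y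
      + (oscillatorPotential n y : ℝ) * f y := rfl

theorem continuous_frozenOp (hf : ContDiff ℝ ∞ f) (ξ E : Rn n) (M : Rn n →L[ℝ] Rn n) :
    Continuous (frozenOp ξ E M f) :=
  continuous_kineticOp (by fun_prop) (by fun_prop) continuous_oscillatorPotential hf

theorem continuous_gradSq (hf : ContDiff ℝ ∞ f) : Continuous (gradSq f) :=
  continuous_finsetSum _ fun _ _ => ((contDiff_dirDeriv hf _).continuous.norm).pow 2

theorem continuous_hessSq (hf : ContDiff ℝ ∞ f) : Continuous (hessSq f) :=
  continuous_finsetSum _ fun _ _ => continuous_gradSq (contDiff_dirDeriv hf _)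

theorem gradSq_eq_zero_off_tsupport {y : Rn n} (hy : y ∉ tsupport f) : gradSq f y = 0 := by
  simp [gradSq, dirDeriv, fderiv_eq_zero_off_tsupport hy]

theorem hessSq_eq_zero_off_tsupport {y : Rn n} (hy : y ∉ tsupport f) : hessSq f y = 0 := by
  refine Finset.sum_eq_zero fun k _ => gradSq_eq_zero_off_tsupport fun h => hy ?_
  exact tsupport_fderiv_apply_subset ℝ (stdVec k) h

theorem integrable_mul_norm_sq (hf : ContDiff ℝ ∞ f) (hfs : HasCompactSupport f) {w : Rn n → ℝ}
    (hw : Continuous w) : Integrable fun y => w y * ‖f y‖ ^ 2 :=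
  integrable_of_eq_zero_off_tsupport hfs (hw.mul (hf.continuous.norm.pow 2)) fun p hp => by
    simp [image_eq_zero_of_notMem_tsupport hp]

theorem integrable_mul_gradSq (hf : ContDiff ℝ ∞ f) (hfs : HasCompactSupport f) {w : Rn n → ℝ}
    (hw : Continuous w) : Integrable fun y => w y * gradSq f y :=
  integrable_of_eq_zero_off_tsupport hfs (hw.mul (continuous_gradSq hf)) fun p hp => by
    simp [gradSq_eq_zero_off_tsupport hp]

theorem integrable_hessSq (hf : ContDiff ℝ ∞ f) (hfs : HasCompactSupport f) :
    Integrable (hessSq f) :=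
  integrable_of_eq_zero_off_tsupport hfs (continuous_hessSq hf) fun p hp => by
    simp [hessSq_eq_zero_off_tsupport hp]

theorem integrable_frozenOp (hf : ContDiff ℝ ∞ f) (hfs : HasCompactSupport f) (ξ E : Rn n)
    (M : Rn n →L[ℝ] Rn n) : Integrable fun y => ‖frozenOp ξ E M f y‖ ^ 2 :=
  integrable_of_eq_zero_off_tsupport hfs ((continuous_frozenOp hf ξ E M).norm.pow 2) fun p hp => by
    simp [frozenOp, kineticOp_eq_zero_off_tsupport hp]

/-- `|∂f|² + |y|²|f|²`. -/
def energySq (f : Rn n → ℂ) (y : Rn n) : ℝ := gradSq f y + ‖y‖ ^ 2 * ‖f y‖ ^ 2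

theorem integrable_energySq (hf : ContDiff ℝ ∞ f) (hfs : HasCompactSupport f) :
    Integrable (energySq f) := by
  have h := (integrable_mul_gradSq hf hfs continuous_const (w := fun _ => 1)).add
    (integrable_mul_norm_sq hf hfs (w := fun y => ‖y‖ ^ 2) (by fun_prop))
  simp only [one_mul] at h
  exact h

theorem energySq_nonneg (f : Rn n → ℂ) (y : Rn n) : 0 ≤ energySq f y :=
  add_nonneg (gradSq_nonneg f y) (by positivity)

/-- Energy identity with constant weight t². The terms in ξ, E and M all drop out, so the bound is
uniform in these parameters. -/
theorem frozen_energy_estimate {M : Rn n →L[ℝ] Rn n} (hM : ∀ y, ⟪M y, y⟫ = 0) (ξ E : Rn n)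
    (hf : ContDiff ℝ ∞ f) (hfs : HasCompactSupport f) {ε : ℝ} (hε : 0 < ε) (t : ℝ) :
    t ^ 2 * ∫ y, energySq f y ≤ ε * (t ^ 4 * ∫ y, ‖f y‖ ^ 2)
      + 8 / ε * (∫ y, ‖frozenOp ξ E M f y‖ ^ 2) + 2 * n ^ 2 / ε * ∫ y, ‖f y‖ ^ 2 := by
  have iN := integrable_mul_norm_sq hf hfs continuous_const (w := fun _ => 1)
  have iP := integrable_frozenOp hf hfs ξ E M
  have iE := integrable_energySq hf hfs
  simp only [one_mul] at iN
  have key := integral_le_of_le_add_energyDefect volume (divergenceFree_affine E hM)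
    (by fun_prop) (θ := fun y => ⟪ξ, y⟫) (by fun_prop) continuous_oscillatorPotential
    (e := fun j : Fin n => stdVec j) (w := fun _ => 1) contDiff_const hf hfs
    (f := fun y => t ^ 2 * energySq f y)
    (g := fun y => (ε * t ^ 4 + 2 * n ^ 2 / ε) * ‖f y‖ ^ 2
      + 8 / ε * ‖frozenOp ξ E M f y‖ ^ 2) (iE.const_mul _)
    ((iN.const_mul _).add (iP.const_mul _)) (-4 * t ^ 2) ?_
  · rw [integral_const_mul, integral_add (iN.const_mul _) (iP.const_mul _), integral_const_mul,
      integral_const_mul] at key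
    linarith
  · intro y
    have e0 : energyDefect (fun y => -E - M y) (fun y => ⟪ξ, y⟫) (oscillatorPotential n)
        (fun j : Fin n => stdVec j) (fun _ => 1) f y = ⟪f y, frozenOp ξ E M f y⟫
          - (gradSq f y + (‖y‖ ^ 2 / 4 - n / 2) * ‖f y‖ ^ 2) := by
      simp [energyDefect, frozenOp, gradSq, oscillatorPotential, dirDeriv]
    rw [e0]
    have h1 := (le_abs_self _).trans (abs_real_inner_le_norm (f y) (frozenOp ξ E M f y))
    have h2 := two_mul_le_div_add_mul (show 0 < ε / 2 by positivity) (t ^ 2 * ‖f y‖)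
      (2 * ‖frozenOp ξ E M f y‖)
    have h3 := two_mul_le_div_add_mul (show 0 < ε / 2 by positivity) (t ^ 2 * ‖f y‖)
      (n * ‖f y‖)
    have h4 : (2 * ‖frozenOp ξ E M f y‖) ^ 2 / (ε / 2) = 8 / ε * ‖frozenOp ξ E M f y‖ ^ 2 := by
      field_simp; ring
    have h5 : (n * ‖f y‖) ^ 2 / (ε / 2) = 2 * n ^ 2 / ε * ‖f y‖ ^ 2 := by field_simp
    rw [h4] at h2
    rw [h5] at h3
    have h6 := mul_le_mul_of_nonneg_left h1 (sq_nonneg t)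
    have h7 : 0 ≤ t ^ 2 * gradSq f y := mul_nonneg (sq_nonneg t) (gradSq_nonneg f y)
    unfold energySq
    linarith

end FrozenOperator

end

noncomputable section

/-! ### Functions with vanishing integral -/

section NullIntegral

variable {X : Type*} [MeasurableSpace X] {μ : Measure X}

/-- `N` is integrable with vanishing integral. -/
def NullIntegral (μ : Measure X) (N : X → ℝ) : Prop := Integrable N μ ∧ ∫ x, N x ∂μ = 0

theorem NullIntegral.add {N N' : X → ℝ} (h : NullIntegral μ N) (h' : NullIntegral μ N') :
    NullIntegral μ fun x => N x + N' x :=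
  ⟨h.1.add h'.1, by rw [integral_add h.1 h'.1, h.2, h'.2, add_zero]⟩

theorem NullIntegral.const_mul {N : X → ℝ} (h : NullIntegral μ N) (c : ℝ) :
    NullIntegral μ fun x => c * N x :=
  ⟨h.1.const_mul c, by rw [integral_const_mul, h.2, mul_zero]⟩

theorem NullIntegral.sum {ι : Type*} [Fintype ι] {N : ι → X → ℝ} (h : ∀ i, NullIntegral μ (N i)) :
    NullIntegral μ fun x => ∑ i, N i x :=
  ⟨integrable_finsetSum _ fun i _ => (h i).1, by
    rw [integral_finsetSum _ fun i _ => (h i).1]; exact Finset.sum_eq_zero fun i _ => (h i).2⟩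

theorem NullIntegral.integral_le {N f g : X → ℝ} (h : NullIntegral μ N) (hf : Integrable f μ)
    (hg : Integrable g μ) (hle : ∀ x, f x ≤ g x + N x) : ∫ x, f x ∂μ ≤ ∫ x, g x ∂μ := by
  have := integral_mono hf (hg.add h.1) hle
  rwa [integral_add' hg h.1, h.2, add_zero] at this

end NullIntegral

/-! ### Second order estimate for frozen coefficients -/

section FrozenSubelliptic

variable {n : ℕ} {f : Rn n → ℂ}

theorem nullIntegral_fderiv {E : Type*} [NormedAddCommGroup E] [NormedSpace ℝ E]
    [MeasurableSpace E] [BorelSpace E] {μ : Measure E} [IsFiniteMeasureOnCompacts μ]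
    {b : E → E} (hb : DivergenceFree μ b)
    (hbc : Continuous b) {g : E → ℝ} (hg : ContDiff ℝ 1 g) (hgs : HasCompactSupport g) :
    NullIntegral μ fun x => fderiv ℝ g x (b x) :=
  ⟨integrable_of_eq_zero_off_tsupport hgs ((hg.continuous_fderiv one_ne_zero).clm_apply hbc)
    fun x hx => by simp [fderiv_eq_zero_off_tsupport hx], hb g hg hgs⟩

theorem nullIntegral_fderiv_const {g : Rn n → ℝ} (v : Rn n) (hg : ContDiff ℝ 1 g)
    (hgs : HasCompactSupport g) : NullIntegral volume fun x => fderiv ℝ g x v :=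
  ⟨integrable_of_eq_zero_off_tsupport hgs ((hg.continuous_fderiv one_ne_zero).clm_apply
    continuous_const) fun x hx => by simp [fderiv_eq_zero_off_tsupport hx],
    integral_fderiv_const_eq_zero volume v hg hgs⟩

theorem contDiff_frozenOp (hf : ContDiff ℝ ∞ f) (ξ E : Rn n) (M : Rn n →L[ℝ] Rn n) :
    ContDiff ℝ ∞ (frozenOp ξ E M f) := by
  have h1 : ContDiff ℝ ∞ fun y => fderiv ℝ f y (-E - M y) :=
    (hf.fderiv_right (m := ∞) (by simp)).clm_apply (contDiff_const.sub M.contDiff)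
  have h2 : ContDiff ℝ ∞ fun y : Rn n => ((⟪ξ, y⟫ : ℝ) : ℂ) :=
    Complex.ofRealCLM.contDiff.comp (contDiff_const.inner ℝ contDiff_id)
  have h3 : ContDiff ℝ ∞ (laplace f) :=
    ContDiff.sum fun j _ => contDiff_dirDeriv (contDiff_dirDeriv hf _) _
  have h4 : ContDiff ℝ ∞ fun y : Rn n => ((oscillatorPotential n y : ℝ) : ℂ) :=
    Complex.ofRealCLM.contDiff.comp (((contDiff_norm_sq ℝ).div_const 4).sub contDiff_const)
  exact ((h1.add ((h2.mul contDiff_const).mul hf)).sub h3).add (h4.mul hf)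

/-- A symmetric Gram matrix contracted with a skew matrix vanishes. Hence the commutators of the
magnetic term with the ∂_k cancel after summation over k. -/
theorem inner_skew_sum {M : Rn n →L[ℝ] Rn n} (hM : ∀ y, ⟪M y, y⟫ = 0) (T : Rn n →L[ℝ] ℂ) :
    ∑ k, ⟪T (stdVec k), T (M (stdVec k))⟫ = 0 := by
  have hanti : ∀ j k : Fin n, M (stdVec k) j = -M (stdVec j) k := by
    intro j k
    have h1 := hM (stdVec j + stdVec k)
    have h2 := hM (stdVec j)
    have h3 := hM (stdVec k)
    simp only [map_add, inner_add_left, inner_add_right, h2, h3] at h1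
    simp [stdVec, EuclideanSpace.inner_single_right] at h1
    simp only [stdVec]
    linarith
  have h1 : ∀ k, ⟪T (stdVec k), T (M (stdVec k))⟫
      = ∑ j, M (stdVec k) j * ⟪T (stdVec k), T (stdVec j)⟫ := by
    intro k
    conv_lhs => rw [← sum_smul_stdVec (M (stdVec k))]
    simp only [map_sum, map_smul, inner_sum, real_inner_smul_right]
  simp_rw [h1]
  have h2 : ∑ k, ∑ j, M (stdVec k) j * ⟪T (stdVec k), T (stdVec j)⟫
      = -∑ k, ∑ j, M (stdVec k) j * ⟪T (stdVec k), T (stdVec j)⟫ := by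
    conv_lhs => rw [Finset.sum_comm]
    rw [← Finset.sum_neg_distrib]
    refine Finset.sum_congr rfl fun j _ => ?_
    rw [← Finset.sum_neg_distrib]
    refine Finset.sum_congr rfl fun k _ => ?_
    rw [hanti j k, real_inner_comm]
    ring
  linarith

theorem integrable_sq_mul_gradSq_add_hessSq (hf : ContDiff ℝ ∞ f) (hfs : HasCompactSupport f) :
    Integrable fun y => hessSq f y + ‖y‖ ^ 2 * gradSq f y :=
  (integrable_hessSq hf hfs).add
    (integrable_mul_gradSq hf hfs (w := fun y => ‖y‖ ^ 2) (by fun_prop))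

theorem sum_coord_mul_inner (T : Rn n →L[ℝ] ℂ) (v : Rn n) (c : ℂ) :
    ∑ k, v k * ⟪T (stdVec k), c⟫ = ⟪T v, c⟫ := by
  conv_rhs => rw [← sum_smul_stdVec v]
  simp only [map_sum, map_smul, sum_inner, real_inner_smul_left]

/-- Energy identity applied to every ∂_k f and summed. Commuting ∂_k past the operator creates iξ_k
f and y_k f/2, and a magnetic term that cancels in the sum. The first is bounded by |ξ||∂f||f|,
split as x⁴|f|² and x²|∂f|² with x = |ξ|^{1/3}. -/
theorem frozen_second_order_estimate {M : Rn n →L[ℝ] Rn n} (hM : ∀ y, ⟪M y, y⟫ = 0) (ξ E : Rn n)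
    (hf : ContDiff ℝ ∞ f) (hfs : HasCompactSupport f) {ε : ℝ} (hε : 0 < ε) {x : ℝ}
    (hxi : ‖ξ‖ = x ^ 3) :
    ∫ y, (hessSq f y + ‖y‖ ^ 2 * gradSq f y) ≤ ε * (x ^ 4 * ∫ y, ‖f y‖ ^ 2)
      + 4 * (x ^ 2 / ε + n / 2 + 1) * (∫ y, energySq f y)
      + 2 * (n + 1) * ∫ y, ‖frozenOp ξ E M f y‖ ^ 2 := by
  have iN := integrable_mul_norm_sq hf hfs continuous_const (w := fun _ => 1)
  have iP := integrable_frozenOp hf hfs ξ E M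
  have iE := integrable_energySq hf hfs
  have iH := integrable_sq_mul_gradSq_add_hessSq hf hfs
  simp only [one_mul] at iN
  have hg := fun k => contDiff_dirDeriv hf (stdVec k : Rn n)
  have hgs := fun k => hasCompactSupport_dirDeriv hfs (stdVec k : Rn n)
  have hF := contDiff_frozenOp hf ξ E M
  have hb : ∀ y, HasFDerivAt (fun y => -E - M y) (-M) y := fun y => by
    simpa using M.hasFDerivAt.const_sub (-E)
  have hθ : ∀ y, HasFDerivAt (fun y : Rn n => ⟪ξ, y⟫) (innerSL ℝ ξ) y := fun y =>
    (innerSL ℝ ξ).hasFDerivAt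
  have n1 : NullIntegral volume fun y => ∑ k : Fin n,
      energyDefect (fun y => -E - M y) (fun y => ⟪ξ, y⟫) (oscillatorPotential n)
        (fun j : Fin n => stdVec j) (fun _ => 1) (dirDeriv (stdVec k) f) y :=
    NullIntegral.sum fun k => ⟨integrable_of_eq_zero_off_tsupport (hgs k)
      (continuous_energyDefect (by fun_prop) (by fun_prop) continuous_oscillatorPotential
        contDiff_const (hg k)) fun x hx => energyDefect_eq_zero_off_tsupport hx,
      integral_energyDefect volume (divergenceFree_affine E hM) (by fun_prop) contDiff_const
        (hg k) (hgs k)⟩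
  have n2 : NullIntegral volume fun y => ∑ k : Fin n,
      fderiv ℝ (fun z => ⟪dirDeriv (stdVec k) f z, frozenOp ξ E M f z⟫) y (stdVec k) :=
    NullIntegral.sum fun k => nullIntegral_fderiv_const _
      (((hg k).of_le (by simp)).inner ℝ (hF.of_le (by simp)))
      (HasCompactSupport.intro (hgs k) fun x hx => by simp [image_eq_zero_of_notMem_tsupport hx])
  -- The second null term integrates ∂_k F by parts back onto ∂_k f, so that only F itself appears,
  -- paired with the Laplacian of f.
  have key := ((n1.const_mul (-4)).add (n2.const_mul 4)).integral_le iH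
    (((iN.const_mul (ε * x ^ 4)).add (iE.const_mul (4 * (x ^ 2 / ε + n / 2 + 1)))).add
      (iP.const_mul (2 * (n + 1)))) ?_
  · rw [integral_add' ((iN.const_mul _).add (iE.const_mul _)) (iP.const_mul _),
      integral_add' (iN.const_mul _) (iE.const_mul _), integral_const_mul, integral_const_mul,
      integral_const_mul] at key
    linarith
  · intro y
    set F := frozenOp ξ E M f with hFdef
    set T := fderiv ℝ f y with hT
    have hcomm : ∀ k, frozenOp ξ E M (dirDeriv (stdVec k) f) y
        = fderiv ℝ F y (stdVec k) + T (M (stdVec k)) - (ξ k : ℂ) * Complex.I * f y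
          - ((1 / 2 * y k : ℝ) : ℂ) * f y := by
      intro k
      have h1 : fderiv ℝ F y (stdVec k) = _ :=
        fderiv_kineticOp (e := fun j : Fin n => stdVec j) hf (hb y) (hθ y)
          (hasFDerivAt_oscillatorPotential y) (stdVec k)
      rw [h1]
      simp [frozenOp, stdVec, EuclideanSpace.inner_single_right]
      ring
    have e1 : ∀ k, energyDefect (fun y => -E - M y) (fun y => ⟪ξ, y⟫) (oscillatorPotential n)
        (fun j : Fin n => stdVec j) (fun _ => 1) (dirDeriv (stdVec k) f) y
        = ⟪T (stdVec k), fderiv ℝ F y (stdVec k)⟫ + ⟪T (stdVec k), T (M (stdVec k))⟫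
          - ξ k * ⟪T (stdVec k), Complex.I * f y⟫ - 1 / 2 * (y k * ⟪T (stdVec k), f y⟫)
          - gradSq (dirDeriv (stdVec k) f) y
          - (‖y‖ ^ 2 / 4 - n / 2) * ‖dirDeriv (stdVec k) f y‖ ^ 2 := by
      intro k
      have h1 : energyDefect (fun y => -E - M y) (fun y => ⟪ξ, y⟫) (oscillatorPotential n)
        (fun j : Fin n => stdVec j) (fun _ => 1) (dirDeriv (stdVec k) f) y
        = ⟪T (stdVec k), frozenOp ξ E M (dirDeriv (stdVec k) f) y⟫
          - gradSq (dirDeriv (stdVec k) f) y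
          - (‖y‖ ^ 2 / 4 - n / 2) * ‖dirDeriv (stdVec k) f y‖ ^ 2 := by
        simp [energyDefect, frozenOp, gradSq, oscillatorPotential, dirDeriv, T]
        ring
      have h2 : ⟪T (stdVec k), (ξ k : ℂ) * Complex.I * f y⟫
          = ξ k * ⟪T (stdVec k), Complex.I * f y⟫ := by
        rw [← real_inner_smul_right, mul_assoc]; rfl
      have h3 : ⟪T (stdVec k), ((1 / 2 * y k : ℝ) : ℂ) * f y⟫
          = 1 / 2 * (y k * ⟪T (stdVec k), f y⟫) := by
        rw [← mul_assoc, ← real_inner_smul_right]; rfl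
      rw [h1, hcomm, inner_sub_right, inner_sub_right, inner_add_right, h2, h3]
    have e2 : ∀ k, fderiv ℝ (fun z => ⟪dirDeriv (stdVec k) f z, F z⟫) y (stdVec k)
        = ⟪T (stdVec k), fderiv ℝ F y (stdVec k)⟫
          + ⟪dirDeriv (stdVec k) (dirDeriv (stdVec k) f) y, F y⟫ := by
      intro k
      have h := (((hg k).differentiable (by simp) y).hasFDerivAt).inner ℝ
        ((hF.differentiable (by simp) y).hasFDerivAt)
      rw [h.fderiv]
      simp [dirDeriv, T, F]
    simp_rw [e1, e2]
    simp only [Finset.sum_add_distrib, Finset.sum_sub_distrib, ← Finset.mul_sum, ← sum_inner]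
    rw [inner_skew_sum hM T, sum_coord_mul_inner, sum_coord_mul_inner]
    have e3 : ∑ k, gradSq (dirDeriv (stdVec k) f) y = hessSq f y := rfl
    have e4 : ∑ k : Fin n, ‖dirDeriv (stdVec k) f y‖ ^ 2 = gradSq f y := rfl
    have e5 : ∑ k : Fin n, dirDeriv (stdVec k) (dirDeriv (stdVec k) f) y = laplace f y := rfl
    rw [e3, e4, e5]
    have pH := hessSq_nonneg f y
    have pG := gradSq_nonneg f y
    have b1 : -⟪laplace f y, F y⟫ ≤ 1 / 2 * hessSq f y + (n + 1) / 2 * ‖F y‖ ^ 2 := by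
      have h1 := (neg_le_abs _).trans (abs_real_inner_le_norm (laplace f y) (F y))
      have hn : (0 : ℝ) < n + 1 := by positivity
      have h2 := two_mul_le_div_add_mul hn (‖F y‖) (‖laplace f y‖)
      have h3 : ‖laplace f y‖ ^ 2 / (n + 1 : ℝ) ≤ hessSq f y := by
        rw [div_le_iff₀ hn]
        have := norm_laplace_sq_le f y
        linarith
      linarith
    have hs := Real.sq_sqrt pG
    have hs0 := Real.sqrt_nonneg (gradSq f y)
    have b2 : -⟪T ξ, Complex.I * f y⟫ ≤ ε / 4 * (x ^ 4 * ‖f y‖ ^ 2) + x ^ 2 / ε * gradSq f y := by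
      have h1 := (neg_le_abs _).trans (abs_real_inner_le_norm (T ξ) (Complex.I * f y))
      have h2 : ‖T ξ‖ ≤ x ^ 3 * Real.sqrt (gradSq f y) := hxi ▸ norm_fderiv_apply_le_sqrt f y ξ
      have h3 : ‖T ξ‖ * ‖Complex.I * f y‖ ≤ (x ^ 3 * Real.sqrt (gradSq f y)) * ‖f y‖ := by
        rw [norm_mul, Complex.norm_I, one_mul]; gcongr
      have h4 := two_mul_le_div_add_mul (show 0 < ε / 4 by positivity) (x ^ 2 * ‖f y‖)
        (1 / 2 * (x * Real.sqrt (gradSq f y)))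
      have h5 : (1 / 2 * (x * Real.sqrt (gradSq f y))) ^ 2 / (ε / 4) = x ^ 2 / ε * gradSq f y := by
        rw [mul_pow, mul_pow, hs]; field_simp; ring
      rw [h5] at h4
      linarith
    have b3 : -⟪T y, f y⟫ ≤ 1 / 2 * energySq f y := by
      have h1 := (neg_le_abs _).trans (abs_real_inner_le_norm (T y) (f y))
      have h2 : ‖T y‖ * ‖f y‖ ≤ (‖y‖ * Real.sqrt (gradSq f y)) * ‖f y‖ := by
        gcongr; exact norm_fderiv_apply_le_sqrt f y y
      have h3 := sq_nonneg (Real.sqrt (gradSq f y) - ‖y‖ * ‖f y‖)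
      unfold energySq
      linarith
    have b4 : (x ^ 2 / ε + n / 2) * gradSq f y ≤ (x ^ 2 / ε + n / 2) * energySq f y := by
      have : gradSq f y ≤ energySq f y := le_add_of_nonneg_right (by positivity)
      gcongr
    simp only [Pi.add_apply]
    have := energySq_nonneg f y
    linarith

end FrozenSubelliptic

end

noncomputable section

/-! ### The positive commutator in the frequency variable -/

section FrozenSubellipticEstimate

variable {n : ℕ} {f : Rn n → ℂ}

theorem real_inner_I_mul_left (z w : ℂ) : ⟪Complex.I * z, w⟫ = -⟪z, Complex.I * w⟫ := by
  simp [Complex.inner]; ring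

theorem real_inner_I_mul_I_mul (z w : ℂ) : ⟪Complex.I * z, Complex.I * w⟫ = ⟪z, w⟫ := by
  simp [Complex.inner]

theorem real_inner_ofReal_mul_left (t : ℝ) (z w : ℂ) : ⟪(t : ℂ) * z, w⟫ = t * ⟪z, w⟫ := by
  rw [← real_inner_smul_left]; rfl

/-- Pairing the operator with iξ·∂f isolates the commutator of ξ·∂ with ξ·y, equal to |ξ|². The
constant force E commutes with ξ·∂ and leaves no trace; M contributes only through Mξ. -/
theorem frozen_commutator_identity {M : Rn n →L[ℝ] Rn n} (hM : ∀ y, ⟪M y, y⟫ = 0) (ξ E : Rn n)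
    (hf : ContDiff ℝ ∞ f) (hfs : HasCompactSupport f) :
    ∃ N : Rn n → ℝ, NullIntegral volume N ∧ ∀ y, 1 / 2 * ‖ξ‖ ^ 2 * ‖f y‖ ^ 2
      = -⟪frozenOp ξ E M f y, Complex.I * fderiv ℝ f y ξ⟫
        + 1 / 2 * ⟪fderiv ℝ f y (M ξ), Complex.I * f y⟫
        - ⟪laplace f y, Complex.I * fderiv ℝ f y ξ⟫
        + oscillatorPotential n y * ⟪f y, Complex.I * fderiv ℝ f y ξ⟫ + N y := by
  have hg := contDiff_dirDeriv hf ξ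
  have hgs := hasCompactSupport_dirDeriv hfs ξ
  have hS : ContDiff ℝ ∞ fun y => fderiv ℝ f y (-E - M y) :=
    (hf.fderiv_right (m := ∞) (by simp)).clm_apply (contDiff_const.sub M.contDiff)
  have hIf : ContDiff ℝ ∞ fun y => Complex.I * f y := contDiff_const.mul hf
  have n1 : NullIntegral volume fun y =>
      fderiv ℝ (fun z => 1 / 2 * (⟪ξ, z⟫ * ⟪f z, f z⟫)) y ξ :=
    nullIntegral_fderiv_const ξ
      ((contDiff_const.mul ((contDiff_const.inner ℝ contDiff_id).mul (hf.inner ℝ hf))).of_le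
        (by simp))
      (HasCompactSupport.intro hfs fun x hx => by simp [image_eq_zero_of_notMem_tsupport hx])
  have n2 : NullIntegral volume fun y =>
      fderiv ℝ (fun z => ⟪fderiv ℝ f z (-E - M z), Complex.I * f z⟫) y ξ :=
    nullIntegral_fderiv_const ξ ((hS.inner ℝ hIf).of_le (by simp))
      (HasCompactSupport.intro hfs fun x hx => by simp [image_eq_zero_of_notMem_tsupport hx])
  have n3 : NullIntegral volume fun y =>
      fderiv ℝ (fun z => ⟪dirDeriv ξ f z, Complex.I * f z⟫) y (-E - M y) :=
    nullIntegral_fderiv (divergenceFree_affine E hM) (by fun_prop)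
      ((hg.inner ℝ hIf).of_le (by simp))
      (HasCompactSupport.intro hfs fun x hx => by simp [image_eq_zero_of_notMem_tsupport hx])
  -- The two transport null terms, with weights 1/2 and -1/2, have the same second derivative of f,
  -- which cancels. They leave the pairing of the transport term with iξ·∂f and half the commutator
  -- with M.
  refine ⟨_, (n1.add (n2.const_mul (1 / 2))).add (n3.const_mul (-1 / 2)), fun y => ?_⟩
  have hb : HasFDerivAt (fun y => -E - M y) (-M) y := by
    simpa using M.hasFDerivAt.const_sub (-E)
  have hf' := (hf.differentiable (by simp) y).hasFDerivAt
  have hIf' : HasFDerivAt (fun y => Complex.I * f y) (Complex.I • fderiv ℝ f y) y :=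
    hf'.const_mul Complex.I
  have hg' := (hg.differentiable (by simp) y).hasFDerivAt
  have h1 := ((innerSL ℝ ξ).hasFDerivAt.mul (hf'.inner ℝ hf')).const_mul (1 / 2 : ℝ)
  have h2 := (hasFDerivAt_dirDeriv_field hf hb).inner ℝ hIf'
  have h3 := hg'.inner ℝ hIf'
  have e1 : fderiv ℝ (fun z => 1 / 2 * (⟪ξ, z⟫ * ⟪f z, f z⟫)) y ξ
      = 1 / 2 * ‖ξ‖ ^ 2 * ‖f y‖ ^ 2 + ⟪ξ, y⟫ * ⟪f y, fderiv ℝ f y ξ⟫ := by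
    erw [h1.fderiv]
    simp [real_inner_comm (f y)]
    ring
  have e2 : fderiv ℝ (fun z => ⟪fderiv ℝ f z (-E - M z), Complex.I * f z⟫) y ξ
      = ⟪fderiv ℝ (fderiv ℝ f) y ξ (-E - M y), Complex.I * f y⟫
        - ⟪fderiv ℝ f y (M ξ), Complex.I * f y⟫
        + ⟪fderiv ℝ f y (-E - M y), Complex.I * fderiv ℝ f y ξ⟫ := by
    rw [h2.fderiv]
    simp only [ContinuousLinearMap.comp_apply, ContinuousLinearMap.prod_apply,
      fderivInnerCLM_apply, add_apply, ContinuousLinearMap.flip_apply,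
      neg_apply, smul_apply, smul_eq_mul, map_neg,
      inner_add_left, inner_neg_left]
    ring
  have e3 : fderiv ℝ (fun z => ⟪dirDeriv ξ f z, Complex.I * f z⟫) y (-E - M y)
      = ⟪fderiv ℝ (fderiv ℝ f) y ξ (-E - M y), Complex.I * f y⟫
        - ⟪fderiv ℝ f y (-E - M y), Complex.I * fderiv ℝ f y ξ⟫ := by
    rw [h3.fderiv]
    simp only [ContinuousLinearMap.comp_apply, ContinuousLinearMap.prod_apply,
      fderivInnerCLM_apply, smul_apply, smul_eq_mul, fderiv_dirDeriv hf,
      fderiv_fderiv_comm hf _ ξ, dirDeriv]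
    have h4 := real_inner_I_mul_left (fderiv ℝ f y (-E - M y)) (fderiv ℝ f y ξ)
    rw [real_inner_comm] at h4
    linarith
  have e4 : ⟪frozenOp ξ E M f y, Complex.I * fderiv ℝ f y ξ⟫
      = ⟪fderiv ℝ f y (-E - M y), Complex.I * fderiv ℝ f y ξ⟫ + ⟪ξ, y⟫ * ⟪f y, fderiv ℝ f y ξ⟫
        - ⟪laplace f y, Complex.I * fderiv ℝ f y ξ⟫
        + oscillatorPotential n y * ⟪f y, Complex.I * fderiv ℝ f y ξ⟫ := by
    rw [frozenOp_eq, inner_add_left, inner_sub_left, inner_add_left, mul_assoc,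
      real_inner_ofReal_mul_left, real_inner_ofReal_mul_left, real_inner_I_mul_I_mul]
  rw [e1, e2, e3, e4]
  ring

/-- The commutator identity divided by x² = |ξ|^{2/3}. Every error is x² times quadratic quantities
already estimated; l⁴ enters through ‖Mξ‖ ≤ K l²x³. -/
theorem frozen_multiplier_estimate {M : Rn n →L[ℝ] Rn n} (hM : ∀ y, ⟪M y, y⟫ = 0) (ξ E : Rn n)
    (hf : ContDiff ℝ ∞ f) (hfs : HasCompactSupport f) {K l : ℝ} (hl : 1 ≤ l)
    (hMK : ‖M‖ ≤ K * l ^ 2) {x : ℝ} (hx : 0 < x) (hxi : ‖ξ‖ = x ^ 3) :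
    1 / 2 * (x ^ 4 * ∫ y, ‖f y‖ ^ 2) ≤ (∫ y, (hessSq f y + ‖y‖ ^ 2 * gradSq f y))
      + (n + 2) * (x ^ 2 * ∫ y, energySq f y)
      + (K ^ 2 + n + 1) * ((∫ y, ‖frozenOp ξ E M f y‖ ^ 2) + l ^ 4 * ∫ y, ‖f y‖ ^ 2) := by
  have iN := integrable_mul_norm_sq hf hfs continuous_const (w := fun _ => 1)
  have iP := integrable_frozenOp hf hfs ξ E M
  have iE := integrable_energySq hf hfs
  have iH := integrable_sq_mul_gradSq_add_hessSq hf hfs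
  simp only [one_mul] at iN
  obtain ⟨N, hN, hid⟩ := frozen_commutator_identity hM ξ E hf hfs
  have key := (hN.const_mul (1 / x ^ 2)).integral_le (iN.const_mul (1 / 2 * x ^ 4))
    ((iH.add (iE.const_mul ((n + 2) * x ^ 2))).add
      ((iP.add (iN.const_mul (l ^ 4))).const_mul (K ^ 2 + n + 1))) ?_
  · rw [integral_add' (iH.add (iE.const_mul _)) ((iP.add (iN.const_mul _)).const_mul _),
      integral_add' iH (iE.const_mul _), integral_const_mul, integral_const_mul,
      integral_const_mul, integral_add' iP (iN.const_mul _), integral_const_mul] at key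
    linarith
  · intro y
    simp only [Pi.add_apply]
    have hy := hid y
    rw [hxi] at hy
    set F := frozenOp ξ E M f y
    set q := fderiv ℝ f y ξ
    have pG := gradSq_nonneg f y
    have hs := Real.sq_sqrt pG
    have hs0 := Real.sqrt_nonneg (gradSq f y)
    set r := Real.sqrt (gradSq f y)
    have hl2 : 1 ≤ l ^ 2 := one_le_pow₀ hl
    have hq : ‖Complex.I * q‖ ≤ x ^ 3 * r := by
      rw [norm_mul, Complex.norm_I, one_mul]; exact hxi ▸ norm_fderiv_apply_le_sqrt f y ξ
    have b1 : -⟪F, Complex.I * q⟫ ≤ x ^ 2 * (1 / 2 * (x ^ 2 * gradSq f y) + 1 / 2 * ‖F‖ ^ 2) := by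
      have h1 : -⟪F, Complex.I * q⟫ ≤ ‖F‖ * (x ^ 3 * r) :=
        (neg_le_abs _).trans ((abs_real_inner_le_norm _ _).trans (by gcongr))
      have h2 := mul_nonneg (sq_nonneg x) (sq_nonneg (x * r - ‖F‖))
      rw [← hs]
      linarith
    have b2 : ⟪fderiv ℝ f y (M ξ), Complex.I * f y⟫
        ≤ x ^ 2 * (1 / 2 * (x ^ 2 * gradSq f y) + 1 / 2 * (K ^ 2 * (l ^ 4 * ‖f y‖ ^ 2))) := by
      have h0 : ‖M ξ‖ ≤ K * l ^ 2 * x ^ 3 :=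
        (M.le_opNorm ξ).trans (by rw [hxi]; gcongr)
      have h1 : ⟪fderiv ℝ f y (M ξ), Complex.I * f y⟫ ≤ (K * l ^ 2 * x ^ 3 * r) * ‖f y‖ := by
        refine (le_abs_self _).trans ((abs_real_inner_le_norm _ _).trans ?_)
        rw [norm_mul, Complex.norm_I, one_mul]
        gcongr
        exact (norm_fderiv_apply_le_sqrt f y (M ξ)).trans (by gcongr)
      have h2 := mul_nonneg (sq_nonneg x) (sq_nonneg (x * r - K * l ^ 2 * ‖f y‖))
      rw [← hs]
      linarith
    have b3 : -⟪laplace f y, Complex.I * q⟫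
        ≤ x ^ 2 * (hessSq f y + (n + 1) / 4 * (x ^ 2 * gradSq f y)) := by
      have h1 : -⟪laplace f y, Complex.I * q⟫ ≤ ‖laplace f y‖ * (x ^ 3 * r) :=
        (neg_le_abs _).trans ((abs_real_inner_le_norm _ _).trans (by gcongr))
      have hn : (0 : ℝ) < n + 1 := by positivity
      have h2 := two_mul_le_div_add_mul hn (1 / 2 * (x * r)) ‖laplace f y‖
      have h3 : ‖laplace f y‖ ^ 2 / (n + 1 : ℝ) ≤ hessSq f y := by
        rw [div_le_iff₀ hn]
        have := norm_laplace_sq_le f y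
        have := hessSq_nonneg f y
        linarith
      have h4 : x * r * ‖laplace f y‖ ≤ hessSq f y + (n + 1) / 4 * (x ^ 2 * gradSq f y) := by
        rw [← hs]; linarith
      have h5 := mul_le_mul_of_nonneg_left h4 (sq_nonneg x)
      linarith
    have b4 : oscillatorPotential n y * ⟪f y, Complex.I * q⟫
        ≤ x ^ 2 * (‖y‖ ^ 2 * gradSq f y + x ^ 2 * (‖y‖ ^ 2 * ‖f y‖ ^ 2)
          + n / 4 * (x ^ 2 * gradSq f y) + n / 4 * ‖f y‖ ^ 2) := by
      have h1 : |⟪f y, Complex.I * q⟫| ≤ ‖f y‖ * (x ^ 3 * r) :=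
        (abs_real_inner_le_norm _ _).trans (by gcongr)
      have h2 : |oscillatorPotential n y| ≤ ‖y‖ ^ 2 / 4 + n / 2 := by
        unfold oscillatorPotential
        refine (abs_sub _ _).trans_eq ?_
        rw [abs_of_nonneg (by positivity), abs_of_nonneg (by positivity)]
      have h3 : oscillatorPotential n y * ⟪f y, Complex.I * q⟫
          ≤ (‖y‖ ^ 2 / 4 + n / 2) * (‖f y‖ * (x ^ 3 * r)) := by
        refine (le_abs_self _).trans ?_
        rw [abs_mul]
        gcongr
      have h4 := mul_nonneg (sq_nonneg x) (sq_nonneg (‖y‖ * r - x * ‖y‖ * ‖f y‖))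
      have h5 := mul_nonneg (sq_nonneg x) (sq_nonneg (‖y‖ * r + x * ‖y‖ * ‖f y‖))
      have h6 := mul_nonneg (Nat.cast_nonneg (α := ℝ) n)
        (mul_nonneg (sq_nonneg x) (sq_nonneg (x * r - ‖f y‖)))
      rw [← hs]
      linarith
    have hx2 : 0 < x ^ 2 := by positivity
    have e1 : gradSq f y = energySq f y - ‖y‖ ^ 2 * ‖f y‖ ^ 2 := by unfold energySq; ring
    have c1 : ‖f y‖ ^ 2 ≤ l ^ 4 * ‖f y‖ ^ 2 :=
      le_mul_of_one_le_left (by positivity) (one_le_pow₀ hl)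
    have c2 : 0 ≤ ‖y‖ ^ 2 * ‖f y‖ ^ 2 := by positivity
    refine le_of_mul_le_mul_left ?_ hx2
    have e2 : x ^ 2 * (1 / x ^ 2 * N y) = N y := by field_simp
    rw [mul_add (x ^ 2) _ (1 / x ^ 2 * N y), e2]
    -- Everything is compared after multiplication by x², which clears the denominator of the null
    -- term.
    have main : x ^ 2 * (1 / 2 * x ^ 4 * ‖f y‖ ^ 2) ≤ x ^ 2 * (hessSq f y + ‖y‖ ^ 2 * gradSq f y
        + (1 / 2 + 1 / 4 + (n + 1) / 4 + n / 4) * (x ^ 2 * gradSq f y)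
        + x ^ 2 * (‖y‖ ^ 2 * ‖f y‖ ^ 2) + 1 / 2 * ‖F‖ ^ 2
        + 1 / 4 * (K ^ 2 * (l ^ 4 * ‖f y‖ ^ 2)) + n / 4 * ‖f y‖ ^ 2) + N y := by
      linarith
    refine main.trans (add_le_add (mul_le_mul_of_nonneg_left ?_ hx2.le) le_rfl)
    have c3 : (1 / 2 + 1 / 4 + (n + 1) / 4 + n / 4) * (x ^ 2 * gradSq f y)
        + x ^ 2 * (‖y‖ ^ 2 * ‖f y‖ ^ 2) ≤ (n + 2) * x ^ 2 * energySq f y := by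
      have d1 : 0 ≤ x ^ 2 * gradSq f y := by positivity
      have d2 : 0 ≤ x ^ 2 * (‖y‖ ^ 2 * ‖f y‖ ^ 2) := by positivity
      have d3 := mul_nonneg (Nat.cast_nonneg (α := ℝ) n) d1
      have d4 := mul_nonneg (Nat.cast_nonneg (α := ℝ) n) d2
      unfold energySq
      linarith
    have c4 : 1 / 2 * ‖F‖ ^ 2 + 1 / 4 * (K ^ 2 * (l ^ 4 * ‖f y‖ ^ 2)) + n / 4 * ‖f y‖ ^ 2
        ≤ (K ^ 2 + n + 1) * (‖F‖ ^ 2 + l ^ 4 * ‖f y‖ ^ 2) := by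
      have d1 : 0 ≤ K ^ 2 * (l ^ 4 * ‖f y‖ ^ 2) := by positivity
      have d2 : 0 ≤ K ^ 2 * ‖F‖ ^ 2 := by positivity
      have d3 : 0 ≤ n * ‖F‖ ^ 2 := by positivity
      have d4 := mul_le_mul_of_nonneg_left c1 (Nat.cast_nonneg (α := ℝ) n)
      have d5 : 0 ≤ n * ‖f y‖ ^ 2 := by positivity
      have d6 : 0 ≤ ‖F‖ ^ 2 := by positivity
      have d7 : 0 ≤ l ^ 4 * ‖f y‖ ^ 2 := by positivity
      linarith
    linarith

/-- The subelliptic estimate for the operator with constant coefficients. -/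
theorem exists_frozen_subelliptic_estimate (n : ℕ) (K : ℝ) : ∃ C : ℝ, 0 ≤ C ∧
    ∀ (M : Rn n →L[ℝ] Rn n) (l : ℝ), (∀ y, ⟪M y, y⟫ = 0) → 1 ≤ l → ‖M‖ ≤ K * l ^ 2 →
    ∀ (ξ E : Rn n) (f : Rn n → ℂ), ContDiff ℝ ∞ f → HasCompactSupport f →
    ‖ξ‖ ^ (4 / 3 : ℝ) * ∫ y, ‖f y‖ ^ 2
      ≤ C * ((∫ y, ‖frozenOp ξ E M f y‖ ^ 2) + l ^ 4 * ∫ y, ‖f y‖ ^ 2) := by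
  -- A is the total coefficient of x² times the energy: 32 from the second order estimate with
  -- parameter 1/8, and n + 2 from the multiplier. With ε = 1/(8A) the two estimates return at most
  -- x⁴N/4 of the x⁴N/2 on the left.
  set A : ℝ := 32 + (n + 2) with hA
  have hA0 : 0 < A := by positivity
  set ε : ℝ := 1 / (8 * A) with hε
  have hε0 : 0 < ε := by positivity
  refine ⟨4 * (A * (8 / ε + 2 * n ^ 2 / ε) + 4 * (n / 2 + 1) * (9 + 2 * n ^ 2) + 2 * (n + 1)
    + (K ^ 2 + n + 1)), by positivity, fun M l hM hl hMK ξ E f hf hfs => ?_⟩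
  have pN : 0 ≤ ∫ y, ‖f y‖ ^ 2 := integral_nonneg fun y => by positivity
  have pP : 0 ≤ ∫ y, ‖frozenOp ξ E M f y‖ ^ 2 := integral_nonneg fun y => by positivity
  have hNl : ∫ y, ‖f y‖ ^ 2 ≤ l ^ 4 * ∫ y, ‖f y‖ ^ 2 :=
    le_mul_of_one_le_left pN (one_le_pow₀ hl)
  -- The multiplier argument divides by |ξ|^{2/3}; at ξ = 0 the left side vanishes.
  rcases eq_or_ne ξ 0 with h0 | h0
  · rw [h0, norm_zero, Real.zero_rpow (by norm_num), zero_mul, ← h0]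
    positivity
  have hξ : 0 < ‖ξ‖ := norm_pos_iff.2 h0
  have h4 := rpow_third_pow hξ 4
  have h3 := rpow_third_pow hξ 3
  push_cast at h3 h4
  norm_num at h3
  have hx : 0 < ‖ξ‖ ^ (1 / 3 : ℝ) := Real.rpow_pos_of_pos hξ _
  rw [← h4]
  have e1 := frozen_multiplier_estimate hM ξ E hf hfs hl hMK hx h3.symm
  have e2 := frozen_second_order_estimate hM ξ E hf hfs (show (0 : ℝ) < 1 / 8 by norm_num) h3.symm
  have e3 := frozen_energy_estimate hM ξ E hf hfs hε0 (‖ξ‖ ^ (1 / 3 : ℝ))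
  have e4 := frozen_energy_estimate hM ξ E hf hfs one_pos 1
  generalize ‖ξ‖ ^ (1 / 3 : ℝ) = x at *
  generalize (∫ y, ‖f y‖ ^ 2) = N at *
  generalize (∫ y, ‖frozenOp ξ E M f y‖ ^ 2) = P at *
  generalize (∫ y, energySq f y) = b at *
  generalize (∫ y, (hessSq f y + ‖y‖ ^ 2 * gradSq f y)) = d at *
  set G := P + l ^ 4 * N with hG
  have hPG : P ≤ G := by linarith
  have hNG : N ≤ G := by linarith
  have e5 : b ≤ (9 + 2 * n ^ 2) * G := by
    have h5 := mul_le_mul_of_nonneg_left hNl (show (0 : ℝ) ≤ 2 * n ^ 2 by positivity)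
    have h6 : (0 : ℝ) ≤ 2 * n ^ 2 * P := by positivity
    simp only [one_pow, one_mul, div_one] at e4
    linarith
  have e6 : A * (x ^ 2 * b) ≤ 1 / 8 * (x ^ 4 * N) + A * (8 / ε + 2 * n ^ 2 / ε) * G := by
    have h5 := mul_le_mul_of_nonneg_left e3 hA0.le
    have h6 : A * (ε * (x ^ 4 * N)) = 1 / 8 * (x ^ 4 * N) := by
      rw [hε]; field_simp
    have h7 : 8 / ε * P ≤ 8 / ε * G := by gcongr
    have h8 : 2 * n ^ 2 / ε * N ≤ 2 * n ^ 2 / ε * G := by gcongr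
    have h9 := mul_le_mul_of_nonneg_left (add_le_add h7 h8) hA0.le
    linarith
  have e7 : 4 * (n / 2 + 1) * b ≤ 4 * (n / 2 + 1) * ((9 + 2 * n ^ 2) * G) := by gcongr
  have e8 : (2 * (n + 1) : ℝ) * P ≤ 2 * (n + 1) * G := by gcongr
  have e9 : A * (x ^ 2 * b) = 32 * (x ^ 2 * b) + (n + 2) * (x ^ 2 * b) := by rw [hA]; ring
  have e10 : 4 * (x ^ 2 / (1 / 8) + n / 2 + 1) * b
      = 32 * (x ^ 2 * b) + 4 * (n / 2 + 1) * b := by ring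
  linarith

end FrozenSubellipticEstimate

end

noncomputable section

/-! ### Fourier transform in x: regularity, symbol calculus, Plancherel -/

section PartialFourier

variable {n : ℕ} {v w : PhaseSpace n → ℂ}

/-- The Fourier transform in the variable `x`. -/
def partialFourier (v : PhaseSpace n → ℂ) (p : PhaseSpace n) : ℂ :=
  𝓕 (fun x : Rn n => v (x, p.2)) p.1

/-- The kernel of the Fourier transform. -/
def fourierKernel (ξ x : Rn n) : ℂ := Complex.exp (↑(-2 * Real.pi * ⟪x, ξ⟫) * Complex.I)

theorem contDiff_fourierKernel {E : Type*} [NormedAddCommGroup E] [NormedSpace ℝ E]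
    {k : WithTop ℕ∞} {ξ x : E → Rn n} (hξ : ContDiff ℝ k ξ) (hx : ContDiff ℝ k x) :
    ContDiff ℝ k fun p => fourierKernel (ξ p) (x p) := by
  unfold fourierKernel
  exact ((Complex.ofRealCLM.contDiff.comp (contDiff_const.mul (hx.inner ℝ hξ))).mul
    contDiff_const).cexp

theorem norm_fourierKernel (ξ x : Rn n) : ‖fourierKernel ξ x‖ = 1 :=
  Complex.norm_exp_ofReal_mul_I _

theorem partialFourier_eq (v : PhaseSpace n → ℂ) (p : PhaseSpace n) :
    partialFourier v p = ∫ x, fourierKernel p.1 x * v (x, p.2) := by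
  simp [partialFourier, Real.fourier_eq', fourierKernel]

theorem IsTestFunction.slice (hv : IsTestFunction v) (y : Rn n) :
    ContDiff ℝ ∞ (fun x => v (x, y)) ∧ HasCompactSupport (fun x => v (x, y)) :=
  ⟨hv.1.comp (contDiff_prodMk_left y), HasCompactSupport.intro (hv.2.isCompact.image continuous_fst)
    fun _ hx => image_eq_zero_of_notMem_tsupport fun h => hx ⟨_, h, rfl⟩⟩

theorem HasCompactSupport.slice (hv : HasCompactSupport v) (y : Rn n) :
    HasCompactSupport (fun x => v (x, y)) :=
  HasCompactSupport.intro (hv.isCompact.image continuous_fst)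
    fun _ hx => image_eq_zero_of_notMem_tsupport fun h => hx ⟨_, h, rfl⟩

/-- Joint smoothness in (ξ, y) comes from viewing the integral as a convolution of the constant 1
with a compactly supported function depending smoothly on parameters, evaluated at 0. -/
theorem contDiff_partialFourier (hv : IsTestFunction v) : ContDiff ℝ ∞ (partialFourier v) := by
  have hk : IsCompact ((fun p : PhaseSpace n => -p.1) '' tsupport v) :=
    hv.2.isCompact.image (by fun_prop)
  -- The reflections x ↦ -x undo the reflection built into convolution at 0.
  have h := contDiffOn_convolution_right_with_param_comp (μ := (volume : Measure (Rn n))) (n := ⊤)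
    (ContinuousLinearMap.lsmul ℝ ℝ) (s := (Set.univ : Set (PhaseSpace n)))
    (v := fun _ => (0 : Rn n)) contDiffOn_const
    (f := fun _ => (1 : ℝ)) (g := fun p x => fourierKernel p.1 (-x) * v (-x, p.2)) isOpen_univ hk
    (fun p x _ hx => by
      rw [image_eq_zero_of_notMem_tsupport (f := v) fun h => hx ⟨_, h, by simp⟩, mul_zero])
    (locallyIntegrable_const 1) (by
      refine ContDiff.contDiffOn (ContDiff.mul ?_ (hv.1.comp ?_))
      · exact contDiff_fourierKernel (by fun_prop) (by fun_prop)
      · fun_prop)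
  rw [contDiffOn_univ] at h
  convert! h using 1
  ext p
  rw [partialFourier_eq]
  simp [convolution]

theorem hasCompactSupport_partialFourier (hv : HasCompactSupport v) (ξ : Rn n) :
    HasCompactSupport fun y => partialFourier v (ξ, y) :=
  HasCompactSupport.intro (hv.isCompact.image continuous_snd) fun y hy => by
    have : ∀ x, v (x, y) = 0 := fun x =>
      image_eq_zero_of_notMem_tsupport fun h => hy ⟨_, h, rfl⟩
    simp [partialFourier_eq, this]

theorem integrable_fourierKernel_mul (hc : Continuous v) (hs : HasCompactSupport v)
    (p : PhaseSpace n) : Integrable fun x => fourierKernel p.1 x * v (x, p.2) :=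
  Continuous.integrable_of_hasCompactSupport
    ((contDiff_fourierKernel (k := 0) contDiff_const contDiff_id).continuous.mul (by fun_prop))
    (HasCompactSupport.slice hs p.2).mul_left

theorem partialFourier_add (hv : Continuous v) (hvs : HasCompactSupport v) (hw : Continuous w)
    (hws : HasCompactSupport w) (p : PhaseSpace n) :
    partialFourier (fun q => v q + w q) p = partialFourier v p + partialFourier w p := by
  simp only [partialFourier_eq, mul_add]
  exact integral_add (integrable_fourierKernel_mul hv hvs p) (integrable_fourierKernel_mul hw hws p)

theorem partialFourier_sub (hv : Continuous v) (hvs : HasCompactSupport v) (hw : Continuous w)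
    (hws : HasCompactSupport w) (p : PhaseSpace n) :
    partialFourier (fun q => v q - w q) p = partialFourier v p - partialFourier w p := by
  simp only [partialFourier_eq, mul_sub]
  exact integral_sub (integrable_fourierKernel_mul hv hvs p) (integrable_fourierKernel_mul hw hws p)

theorem partialFourier_sum {m : ℕ} {v : Fin m → PhaseSpace n → ℂ} (hv : ∀ j, Continuous (v j))
    (hvs : ∀ j, HasCompactSupport (v j)) (p : PhaseSpace n) :
    partialFourier (fun q => ∑ j, v j q) p = ∑ j, partialFourier (v j) p := by
  simp only [partialFourier_eq, Finset.mul_sum]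
  exact integral_finsetSum _ fun j _ => integrable_fourierKernel_mul (hv j) (hvs j) p

theorem partialFourier_mul_left (c : Rn n → ℂ) (v : PhaseSpace n → ℂ) (p : PhaseSpace n) :
    partialFourier (fun q => c q.2 * v q) p = c p.2 * partialFourier v p := by
  simp only [partialFourier_eq]
  rw [← integral_const_mul]
  congr 1 with x
  ring

theorem fderiv_slice_left (hv : IsTestFunction v) (p : PhaseSpace n) (a : Rn n) :
    fderiv ℝ (fun x => v (x, p.2)) p.1 a = fderiv ℝ v p (a, 0) := by
  have h : HasFDerivAt (fun x => v (x, p.2)) _ p.1 :=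
    ((hv.1.differentiable (by simp) (p.1, p.2)).hasFDerivAt).comp p.1
      (hasFDerivAt_prodMk_left p.1 p.2)
  rw [h.fderiv]
  simp

/-- `partialFourier` turns `∂_x` into multiplication by `2πiξ`. -/
theorem partialFourier_fderiv_fst (hv : IsTestFunction v) (a : Rn n) (p : PhaseSpace n) :
    partialFourier (fun q => fderiv ℝ v q (a, 0)) p
      = ((2 * Real.pi * ⟪a, p.1⟫ : ℝ) : ℂ) * Complex.I * partialFourier v p := by
  obtain ⟨h1, h2⟩ := hv.slice p.2
  have hi : Integrable (fun x => v (x, p.2)) := h1.continuous.integrable_of_hasCompactSupport h2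
  have hi' : Integrable (fderiv ℝ fun x => v (x, p.2)) :=
    (h1.continuous_fderiv (by simp)).integrable_of_hasCompactSupport (h2.fderiv ℝ)
  have h3 := congrFun (Real.fourier_fderiv hi (h1.differentiable (by simp)) hi') p.1
  have h4 : (fun x => fderiv ℝ v (x, p.2) (a, 0)) = fun x => fderiv ℝ (fun x => v (x, p.2)) x a := by
    ext x; exact (fderiv_slice_left hv (x, p.2) a).symm
  rw [partialFourier, h4, ← Real.fourier_continuousLinearMap_apply hi', h3]
  have h5 : innerSL ℝ p.1 a = ⟪a, p.1⟫ := by rw [innerSL_apply_apply, real_inner_comm]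
  simp [VectorFourier.fourierSMulRight_apply, partialFourier, h5]
  ring

/-- `partialFourier` commutes with `∂_y`. -/
theorem fderiv_partialFourier_snd (hv : IsTestFunction v) (ξ y b : Rn n) :
    fderiv ℝ (fun z => partialFourier v (ξ, z)) y b
      = partialFourier (fun q => fderiv ℝ v q (0, b)) (ξ, y) := by
  have hc := hv.1.continuous_fderiv (by simp)
  obtain ⟨C, hC⟩ := (hv.2.fderiv ℝ).exists_bound_of_continuous hc
  set k := Prod.fst '' tsupport v with hk
  have hkc : IsCompact k := hv.2.isCompact.image continuous_fst
  have hK : ∀ ξ : Rn n, Continuous (fourierKernel ξ) := fun ξ =>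
    (contDiff_fourierKernel (k := 0) contDiff_const contDiff_id).continuous
  set F' : Rn n → Rn n → Rn n →L[ℝ] ℂ := fun z x =>
    fourierKernel ξ x • (fderiv ℝ v (x, z)).comp (ContinuousLinearMap.inr ℝ (Rn n) (Rn n)) with hF'
  have hF'c : ∀ z, Continuous (F' z) := fun z =>
    (hK ξ).smul (((hc.comp (by fun_prop : Continuous fun x : Rn n => (x, z)))).clm_comp
      continuous_const)
  have hF's : ∀ z, HasCompactSupport (F' z) := fun z =>
    HasCompactSupport.intro hkc fun x hx => by
      have : (x, z) ∉ tsupport v := fun h => hx ⟨_, h, rfl⟩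
      simp only [hF', fderiv_eq_zero_off_tsupport this, ContinuousLinearMap.zero_comp]
      exact smul_zero (A := Rn n →L[ℝ] ℂ) (fourierKernel ξ x)
  -- The derivatives are dominated by a constant on the compact x-projection of the support, which
  -- serves all y simultaneously.
  have h := hasFDerivAt_integral_of_dominated_of_fderiv_le (μ := (volume : Measure (Rn n)))
    (F := fun z x => fourierKernel ξ x * v (x, z)) (F' := F') (x₀ := y) (s := Set.univ)
    (bound := k.indicator fun _ => C) Filter.univ_mem
    (Filter.Eventually.of_forall fun z =>
      ((hK ξ).mul (hv.1.continuous.comp (by fun_prop))).aestronglyMeasurable)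
    (integrable_fourierKernel_mul hv.1.continuous hv.2 (ξ, y))
    (hF'c y).aestronglyMeasurable
    (Filter.Eventually.of_forall fun x z _ => by
      by_cases hx : x ∈ k
      · rw [Set.indicator_of_mem hx, hF', norm_smul, norm_fourierKernel, one_mul]
        refine (ContinuousLinearMap.opNorm_comp_le _ _).trans ?_
        calc _ ≤ ‖fderiv ℝ v (x, z)‖ * 1 := by
              gcongr; exact ContinuousLinearMap.norm_inr_le_one ℝ (Rn n) (Rn n)
          _ ≤ C := by rw [mul_one]; exact hC _
      · have : (x, z) ∉ tsupport v := fun h => hx ⟨_, h, rfl⟩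
        simp [hF', hx, fderiv_eq_zero_off_tsupport this])
    ((integrableOn_const hkc.measure_ne_top).integrable_indicator hkc.measurableSet)
    (Filter.Eventually.of_forall fun x z _ => by
      have h1 := ((hv.1.differentiable (by simp) (x, z)).hasFDerivAt).comp z
        (hasFDerivAt_prodMk_right x z)
      exact h1.const_mul (fourierKernel ξ x))
  have h2 : (fun z => partialFourier v (ξ, z)) = fun z => ∫ x, fourierKernel ξ x * v (x, z) := by
    ext z; exact partialFourier_eq v _
  rw [h2, h.fderiv, partialFourier_eq, ContinuousLinearMap.integral_apply
    ((hF'c y).integrable_of_hasCompactSupport (hF's y))]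
  simp [hF']

/-- Plancherel's theorem on Schwartz functions, for the lower Lebesgue integral. -/
theorem SchwartzMap.lintegral_enorm_sq_fourier (f : SchwartzMap (Rn n) ℂ) :
    ∫⁻ ξ, ‖𝓕 (f : Rn n → ℂ) ξ‖ₑ ^ 2 = ∫⁻ x, ‖f x‖ₑ ^ 2 := by
  have h : ∀ g : SchwartzMap (Rn n) ℂ, ∫⁻ x, ‖g x‖ₑ ^ 2 = ENNReal.ofReal (∫ x, ‖g x‖ ^ 2) := by
    intro g
    have hi : Integrable fun x => ‖g x‖ ^ 2 := (g.memLp 2 volume).integrable_norm_pow (by norm_num)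
    rw [ofReal_integral_eq_lintegral_ofReal hi (Filter.Eventually.of_forall fun x => by positivity)]
    simp_rw [ENNReal.ofReal_pow (norm_nonneg _), ofReal_norm]
  rw [h f, ← SchwartzMap.integral_norm_sq_fourier, ← h, ← SchwartzMap.fourier_coe]

theorem lintegral_enorm_sq_partialFourier (hv : IsTestFunction v) (y : Rn n) :
    ∫⁻ ξ, ‖partialFourier v (ξ, y)‖ₑ ^ 2 = ∫⁻ x, ‖v (x, y)‖ₑ ^ 2 := by
  obtain ⟨h1, h2⟩ := hv.slice y
  exact SchwartzMap.lintegral_enorm_sq_fourier (h2.toSchwartzMap h1)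

theorem partialFourier_comp_add (v : PhaseSpace n → ℂ) (a : Rn n) (p : PhaseSpace n) :
    partialFourier (fun q => v (q.1 + a, q.2)) p
      = Complex.exp (↑(2 * Real.pi * ⟪a, p.1⟫) * Complex.I) * partialFourier v p := by
  have h := congrFun (VectorFourier.fourierIntegral_comp_add_right Real.fourierChar
    (volume : Measure (Rn n)) (innerₗ (Rn n)) (fun x => v (x, p.2)) a) p.1
  refine (Eq.trans ?_ h).trans ?_
  · rfl
  · rw [Circle.smul_def, Real.fourierChar_apply, smul_eq_mul]
    rfl

theorem IsTestFunction.fderiv_apply (hv : IsTestFunction v) (d : PhaseSpace n) :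
    IsTestFunction fun q => fderiv ℝ v q d :=
  ⟨contDiff_fderiv_apply_const hv.1 d, hv.2.fderiv_apply ℝ d⟩

theorem map_eq_sum_stdVec (T : Rn n →L[ℝ] ℂ) (a : Rn n) :
    T a = ∑ j, (a j : ℂ) * T (stdVec j) := by
  conv_lhs => rw [← sum_smul_stdVec a]
  simp

theorem map_phaseSpace_eq_sum (T : PhaseSpace n →L[ℝ] ℂ) (a b : Rn n) :
    T (a, b) = (∑ j, (a j : ℂ) * T (stdVec j, 0)) + ∑ j, (b j : ℂ) * T (0, stdVec j) := by
  have h1 := map_eq_sum_stdVec (T.comp (ContinuousLinearMap.inl ℝ (Rn n) (Rn n))) a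
  have h2 := map_eq_sum_stdVec (T.comp (ContinuousLinearMap.inr ℝ (Rn n) (Rn n))) b
  simp only [ContinuousLinearMap.comp_apply, ContinuousLinearMap.inl_apply,
    ContinuousLinearMap.inr_apply] at h1 h2
  rw [← h1, ← h2, ← map_add]
  simp

/-- The frozen operator is the partial Fourier transform of the operator with constant
coefficients. -/
theorem frozenOp_partialFourier (hv : IsTestFunction v) (E : Rn n) (M : Rn n →L[ℝ] Rn n)
    (ξ y : Rn n) :
    frozenOp ((2 * Real.pi) • ξ) E M (fun z => partialFourier v (ξ, z)) y
      = partialFourier (fokkerPlanckOp (fun _ => E) (fun _ => M) v) (ξ, y) := by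
  have hX := fun j => hv.fderiv_apply ((stdVec j, 0) : PhaseSpace n)
  have hY := fun j => hv.fderiv_apply ((0, stdVec j) : PhaseSpace n)
  have hYY := fun j => (hY j).fderiv_apply ((0, stdVec j) : PhaseSpace n)
  have e1 : fokkerPlanckOp (fun _ => E) (fun _ => M) v = fun q =>
      (∑ j, (q.2 j : ℂ) * fderiv ℝ v q (stdVec j, 0))
        + (∑ j, ((-E - M q.2) j : ℂ) * fderiv ℝ v q (0, stdVec j))
        - (∑ j, fderiv ℝ (fun q => fderiv ℝ v q (0, stdVec j)) q (0, stdVec j))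
        + (oscillatorPotential n q.2 : ℂ) * v q := by
    ext q
    simp only [fokkerPlanckOp, kineticOp, transportField, map_phaseSpace_eq_sum (fderiv ℝ v q) q.2]
    simp
  have cX : ∀ j, Continuous fun q : PhaseSpace n => (q.2 j : ℂ) * fderiv ℝ v q (stdVec j, 0) :=
    fun j => (by fun_prop : Continuous fun q : PhaseSpace n => (q.2 j : ℂ)).mul (hX j).1.continuous
  have cY : ∀ j, Continuous fun q : PhaseSpace n =>
      ((-E - M q.2) j : ℂ) * fderiv ℝ v q (0, stdVec j) := fun j =>
    (by fun_prop : Continuous fun q : PhaseSpace n => ((-E - M q.2) j : ℂ)).mul (hY j).1.continuous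
  have sX : ∀ j, HasCompactSupport fun q : PhaseSpace n =>
      (q.2 j : ℂ) * fderiv ℝ v q (stdVec j, 0) := fun j => (hX j).2.mul_left
  have sY : ∀ j, HasCompactSupport fun q : PhaseSpace n =>
      ((-E - M q.2) j : ℂ) * fderiv ℝ v q (0, stdVec j) := fun j => (hY j).2.mul_left
  have ssum : ∀ {g : Fin n → PhaseSpace n → ℂ}, (∀ j, HasCompactSupport (g j)) →
      HasCompactSupport fun q => ∑ j, g j q := fun {g} hg =>
    HasCompactSupport.intro (isCompact_iUnion fun j => (hg j).isCompact) fun q hq =>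
      Finset.sum_eq_zero fun j _ => image_eq_zero_of_notMem_tsupport fun h =>
        hq (Set.mem_iUnion.2 ⟨j, h⟩)
  have hq : Continuous fun q : PhaseSpace n => (oscillatorPotential n q.2 : ℂ) * v q :=
    (Complex.continuous_ofReal.comp
      (continuous_oscillatorPotential.comp continuous_snd)).mul hv.1.continuous
  have c1 := continuous_finsetSum Finset.univ fun j _ => cX j
  have c2 := continuous_finsetSum Finset.univ fun j _ => cY j
  have c3 := continuous_finsetSum Finset.univ fun j _ => (hYY j).1.continuous
  have s3 := ssum fun j => (hYY j).2
  have e2 : partialFourier (fokkerPlanckOp (fun _ => E) (fun _ => M) v) (ξ, y)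
      = (∑ j, partialFourier (fun q => (q.2 j : ℂ) * fderiv ℝ v q (stdVec j, 0)) (ξ, y))
        + (∑ j, partialFourier (fun q => ((-E - M q.2) j : ℂ) * fderiv ℝ v q (0, stdVec j)) (ξ, y))
        - (∑ j, partialFourier
          (fun q => fderiv ℝ (fun q => fderiv ℝ v q (0, stdVec j)) q (0, stdVec j)) (ξ, y))
        + partialFourier (fun q => (oscillatorPotential n q.2 : ℂ) * v q) (ξ, y) := by
    rw [e1]
    refine (partialFourier_add ((c1.add c2).sub c3) (((ssum sX).add (ssum sY)).sub s3) hq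
      hv.2.mul_left (ξ, y)).trans ?_
    refine congrArg (· + _) ((partialFourier_sub (c1.add c2) ((ssum sX).add (ssum sY)) c3 s3
      (ξ, y)).trans ?_)
    rw [← partialFourier_sum cX sX, ← partialFourier_sum cY sY,
      ← partialFourier_sum (fun j => (hYY j).1.continuous) fun j => (hYY j).2]
    exact congrArg (· - _) (partialFourier_add c1 (ssum sX) c2 (ssum sY) (ξ, y))
  rw [e2, frozenOp_eq, map_eq_sum_stdVec]
  have t1 : ∀ j : Fin n, partialFourier (fun q => (q.2 j : ℂ) * fderiv ℝ v q (stdVec j, 0)) (ξ, y)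
      = ((2 * Real.pi * (y j * ξ j) : ℝ) : ℂ) * Complex.I * partialFourier v (ξ, y) := fun j => by
    rw [partialFourier_mul_left (fun y => (y j : ℂ)), partialFourier_fderiv_fst hv]
    simp [stdVec, EuclideanSpace.inner_single_left]
    ring
  have t2 : ∀ j : Fin n, partialFourier (fun q => ((-E - M q.2) j : ℂ)
      * fderiv ℝ v q (0, stdVec j)) (ξ, y)
      = ((-E - M y) j : ℂ) * fderiv ℝ (fun z => partialFourier v (ξ, z)) y (stdVec j) := fun j => by
    rw [partialFourier_mul_left (fun y => ((-E - M y) j : ℂ)), fderiv_partialFourier_snd hv]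
  have t3 : laplace (fun z => partialFourier v (ξ, z)) y = ∑ j, partialFourier
      (fun q => fderiv ℝ (fun q => fderiv ℝ v q (0, stdVec j)) q (0, stdVec j)) (ξ, y) := by
    refine Finset.sum_congr rfl fun j _ => ?_
    rw [← fderiv_partialFourier_snd (hY j)]
    have : dirDeriv (stdVec j) (fun z => partialFourier v (ξ, z))
        = fun z => partialFourier (fun q => fderiv ℝ v q (0, stdVec j)) (ξ, z) := by
      ext z; exact fderiv_partialFourier_snd hv ξ z (stdVec j)
    rw [dirDeriv, this]
  have t4 : ((⟪(2 * Real.pi) • ξ, y⟫ : ℝ) : ℂ)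
      = ∑ j, ((2 * Real.pi * (y j * ξ j) : ℝ) : ℂ) := by
    rw [real_inner_smul_left, ← Complex.ofReal_sum, ← Finset.mul_sum]
    simp [PiLp.inner_apply]
  rw [t3, t4, partialFourier_mul_left (fun y => (oscillatorPotential n y : ℂ)),
    Finset.sum_congr rfl fun j _ => t1 j, Finset.sum_congr rfl fun j _ => t2 j,
    ← Finset.sum_mul, ← Finset.sum_mul]
  ring

end PartialFourier

end

noncomputable section

/-! ### Constant coefficient estimate on phase space and interpolation -/

section LiftedEstimate

variable {n : ℕ} {v : PhaseSpace n → ℂ}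

theorem lintegral_enorm_sq_eq_ofReal {E : Type*} [NormedAddCommGroup E] [MeasurableSpace E]
    [NormedSpace ℝ E] [BorelSpace E] {μ : Measure E} [IsFiniteMeasureOnCompacts μ] {f : E → ℂ}
    (hf : Continuous f) (hs : HasCompactSupport f) :
    ∫⁻ x, ‖f x‖ₑ ^ 2 ∂μ = ENNReal.ofReal (∫ x, ‖f x‖ ^ 2 ∂μ) := by
  have hi : Integrable (fun x => ‖f x‖ ^ 2) μ :=
    integrable_of_eq_zero_off_tsupport hs (hf.norm.pow 2) fun x hx => by
      simp [image_eq_zero_of_notMem_tsupport hx]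
  rw [ofReal_integral_eq_lintegral_ofReal hi (Filter.Eventually.of_forall fun x => by positivity)]
  simp_rw [ENNReal.ofReal_pow (norm_nonneg _), ofReal_norm]

theorem lintegral_prod_partialFourier (hv : IsTestFunction v) {w : Rn n → ENNReal}
    (hw : Measurable w) : ∫⁻ p : PhaseSpace n, w p.1 * ‖partialFourier v p‖ₑ ^ 2
      = ∫⁻ ξ, w ξ * ∫⁻ y, ‖partialFourier v (ξ, y)‖ₑ ^ 2 := by
  have hc := (contDiff_partialFourier hv).continuous
  rw [Measure.volume_eq_prod, lintegral_prod _ (by fun_prop)]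
  refine lintegral_congr fun ξ => ?_
  have hξ : Continuous fun y => partialFourier v (ξ, y) := by fun_prop
  exact lintegral_const_mul (w ξ) (hξ.measurable.enorm.pow_const 2)

theorem lintegral_enorm_sq_partialFourier_phaseSpace (hv : IsTestFunction v) :
    ∫⁻ p, ‖partialFourier v p‖ₑ ^ 2 = ∫⁻ p, ‖v p‖ₑ ^ 2 := by
  have hc := (contDiff_partialFourier hv).continuous
  have hc' := hv.1.continuous
  rw [Measure.volume_eq_prod, lintegral_prod_symm _ (by fun_prop),
    lintegral_prod_symm _ (by fun_prop)]
  exact lintegral_congr fun y => lintegral_enorm_sq_partialFourier hv y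

theorem IsTestFunction.fokkerPlanckOp_const (hv : IsTestFunction v) (E : Rn n)
    (M : Rn n →L[ℝ] Rn n) : IsTestFunction (fokkerPlanckOp (fun _ => E) (fun _ => M) v) := by
  refine ⟨?_, HasCompactSupport.intro hv.2.isCompact fun q hq => by
    simp [fokkerPlanckOp, kineticOp_eq_zero_off_tsupport hq]⟩
  have h1 : ContDiff ℝ ∞ fun q : PhaseSpace n =>
      fderiv ℝ v q (transportField (fun _ => E) (fun _ => M) q) :=
    (hv.1.fderiv_right (m := ∞) (by simp)).clm_apply (by unfold transportField; fun_prop)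
  have h2 : ContDiff ℝ ∞ fun q : PhaseSpace n =>
      ∑ j : Fin n, fderiv ℝ (fun z => fderiv ℝ v z (0, stdVec j)) q (0, stdVec j) :=
    ContDiff.sum fun j _ => ((hv.fderiv_apply _).fderiv_apply _).1
  have h3 : ContDiff ℝ ∞ fun q : PhaseSpace n => (oscillatorPotential n q.2 : ℂ) * v q :=
    (Complex.ofRealCLM.contDiff.comp ((((contDiff_norm_sq ℝ).comp contDiff_snd).div_const 4).sub
      contDiff_const)).mul hv.1
  convert (h1.sub h2).add h3 using 1
  ext q
  simp [fokkerPlanckOp, kineticOp]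

/-- The subelliptic estimate for constant coefficients. -/
theorem exists_constant_coefficient_estimate (n : ℕ) (K : ℝ) : ∃ C : ℝ, 0 ≤ C ∧
    ∀ (M : Rn n →L[ℝ] Rn n) (l : ℝ), (∀ y, ⟪M y, y⟫ = 0) → 1 ≤ l → ‖M‖ ≤ K * l ^ 2 →
    ∀ (E : Rn n) (v : PhaseSpace n → ℂ), IsTestFunction v →
    ∫⁻ p : PhaseSpace n, ENNReal.ofReal (‖(2 * Real.pi) • p.1‖ ^ (4 / 3 : ℝ))
        * ‖partialFourier v p‖ₑ ^ 2
      ≤ ENNReal.ofReal C * ((∫⁻ p, ‖fokkerPlanckOp (fun _ => E) (fun _ => M) v p‖ₑ ^ 2)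
        + ENNReal.ofReal (l ^ 4) * ∫⁻ p, ‖v p‖ₑ ^ 2) := by
  obtain ⟨C, hC, h⟩ := exists_frozen_subelliptic_estimate n K
  refine ⟨C, hC, fun M l hM hl hMl E v hv => ?_⟩
  have hP := hv.fokkerPlanckOp_const E M
  have hc := (contDiff_partialFourier hv).continuous
  have hPc := (contDiff_partialFourier hP).continuous
  rw [← lintegral_enorm_sq_partialFourier_phaseSpace hv,
    ← lintegral_enorm_sq_partialFourier_phaseSpace hP,
    lintegral_prod_partialFourier hv (w := fun ξ =>
      ENNReal.ofReal (‖(2 * Real.pi) • ξ‖ ^ (4 / 3 : ℝ))) (by fun_prop)]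
  have hm : ∀ {g : PhaseSpace n → ℂ}, Continuous g →
      Measurable fun ξ : Rn n => ∫⁻ y, ‖g (ξ, y)‖ₑ ^ 2 := fun {g} hg =>
    Measurable.lintegral_prod_right' (f := fun p : PhaseSpace n => ‖g p‖ₑ ^ 2) (by fun_prop)
  have hsplit : ∀ {g : PhaseSpace n → ℂ}, Continuous g →
      ∫⁻ p, ‖g p‖ₑ ^ 2 = ∫⁻ ξ : Rn n, ∫⁻ y, ‖g (ξ, y)‖ₑ ^ 2 := fun {g} hg => by
    rw [Measure.volume_eq_prod, lintegral_prod _ (by fun_prop)]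
  rw [hsplit hc, hsplit hPc, ← lintegral_const_mul _ (hm hc), ← lintegral_add_left (hm hPc),
    ← lintegral_const_mul' _ _ ENNReal.ofReal_ne_top]
  refine lintegral_mono fun ξ => ?_
  have hξ : Continuous fun y => partialFourier v (ξ, y) := by fun_prop
  have hPξ : Continuous fun y =>
      partialFourier (fokkerPlanckOp (fun _ => E) (fun _ => M) v) (ξ, y) := by fun_prop
  have hf := h M l hM hl hMl ((2 * Real.pi) • ξ) E (fun y => partialFourier v (ξ, y))
    ((contDiff_partialFourier hv).comp (contDiff_prodMk_right ξ))
    (hasCompactSupport_partialFourier hv.2 ξ)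
  simp only [frozenOp_partialFourier hv] at hf
  rw [lintegral_enorm_sq_eq_ofReal hξ (hasCompactSupport_partialFourier hv.2 ξ),
    lintegral_enorm_sq_eq_ofReal hPξ (hasCompactSupport_partialFourier hP.2 ξ),
    ← ENNReal.ofReal_mul (by positivity), ← ENNReal.ofReal_mul (by positivity),
    ← ENNReal.ofReal_add (by positivity) (by positivity), ← ENNReal.ofReal_mul hC]
  exact ENNReal.ofReal_le_ofReal hf

/-- Young's inequality for the interpolation between the weights `|ξ|^{4/3}` and `Λ^{4/3}`. -/
theorem rpow_le_weight_mul_add {a t s τ : ℝ} (ha : 0 ≤ a) (ht : 1 ≤ t) (hs : 2 / 3 ≤ s)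
    (hτ0 : 0 < τ) (hτ : τ ≤ 2 / 3) (hτs : τ ≤ 4 / 3 - s) :
    a ^ (2 * τ) ≤ t ^ (2 / 3 - s) * a ^ (4 / 3 : ℝ) + t ^ (4 / 3 : ℝ) := by
  have ht0 : 0 < t := by linarith
  -- The threshold is the value of a at which a^{2τ} equals t^{4/3}. Above it, only the comparison
  -- of a^{2τ-4/3} with t^{2/3-s} remains.
  rcases le_or_gt a (t ^ (2 / (3 * τ))) with h | h
  · have : a ^ (2 * τ) ≤ t ^ (4 / 3 : ℝ) := by
      calc a ^ (2 * τ) ≤ (t ^ (2 / (3 * τ))) ^ (2 * τ) := by gcongr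
        _ = t ^ (4 / 3 : ℝ) := by rw [← Real.rpow_mul ht0.le]; congr 1; field_simp; norm_num
    have : 0 ≤ t ^ (2 / 3 - s) * a ^ (4 / 3 : ℝ) := by positivity
    linarith
  · have ha0 : 0 < a := lt_trans (by positivity) h
    have h1 : a ^ (2 * τ - 4 / 3) ≤ t ^ (2 / 3 - s) := by
      calc a ^ (2 * τ - 4 / 3) ≤ (t ^ (2 / (3 * τ))) ^ (2 * τ - 4 / 3) :=
            Real.rpow_le_rpow_of_nonpos (by positivity) h.le (by linarith)
        _ = t ^ (4 / 3 - 8 / (9 * τ)) := by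
            rw [← Real.rpow_mul ht0.le]; congr 1; field_simp; ring
        _ ≤ t ^ (2 / 3 - s) := by
            refine Real.rpow_le_rpow_of_exponent_le ht ?_
            -- Since τ ≤ 4/3 - s, this follows from (4/3 - s)(s + 2/3) = 8/9 - s(s - 2/3) ≤ 8/9.
            have : s + 2 / 3 ≤ 8 / (9 * τ) := by
              rw [le_div_iff₀ (by positivity)]
              nlinarith [mul_nonneg (by linarith : (0 : ℝ) ≤ s - 2 / 3) (by linarith : 0 ≤ s)]
            linarith
    calc a ^ (2 * τ) = a ^ (2 * τ - 4 / 3) * a ^ (4 / 3 : ℝ) := by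
          rw [← Real.rpow_add ha0]; congr 1; ring
      _ ≤ t ^ (2 / 3 - s) * a ^ (4 / 3 : ℝ) := by gcongr
      _ ≤ _ := by have : 0 ≤ t ^ (4 / 3 : ℝ) := by positivity
                  linarith

/-- The constant coefficient estimate after interpolation. -/
theorem exists_interpolated_estimate (n : ℕ) (K : ℝ) : ∃ C : ℝ, 0 ≤ C ∧
    ∀ (M : Rn n →L[ℝ] Rn n) (t s τ : ℝ), (∀ y, ⟪M y, y⟫ = 0) → 1 ≤ t →
    ‖M‖ ≤ K * t ^ (2 / 3 : ℝ) → 2 / 3 ≤ s → 0 < τ → τ ≤ 2 / 3 → τ ≤ 4 / 3 - s →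
    ∀ (E : Rn n) (v : PhaseSpace n → ℂ), IsTestFunction v →
    ∫⁻ p : PhaseSpace n, ENNReal.ofReal (‖(2 * Real.pi) • p.1‖ ^ (2 * τ))
        * ‖partialFourier v p‖ₑ ^ 2
      ≤ ENNReal.ofReal C * (ENNReal.ofReal (t ^ (2 / 3 - s))
          * (∫⁻ p, ‖fokkerPlanckOp (fun _ => E) (fun _ => M) v p‖ₑ ^ 2)
        + ENNReal.ofReal (t ^ (4 / 3 : ℝ)) * ∫⁻ p, ‖v p‖ₑ ^ 2) := by
  obtain ⟨C, hC, h⟩ := exists_constant_coefficient_estimate n K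
  refine ⟨C + 1, by positivity, fun M t s τ hM ht hMt hs hτ0 hτ hτs E v hv => ?_⟩
  have ht0 : 0 < t := by linarith
  have hc := (contDiff_partialFourier hv).continuous
  have e2 : (t ^ (1 / 3 : ℝ)) ^ 2 = t ^ (2 / 3 : ℝ) := by
    rw [rpow_third_pow ht0]; norm_num
  have e4 : (t ^ (1 / 3 : ℝ)) ^ 4 = t ^ (4 / 3 : ℝ) := by
    rw [rpow_third_pow ht0]; norm_num
  have h1 := h M (t ^ (1 / 3 : ℝ)) hM (Real.one_le_rpow ht (by norm_num)) (by rwa [e2]) E v hv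
  rw [e4] at h1
  set A := ∫⁻ p, ‖fokkerPlanckOp (fun _ => E) (fun _ => M) v p‖ₑ ^ 2
  set B := ∫⁻ p, ‖v p‖ₑ ^ 2 with hB
  calc _ ≤ ∫⁻ p : PhaseSpace n, (ENNReal.ofReal (t ^ (2 / 3 - s))
          * (ENNReal.ofReal (‖(2 * Real.pi) • p.1‖ ^ (4 / 3 : ℝ)) * ‖partialFourier v p‖ₑ ^ 2)
        + ENNReal.ofReal (t ^ (4 / 3 : ℝ)) * ‖partialFourier v p‖ₑ ^ 2) := by
        refine lintegral_mono fun p => ?_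
        rw [← mul_assoc, ← add_mul, ← ENNReal.ofReal_mul (by positivity),
          ← ENNReal.ofReal_add (by positivity) (by positivity)]
        gcongr
        exact rpow_le_weight_mul_add (norm_nonneg _) ht hs hτ0 hτ hτs
    _ = ENNReal.ofReal (t ^ (2 / 3 - s)) * (∫⁻ p : PhaseSpace n,
          ENNReal.ofReal (‖(2 * Real.pi) • p.1‖ ^ (4 / 3 : ℝ)) * ‖partialFourier v p‖ₑ ^ 2)
        + ENNReal.ofReal (t ^ (4 / 3 : ℝ)) * B := by
        rw [lintegral_add_left (by fun_prop), lintegral_const_mul _ (by fun_prop),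
          lintegral_const_mul _ (by fun_prop), lintegral_enorm_sq_partialFourier_phaseSpace hv]
    _ ≤ ENNReal.ofReal (t ^ (2 / 3 - s))
          * (ENNReal.ofReal C * (A + ENNReal.ofReal (t ^ (4 / 3 : ℝ)) * B))
        + ENNReal.ofReal (t ^ (4 / 3 : ℝ)) * B := by gcongr
    _ = ENNReal.ofReal C * (ENNReal.ofReal (t ^ (2 / 3 - s)) * A)
        + ENNReal.ofReal C * (ENNReal.ofReal (t ^ (2 / 3 - s))
          * (ENNReal.ofReal (t ^ (4 / 3 : ℝ)) * B))
        + ENNReal.ofReal (t ^ (4 / 3 : ℝ)) * B := by ring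
    _ ≤ ENNReal.ofReal C * (ENNReal.ofReal (t ^ (2 / 3 - s)) * A)
        + ENNReal.ofReal C * (1 * (ENNReal.ofReal (t ^ (4 / 3 : ℝ)) * B))
        + ENNReal.ofReal (t ^ (4 / 3 : ℝ)) * B
        + ENNReal.ofReal (t ^ (2 / 3 - s)) * A := by
        refine le_add_right ?_
        gcongr
        exact ENNReal.ofReal_le_one.2 (Real.rpow_le_one_of_one_le_of_nonpos ht (by linarith))
    _ = _ := by
        rw [ENNReal.ofReal_add hC zero_le_one, ENNReal.ofReal_one]; ring

end LiftedEstimate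

end

noncomputable section

/-! ### Fractional Sobolev norms through finite differences -/

section Gagliardo

/-- The integral of `f` over `(0, ∞)` with density `t ^ (-1 - 2τ)`. -/
def scaleIntegral (τ : ℝ) (f : ℝ → ENNReal) : ENNReal :=
  ∫⁻ t in Set.Ioi 0, ENNReal.ofReal (t ^ (-1 - 2 * τ)) * f t

variable {τ : ℝ}

theorem scaleIntegral_mono {f g : ℝ → ENNReal} (h : ∀ t, 0 < t → f t ≤ g t) :
    scaleIntegral τ f ≤ scaleIntegral τ g :=
  setLIntegral_mono' measurableSet_Ioi fun t ht => by gcongr; exact h t ht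

theorem scaleIntegral_const_mul {f : ℝ → ENNReal} {c : ENNReal} (hc : c ≠ ⊤) :
    scaleIntegral τ (fun t => c * f t) = c * scaleIntegral τ f := by
  rw [scaleIntegral, scaleIntegral, ← lintegral_const_mul' _ _ hc]
  exact lintegral_congr fun t => by ring

/-- The measure t^{-1-2τ}dt is homogeneous of degree -2τ, so rescaling t by a produces a^{2τ}. This
turns differences into powers of ξ, and the localization error into powers of 1/ρ. -/
theorem scaleIntegral_comp_mul {f : ℝ → ENNReal} (hf : Measurable f) {a : ℝ} (ha : 0 < a) :
    scaleIntegral τ (fun t => f (a * t)) = ENNReal.ofReal (a ^ (2 * τ)) * scaleIntegral τ f := by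
  set h : ℝ → ENNReal := fun t => ENNReal.ofReal (t ^ (-1 - 2 * τ)) * f t with hh
  have hm : Measurable h := by fun_prop
  have e1 : ∫⁻ t in Set.Ioi 0, h (a * t) = ENNReal.ofReal a⁻¹ * ∫⁻ t in Set.Ioi 0, h t := by
    have h1 := setLIntegral_map (μ := (volume : Measure ℝ)) (s := Set.Ioi 0) measurableSet_Ioi hm
      (measurable_const_mul a)
    rw [Real.map_volume_mul_left ha.ne', abs_of_pos (inv_pos.2 ha), Measure.restrict_smul,
      lintegral_smul_measure, smul_eq_mul] at h1
    rw [h1]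
    congr 2
    ext t
    simp [ha]
  calc scaleIntegral τ (fun t => f (a * t))
      = ∫⁻ t in Set.Ioi 0, ENNReal.ofReal (a ^ (1 + 2 * τ)) * h (a * t) := by
        refine setLIntegral_congr_fun measurableSet_Ioi fun t ht => ?_
        have ht0 : 0 < t := ht
        simp only [hh]
        rw [← mul_assoc, ← ENNReal.ofReal_mul (by positivity), Real.mul_rpow ha.le ht0.le,
          ← mul_assoc, ← Real.rpow_add ha]
        rw [show 1 + 2 * τ + (-1 - 2 * τ) = 0 by ring, Real.rpow_zero, one_mul]
    _ = ENNReal.ofReal (a ^ (1 + 2 * τ)) * (ENNReal.ofReal a⁻¹ * ∫⁻ t in Set.Ioi 0, h t) := by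
        rw [lintegral_const_mul' _ _ ENNReal.ofReal_ne_top, e1]
    _ = _ := by
        rw [← mul_assoc, ← ENNReal.ofReal_mul (by positivity), ← Real.rpow_neg_one a,
          ← Real.rpow_add ha]
        congr 3
        ring

/-- Convergence at 0 needs τ < 1, convergence at infinity needs τ > 0. -/
theorem scaleIntegral_min_one_sq_lt_top (h0 : 0 < τ) (h1 : τ < 1) :
    scaleIntegral τ (fun t => ENNReal.ofReal (min 1 (t ^ 2))) < ⊤ := by
  have hI1 : IntegrableOn (fun t : ℝ => t ^ (1 - 2 * τ)) (Set.Ioc 0 1) :=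
    (intervalIntegrable_iff_integrableOn_Ioc_of_le zero_le_one).1
      (intervalIntegral.intervalIntegrable_rpow' (by linarith))
  have hI2 : IntegrableOn (fun t : ℝ => t ^ (-1 - 2 * τ)) (Set.Ioi 1) :=
    integrableOn_Ioi_rpow_of_lt (by linarith) one_pos
  rw [scaleIntegral, ← Set.Ioc_union_Ioi_eq_Ioi (zero_le_one' ℝ),
    lintegral_union measurableSet_Ioi (Set.Ioc_disjoint_Ioi le_rfl)]
  refine ENNReal.add_lt_top.2 ⟨lt_of_le_of_lt ?_ hI1.lintegral_lt_top,
    lt_of_le_of_lt ?_ hI2.lintegral_lt_top⟩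
  · refine setLIntegral_mono' measurableSet_Ioc fun t ht => ?_
    rw [← ENNReal.ofReal_mul (Real.rpow_nonneg ht.1.le _)]
    refine ENNReal.ofReal_le_ofReal ?_
    calc t ^ (-1 - 2 * τ) * min 1 (t ^ 2) ≤ t ^ (-1 - 2 * τ) * t ^ 2 :=
          mul_le_mul_of_nonneg_left (min_le_right _ _) (Real.rpow_nonneg ht.1.le _)
      _ = t ^ (1 - 2 * τ) := by
          rw [← Real.rpow_natCast t 2, ← Real.rpow_add ht.1]; congr 1; push_cast; ring
  · refine setLIntegral_mono' measurableSet_Ioi fun t ht => ?_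
    have ht0 : (0 : ℝ) < t := one_pos.trans ht
    rw [← ENNReal.ofReal_mul (by positivity)]
    refine ENNReal.ofReal_le_ofReal (mul_le_of_le_one_right (by positivity) (min_le_left _ _))

/-- The function `|exp (it) - 1|²`. -/
def chordSq (t : ℝ) : ENNReal := ENNReal.ofReal (4 * Real.sin (t / 2) ^ 2)

theorem measurable_chordSq : Measurable chordSq := by unfold chordSq; fun_prop

theorem enorm_exp_sub_one_sq (t : ℝ) : ‖Complex.exp (↑t * Complex.I) - 1‖ₑ ^ 2 = chordSq t := by
  rw [← ofReal_norm, ← ENNReal.ofReal_pow (norm_nonneg _), mul_comm,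
    Complex.norm_exp_I_mul_ofReal_sub_one, Real.norm_eq_abs, sq_abs, chordSq]
  ring_nf

theorem chordSq_abs (t : ℝ) : chordSq |t| = chordSq t := by
  rcases abs_choice t with h | h <;> rw [h]
  simp [chordSq, neg_div]

theorem scaleIntegral_chordSq_lt_top (h0 : 0 < τ) (h1 : τ < 1) :
    scaleIntegral τ chordSq < ⊤ := by
  have h : scaleIntegral τ chordSq
      ≤ scaleIntegral τ (fun t => ENNReal.ofReal 4 * ENNReal.ofReal (min 1 (t ^ 2))) := by
    refine scaleIntegral_mono fun t ht => ?_
    rw [chordSq, ← ENNReal.ofReal_mul (by norm_num)]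
    refine ENNReal.ofReal_le_ofReal ?_
    have h2 : Real.sin (t / 2) ^ 2 ≤ 1 := Real.sin_sq_le_one _
    have h3 : Real.sin (t / 2) ^ 2 ≤ (t / 2) ^ 2 := by
      rw [sq_le_sq]; exact Real.abs_sin_le_abs
    have : Real.sin (t / 2) ^ 2 ≤ min 1 (t ^ 2) := le_min h2 (by nlinarith [sq_nonneg t])
    linarith
  refine h.trans_lt ?_
  rw [scaleIntegral_const_mul ENNReal.ofReal_ne_top]
  exact ENNReal.mul_lt_top ENNReal.ofReal_lt_top (scaleIntegral_min_one_sq_lt_top h0 h1)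

theorem scaleIntegral_chordSq_pos (τ : ℝ) : 0 < scaleIntegral τ chordSq := by
  have hm : Measurable fun t : ℝ => ENNReal.ofReal (t ^ (-1 - 2 * τ)) * chordSq t :=
    (by fun_prop : Measurable fun t : ℝ => ENNReal.ofReal (t ^ (-1 - 2 * τ))).mul measurable_chordSq
  rw [scaleIntegral, setLIntegral_pos_iff hm]
  -- Positivity is witnessed on (1, 2), where 0 < t/2 < π keeps the sine positive.
  refine lt_of_lt_of_le ?_ (measure_mono (s := Set.Ioo 1 2) fun t ht => ?_)
  · simp
  · have ht0 : (0 : ℝ) < t := one_pos.trans ht.1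
    refine ⟨?_, ht0⟩
    have : 0 < Real.sin (t / 2) :=
      Real.sin_pos_of_pos_of_lt_pi (by linarith) (by linarith [ht.2, Real.pi_gt_three])
    refine (ENNReal.mul_pos ?_ ?_).ne'
    · exact (ENNReal.ofReal_pos.2 (by positivity)).ne'
    · exact (ENNReal.ofReal_pos.2 (by positivity)).ne'

theorem scaleIntegral_chordSq_comp_mul (h0 : 0 < τ) (a : ℝ) :
    scaleIntegral τ (fun t => chordSq (t * a))
      = ENNReal.ofReal (|a| ^ (2 * τ)) * scaleIntegral τ chordSq := by
  rcases eq_or_ne a 0 with rfl | ha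
  · rw [abs_zero, Real.zero_rpow (by positivity)]
    simp [scaleIntegral, chordSq]
  · rw [← scaleIntegral_comp_mul measurable_chordSq (abs_pos.2 ha)]
    refine le_antisymm (scaleIntegral_mono fun t ht => le_of_eq ?_)
      (scaleIntegral_mono fun t ht => le_of_eq ?_) <;>
    · conv_lhs => rw [← chordSq_abs]
      conv_rhs => rw [← chordSq_abs]
      simp [abs_mul, mul_comm]

variable {n : ℕ} {v : PhaseSpace n → ℂ}

/-- The translate by `a` in the variable `x`. -/
def shiftX (a : Rn n) (v : PhaseSpace n → ℂ) (p : PhaseSpace n) : ℂ := v (p.1 + a, p.2)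

theorem IsTestFunction.shiftX (hv : IsTestFunction v) (a : Rn n) :
    IsTestFunction (shiftX a v) :=
  ⟨hv.1.comp (by fun_prop),
    hv.2.comp_homeomorph (Homeomorph.prodCongr (Homeomorph.addRight a) (Homeomorph.refl _))⟩

/-- The Gagliardo seminorm (squared) in the direction of `x_j`. -/
def gagliardo (τ : ℝ) (j : Fin n) (v : PhaseSpace n → ℂ) : ENNReal :=
  scaleIntegral τ fun t => ∫⁻ p, ‖shiftX (t • stdVec j) v p - v p‖ₑ ^ 2

theorem lintegral_shiftX_sub (hv : IsTestFunction v) (j : Fin n) (t : ℝ) :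
    ∫⁻ p, ‖shiftX (t • stdVec j) v p - v p‖ₑ ^ 2
      = ∫⁻ p : PhaseSpace n, chordSq (t * (2 * Real.pi * p.1 j)) * ‖partialFourier v p‖ₑ ^ 2 := by
  have hs := hv.shiftX (t • stdVec j)
  have hd : IsTestFunction fun p => shiftX (t • stdVec j) v p - v p :=
    ⟨hs.1.sub hv.1, hs.2.sub hv.2⟩
  rw [← lintegral_enorm_sq_partialFourier_phaseSpace hd]
  refine lintegral_congr fun p => ?_
  rw [partialFourier_sub hs.1.continuous hs.2 hv.1.continuous hv.2]
  have h1 : partialFourier (shiftX (t • stdVec j) v) p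
      = Complex.exp (↑(t * (2 * Real.pi * p.1 j)) * Complex.I) * partialFourier v p := by
    refine (partialFourier_comp_add v _ p).trans ?_
    rw [real_inner_smul_left]
    simp only [stdVec, EuclideanSpace.inner_single_left]
    congr 4
    simp
    ring
  rw [h1, ← sub_one_mul, enorm_mul, mul_pow, enorm_exp_sub_one_sq]

/-- A translation in x multiplies the partial Fourier transform by a phase; Plancherel and the
scaling of |e^{it} - 1|² give the symbol |2πξ_j|^{2τ} exactly. One coordinate direction at a time
keeps the scale integral one-dimensional. -/
theorem gagliardo_eq (h0 : 0 < τ) (hv : IsTestFunction v) (j : Fin n) :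
    gagliardo τ j v = scaleIntegral τ chordSq * ∫⁻ p : PhaseSpace n,
      ENNReal.ofReal (|2 * Real.pi * p.1 j| ^ (2 * τ)) * ‖partialFourier v p‖ₑ ^ 2 := by
  have hc := (contDiff_partialFourier hv).continuous
  have hch := measurable_chordSq
  simp only [gagliardo, lintegral_shiftX_sub hv, scaleIntegral]
  have e1 : ∀ t : ℝ, ENNReal.ofReal (t ^ (-1 - 2 * τ)) * ∫⁻ p : PhaseSpace n,
      chordSq (t * (2 * Real.pi * p.1 j)) * ‖partialFourier v p‖ₑ ^ 2
      = ∫⁻ p : PhaseSpace n, ENNReal.ofReal (t ^ (-1 - 2 * τ)) *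
        (chordSq (t * (2 * Real.pi * p.1 j)) * ‖partialFourier v p‖ₑ ^ 2) := fun t =>
    (lintegral_const_mul' _ _ ENNReal.ofReal_ne_top).symm
  simp_rw [e1]
  rw [lintegral_lintegral_swap (by
    refine Measurable.aemeasurable ?_
    have hm : Measurable fun q : ℝ × PhaseSpace n => ‖partialFourier v q.2‖ₑ ^ 2 :=
      (hc.comp continuous_snd).measurable.enorm.pow_const 2
    refine Measurable.mul (by fun_prop) (Measurable.mul (hch.comp (by fun_prop)) hm))]
  have e2 : ∀ p : PhaseSpace n, ∫⁻ t in Set.Ioi (0 : ℝ), ENNReal.ofReal (t ^ (-1 - 2 * τ)) *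
        (chordSq (t * (2 * Real.pi * p.1 j)) * ‖partialFourier v p‖ₑ ^ 2)
      = scaleIntegral τ chordSq *
        (ENNReal.ofReal (|2 * Real.pi * p.1 j| ^ (2 * τ)) * ‖partialFourier v p‖ₑ ^ 2) := fun p => by
    have h := scaleIntegral_chordSq_comp_mul h0 (2 * Real.pi * p.1 j)
    rw [← mul_assoc, mul_comm (scaleIntegral τ chordSq), ← h, scaleIntegral,
      ← lintegral_mul_const' _ _ (by simp)]
    exact lintegral_congr fun t => by ring
  simp_rw [e2]
  rw [lintegral_const_mul _ (by fun_prop)]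
  rfl

theorem gagliardo_le (h0 : 0 < τ) (hv : IsTestFunction v) (j : Fin n) :
    gagliardo τ j v ≤ scaleIntegral τ chordSq * ∫⁻ p : PhaseSpace n,
      ENNReal.ofReal (‖(2 * Real.pi) • p.1‖ ^ (2 * τ)) * ‖partialFourier v p‖ₑ ^ 2 := by
  rw [gagliardo_eq h0 hv]
  gcongr with p
  have h := PiLp.norm_apply_le ((2 * Real.pi) • p.1) j
  simpa [abs_mul] using h

theorem add_rpow_le_of_le_one {a b r : ℝ} (ha : 0 ≤ a) (hb : 0 ≤ b) (h0 : 0 ≤ r) (h1 : r ≤ 1) :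
    (a + b) ^ r ≤ a ^ r + b ^ r := by
  lift a to ℝ≥0 using ha
  lift b to ℝ≥0 using hb
  exact_mod_cast NNReal.rpow_add_le_add_rpow a b h0 h1

theorem sum_rpow_le_of_le_one {ι : Type*} (S : Finset ι) {a : ι → ℝ} (ha : ∀ i, 0 ≤ a i) {r : ℝ}
    (h0 : 0 < r) (h1 : r ≤ 1) : (∑ i ∈ S, a i) ^ r ≤ ∑ i ∈ S, a i ^ r := by
  classical
  induction S using Finset.induction_on with
  | empty => simp [Real.zero_rpow h0.ne']
  | insert i S hi ih =>
    rw [Finset.sum_insert hi, Finset.sum_insert hi]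
    refine (add_rpow_le_of_le_one (ha i) (Finset.sum_nonneg fun j _ => ha j) h0.le h1).trans ?_
    gcongr

/-- Subadditivity of r ↦ r^τ for τ ≤ 1 reduces the isotropic symbol to the coordinate symbols. -/
theorem japaneseBracket_rpow_two_mul_le (v : Rn n) (h0 : 0 < τ) (h1 : τ ≤ 1) :
    japaneseBracket v ^ (2 * τ) ≤ 1 + ∑ j, |v j| ^ (2 * τ) := by
  rw [japaneseBracket_rpow, EuclideanSpace.norm_sq_eq, mul_div_cancel_left₀ _ two_ne_zero]
  refine (add_rpow_le_of_le_one zero_le_one (by positivity) h0.le h1).trans ?_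
  rw [Real.one_rpow]
  gcongr
  refine (sum_rpow_le_of_le_one _ (fun j => by positivity) h0 h1).trans_eq ?_
  refine Finset.sum_congr rfl fun j _ => ?_
  rw [Real.norm_eq_abs, ← Real.rpow_natCast, ← Real.rpow_mul (abs_nonneg _)]
  norm_num

/-- The Sobolev norm in `x` is controlled by the Gagliardo seminorms. -/
theorem scaleIntegral_mul_lintegral_japaneseBracket_le (h0 : 0 < τ) (h1 : τ ≤ 1)
    (hv : IsTestFunction v) :
    scaleIntegral τ chordSq * ∫⁻ p : PhaseSpace n,
      ENNReal.ofReal (japaneseBracket ((2 * Real.pi) • p.1) ^ (2 * τ)) * ‖partialFourier v p‖ₑ ^ 2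
      ≤ scaleIntegral τ chordSq * (∫⁻ p, ‖v p‖ₑ ^ 2) + ∑ j, gagliardo τ j v := by
  have hc := (contDiff_partialFourier hv).continuous
  simp_rw [gagliardo_eq h0 hv]
  rw [← Finset.mul_sum, ← mul_add, ← lintegral_enorm_sq_partialFourier_phaseSpace hv,
    ← lintegral_finsetSum _ fun j _ => by fun_prop, ← lintegral_add_left (by fun_prop)]
  gcongr with p
  rw [← Finset.sum_mul, ← one_add_mul, ← ENNReal.ofReal_one,
    ← ENNReal.ofReal_sum_of_nonneg fun j _ => by positivity,
    ← ENNReal.ofReal_add zero_le_one (by positivity)]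
  gcongr
  simpa using japaneseBracket_rpow_two_mul_le ((2 * Real.pi) • p.1) h0 h1

end Gagliardo

end

noncomputable section

/-! ### Localization at a slowly varying scale -/

section Localization

variable {n : ℕ} {ρ : Rn n → ℝ}

/-- A positive radius function that varies slowly. -/
structure IsSlowRadius (ρ : Rn n → ℝ) : Prop where
  pos : ∀ x, 0 < ρ x
  abs_sub_le : ∀ x z, |ρ x - ρ z| ≤ 1 / 2 * ‖x - z‖

/-- A bump function on the unit ball. -/
def unitBump (n : ℕ) : ContDiffBump (0 : Rn n) := ⟨1 / 2, 1, by norm_num, by norm_num⟩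

/-- A bump function on the ball of center `z` and radius `ρ z`. -/
def localBump (ρ : Rn n → ℝ) (z x : Rn n) : ℝ := unitBump n ((ρ z)⁻¹ • (x - z))

/-- The measure `dz / ρ(z)ⁿ`. -/
def localMeasure (ρ : Rn n → ℝ) : Measure (Rn n) :=
  volume.withDensity fun z => ENNReal.ofReal ((ρ z)⁻¹ ^ n)

instance : SFinite (localMeasure ρ) := by unfold localMeasure; infer_instance

/-- The centers of the balls that contain `x`. -/
def nearCenters (ρ : Rn n → ℝ) (x : Rn n) : Set (Rn n) := {z | ‖x - z‖ ≤ ρ z}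

theorem IsSlowRadius.continuous (h : IsSlowRadius ρ) : Continuous ρ :=
  (LipschitzWith.of_dist_le_mul (K := 1 / 2) fun x z => by
    rw [Real.dist_eq, dist_eq_norm]; simpa using h.abs_sub_le x z).continuous

theorem IsSlowRadius.le_of_mem (h : IsSlowRadius ρ) {x z : Rn n} (hz : z ∈ nearCenters ρ x) :
    ρ z ≤ 2 * ρ x ∧ ρ x ≤ 3 / 2 * ρ z := by
  have h1 := abs_le.1 (h.abs_sub_le x z)
  have h2 : ‖x - z‖ ≤ ρ z := hz
  exact ⟨by linarith, by linarith⟩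

theorem exists_lipschitzWith_unitBump (n : ℕ) : ∃ L : ℝ≥0, LipschitzWith L (unitBump n) :=
  ContDiff.lipschitzWith_of_hasCompactSupport (unitBump n).hasCompactSupport
    (unitBump n).contDiff (n := 1) one_ne_zero

/-- A Lipschitz constant of `unitBump`. -/
def bumpConst (n : ℕ) : ℝ≥0 := (exists_lipschitzWith_unitBump n).choose

theorem lipschitzWith_unitBump (n : ℕ) : LipschitzWith (bumpConst n) (unitBump n) :=
  (exists_lipschitzWith_unitBump n).choose_spec

theorem localBump_nonneg (ρ : Rn n → ℝ) (z x : Rn n) : 0 ≤ localBump ρ z x :=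
  (unitBump n).nonneg

theorem localBump_le_one (ρ : Rn n → ℝ) (z x : Rn n) : localBump ρ z x ≤ 1 :=
  (unitBump n).le_one

theorem contDiff_localBump (ρ : Rn n → ℝ) (z : Rn n) : ContDiff ℝ ∞ (localBump ρ z) :=
  (unitBump n).contDiff.comp (by fun_prop)

theorem IsSlowRadius.continuous_localBump (h : IsSlowRadius ρ) :
    Continuous fun q : Rn n × Rn n => localBump ρ q.1 q.2 := by
  have h1 : Continuous fun q : Rn n × Rn n => (ρ q.1)⁻¹ :=
    (h.continuous.comp continuous_fst).inv₀ fun q => (h.pos _).ne'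
  exact (unitBump n).continuous.comp (h1.smul (continuous_snd.sub continuous_fst))

theorem IsSlowRadius.localBump_eq_zero (h : IsSlowRadius ρ) {x z : Rn n}
    (hz : z ∉ nearCenters ρ x) : localBump ρ z x = 0 := by
  refine (unitBump n).zero_of_le_dist ?_
  have h1 : ρ z < ‖x - z‖ := not_le.1 hz
  rw [dist_zero_right, norm_smul, norm_inv, Real.norm_of_nonneg (h.pos z).le,
    inv_mul_eq_div, le_div_iff₀ (h.pos z)]
  simpa [unitBump] using h1.le

theorem IsSlowRadius.localBump_eq_one (h : IsSlowRadius ρ) {x z : Rn n}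
    (hz : ‖x - z‖ ≤ ρ z / 2) : localBump ρ z x = 1 := by
  refine (unitBump n).one_of_mem_closedBall ?_
  rw [mem_closedBall_zero_iff, norm_smul, norm_inv, Real.norm_of_nonneg (h.pos z).le,
    inv_mul_eq_div, div_le_iff₀ (h.pos z)]
  simp only [unitBump]
  linarith

theorem IsSlowRadius.abs_localBump_sub_le (h : IsSlowRadius ρ) (z x x' : Rn n) :
    |localBump ρ z x - localBump ρ z x'| ≤ bumpConst n * (ρ z)⁻¹ * ‖x - x'‖ := by
  have h1 := (lipschitzWith_unitBump n).dist_le_mul ((ρ z)⁻¹ • (x - z)) ((ρ z)⁻¹ • (x' - z))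
  rw [Real.dist_eq, dist_eq_norm, ← smul_sub, sub_sub_sub_cancel_right, norm_smul, norm_inv,
    Real.norm_of_nonneg (h.pos z).le, ← mul_assoc] at h1
  exact h1

theorem IsSlowRadius.norm_fderiv_localBump_le (h : IsSlowRadius ρ) (z x : Rn n) :
    ‖fderiv ℝ (localBump ρ z) x‖ ≤ bumpConst n * (ρ z)⁻¹ := by
  have h0 : 0 ≤ bumpConst n * (ρ z)⁻¹ := mul_nonneg (by positivity) (inv_nonneg.2 (h.pos z).le)
  exact norm_fderiv_le_of_lip' ℝ h0 (Filter.Eventually.of_forall fun x' => by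
    rw [Real.norm_eq_abs]; exact h.abs_localBump_sub_le z x' x)

theorem IsSlowRadius.fderiv_localBump_eq_zero (h : IsSlowRadius ρ) {x z : Rn n}
    (hz : z ∉ nearCenters ρ x) : fderiv ℝ (localBump ρ z) x = 0 := by
  refine fderiv_eq_zero_off_tsupport fun hx => hz ?_
  have h1 : tsupport (localBump ρ z) ⊆ Metric.closedBall z (ρ z) :=
    closure_minimal (fun y hy => by
      by_contra hy'
      refine hy (h.localBump_eq_zero fun hz => hy' ?_)
      rw [Metric.mem_closedBall, dist_eq_norm]; exact hz) Metric.isClosed_closedBall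
  have h2 := h1 hx
  rwa [Metric.mem_closedBall, dist_eq_norm] at h2

theorem IsSlowRadius.measurableSet_nearCenters (h : IsSlowRadius ρ) (x : Rn n) :
    MeasurableSet (nearCenters ρ x) :=
  (isClosed_le (by fun_prop) h.continuous).measurableSet

/-- The volume of the unit ball. -/
def ballVolume (n : ℕ) : ENNReal := volume (Metric.closedBall (0 : Rn n) 1)

theorem ballVolume_pos (n : ℕ) : 0 < ballVolume n :=
  Metric.measure_closedBall_pos _ _ one_pos

theorem ballVolume_lt_top (n : ℕ) : ballVolume n < ⊤ := measure_closedBall_lt_top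

theorem volume_closedBall_eq (x : Rn n) {r : ℝ} (hr : 0 ≤ r) :
    volume (Metric.closedBall x r) = ENNReal.ofReal (r ^ n) * ballVolume n := by
  simpa [ballVolume] using Measure.addHaar_closedBall' (volume : Measure (Rn n)) x hr

/-- Bounded overlap. A center z whose ball contains x lies within 2ρ(x) of x and has 1/ρ(z) ≤
3/(2ρ(x)); the factors multiply to 3. -/
theorem IsSlowRadius.localMeasure_nearCenters_le (h : IsSlowRadius ρ) (x : Rn n) :
    localMeasure ρ (nearCenters ρ x) ≤ ENNReal.ofReal (3 ^ n) * ballVolume n := by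
  have hx := h.pos x
  rw [localMeasure, withDensity_apply _ (h.measurableSet_nearCenters x)]
  calc _ ≤ ∫⁻ _ in nearCenters ρ x, ENNReal.ofReal ((3 / 2 * (ρ x)⁻¹) ^ n) := by
        refine setLIntegral_mono' (h.measurableSet_nearCenters x) fun z hz => ?_
        have hz0 := h.pos z
        gcongr
        rw [inv_eq_one_div, inv_eq_one_div, div_le_iff₀ hz0]
        have := (h.le_of_mem hz).2
        field_simp
        linarith
    _ = ENNReal.ofReal ((3 / 2 * (ρ x)⁻¹) ^ n) * volume (nearCenters ρ x) := setLIntegral_const _ _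
    _ ≤ ENNReal.ofReal ((3 / 2 * (ρ x)⁻¹) ^ n) * volume (Metric.closedBall x (2 * ρ x)) := by
        gcongr
        intro z hz
        rw [Metric.mem_closedBall, dist_comm, dist_eq_norm]
        exact le_trans hz (h.le_of_mem hz).1
    _ = _ := by
        rw [volume_closedBall_eq x (by positivity), ← mul_assoc,
          ← ENNReal.ofReal_mul (by positivity), ← mul_pow]
        congr 3
        field_simp

/-- The bumps of all centers within ρ(x)/4 of x equal 1 at x, so their squares have total mass
bounded below: a continuous substitute for a partition of unity. -/
theorem IsSlowRadius.le_lintegral_localBump_sq (h : IsSlowRadius ρ) (x : Rn n) :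
    ENNReal.ofReal ((1 / 8) ^ n) * ballVolume n
      ≤ ∫⁻ z, ENNReal.ofReal (localBump ρ z x ^ 2) ∂localMeasure ρ := by
  have hx := h.pos x
  have hb : ∀ z ∈ Metric.closedBall x (ρ x / 4), ρ z ≤ 2 * ρ x ∧ ‖x - z‖ ≤ ρ z / 2 := by
    intro z hz
    rw [Metric.mem_closedBall, dist_comm, dist_eq_norm] at hz
    have h1 := abs_le.1 (h.abs_sub_le x z)
    exact ⟨by linarith, by linarith⟩
  calc _ = ENNReal.ofReal ((1 / 2 * (ρ x)⁻¹) ^ n) * volume (Metric.closedBall x (ρ x / 4)) := by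
        rw [volume_closedBall_eq x (by positivity), ← mul_assoc,
          ← ENNReal.ofReal_mul (by positivity), ← mul_pow]
        congr 3
        field_simp
        norm_num
    _ = ∫⁻ _ in Metric.closedBall x (ρ x / 4), ENNReal.ofReal ((1 / 2 * (ρ x)⁻¹) ^ n) :=
        (setLIntegral_const _ _).symm
    _ ≤ ∫⁻ z in Metric.closedBall x (ρ x / 4), ENNReal.ofReal ((ρ z)⁻¹ ^ n) := by
        refine setLIntegral_mono' Metric.isClosed_closedBall.measurableSet fun z hz => ?_
        have hz0 := h.pos z
        gcongr
        rw [inv_eq_one_div, inv_eq_one_div, le_div_iff₀ hz0]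
        have := (hb z hz).1
        field_simp
        linarith
    _ = ∫⁻ _ in Metric.closedBall x (ρ x / 4), 1 ∂localMeasure ρ := by
        rw [setLIntegral_one, localMeasure,
          withDensity_apply _ Metric.isClosed_closedBall.measurableSet]
    _ ≤ ∫⁻ z in Metric.closedBall x (ρ x / 4), ENNReal.ofReal (localBump ρ z x ^ 2)
          ∂localMeasure ρ := by
        refine setLIntegral_mono' Metric.isClosed_closedBall.measurableSet fun z hz => ?_
        rw [h.localBump_eq_one (hb z hz).2]
        simp
    _ ≤ _ := setLIntegral_le_lintegral _ _

/-- The constant in `IsSlowRadius.lintegral_localBump_sub_sq_le`. -/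
def shiftConst (n : ℕ) : ENNReal :=
  ENNReal.ofReal (1 + 9 * bumpConst n ^ 2) * (2 * (ENNReal.ofReal (3 ^ n) * ballVolume n))

theorem shiftConst_lt_top (n : ℕ) : shiftConst n < ⊤ :=
  ENNReal.mul_lt_top ENNReal.ofReal_lt_top (ENNReal.mul_lt_top (by simp)
    (ENNReal.mul_lt_top ENNReal.ofReal_lt_top (ballVolume_lt_top n)))

/-- A translation by a moves the cutoffs by O(|a|/ρ(x)) and never by more than 1; only centers near
x or x + a contribute. The minimum makes the bound integrable against t^{-1-2τ}. -/
theorem IsSlowRadius.lintegral_localBump_sub_sq_le (h : IsSlowRadius ρ) (x a : Rn n) :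
    ∫⁻ z, ENNReal.ofReal ((localBump ρ z (x + a) - localBump ρ z x) ^ 2) ∂localMeasure ρ
      ≤ shiftConst n * ENNReal.ofReal (min 1 (((ρ x)⁻¹ * ‖a‖) ^ 2)) := by
  have hx := h.pos x
  set L : ℝ := (bumpConst n : ℝ) with hL
  have hL0 : 0 ≤ L := (bumpConst n).coe_nonneg
  set m : ℝ := (1 + 9 * L ^ 2) * min 1 (((ρ x)⁻¹ * ‖a‖) ^ 2) with hm
  have hm0 : 0 ≤ m := by positivity
  have hle : ∀ z, z ∈ nearCenters ρ x ∨ z ∈ nearCenters ρ (x + a) →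
      (localBump ρ z (x + a) - localBump ρ z x) ^ 2 ≤ m := by
    intro z hz
    rcases le_or_gt ‖a‖ (ρ x) with ha | ha
    · have h1 : (ρ x)⁻¹ * ‖a‖ ≤ 1 := by rw [inv_mul_eq_div, div_le_one hx]; exact ha
      rw [hm, min_eq_right (by have : 0 ≤ (ρ x)⁻¹ * ‖a‖ := by positivity
                               nlinarith)]
      have h2 : (ρ z)⁻¹ ≤ 3 * (ρ x)⁻¹ := by
        have hz0 := h.pos z
        have h3 := abs_le.1 (h.abs_sub_le (x + a) x)
        rw [add_sub_cancel_left] at h3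
        -- For z near x + a this combines ρ(x) ≤ 2ρ(x + a), valid since |a| ≤ ρ(x), with ρ(x + a) ≤
        -- 3ρ(z)/2.
        have h4 : ρ x ≤ 3 * ρ z := by
          rcases hz with hz | hz
          · linarith [(h.le_of_mem hz).2]
          · linarith [(h.le_of_mem hz).2]
        rw [inv_eq_one_div, div_le_iff₀ hz0]
        field_simp
        linarith
      have h5 := h.abs_localBump_sub_le z (x + a) x
      rw [add_sub_cancel_left] at h5
      calc (localBump ρ z (x + a) - localBump ρ z x) ^ 2
          = |localBump ρ z (x + a) - localBump ρ z x| ^ 2 := (sq_abs _).symm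
        _ ≤ (L * (3 * (ρ x)⁻¹) * ‖a‖) ^ 2 := by
            gcongr
            exact h5.trans (by gcongr)
        _ ≤ _ := by
            have : 0 ≤ ((ρ x)⁻¹ * ‖a‖) ^ 2 := by positivity
            linarith
    · have h1 : 1 ≤ (ρ x)⁻¹ * ‖a‖ := by rw [inv_mul_eq_div, one_le_div hx]; exact ha.le
      rw [hm, min_eq_left (by nlinarith)]
      have h2 := localBump_nonneg ρ z x
      have h3 := localBump_le_one ρ z x
      have h4 := localBump_nonneg ρ z (x + a)
      have h5 := localBump_le_one ρ z (x + a)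
      have : (localBump ρ z (x + a) - localBump ρ z x) ^ 2 ≤ 1 := by
        rw [sq_le_one_iff_abs_le_one, abs_le]
        exact ⟨by linarith, by linarith⟩
      nlinarith [sq_nonneg L]
  have hS := (h.measurableSet_nearCenters x).union (h.measurableSet_nearCenters (x + a))
  calc _ ≤ ∫⁻ z, (nearCenters ρ x ∪ nearCenters ρ (x + a)).indicator
          (fun _ => ENNReal.ofReal m) z ∂localMeasure ρ := by
        refine lintegral_mono fun z => ?_
        by_cases hz : z ∈ nearCenters ρ x ∪ nearCenters ρ (x + a)
        · rw [Set.indicator_of_mem hz]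
          exact ENNReal.ofReal_le_ofReal (hle z hz)
        · rw [Set.mem_union, not_or] at hz
          simp [h.localBump_eq_zero hz.1, h.localBump_eq_zero hz.2]
    _ = ENNReal.ofReal m * localMeasure ρ (nearCenters ρ x ∪ nearCenters ρ (x + a)) :=
        lintegral_indicator_const hS _
    _ ≤ ENNReal.ofReal m * (ENNReal.ofReal (3 ^ n) * ballVolume n
          + ENNReal.ofReal (3 ^ n) * ballVolume n) := by
        gcongr
        exact (measure_union_le _ _).trans
          (add_le_add (h.localMeasure_nearCenters_le x) (h.localMeasure_nearCenters_le _))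
    _ = _ := by
        rw [hm, ENNReal.ofReal_mul (by positivity), shiftConst]
        ring

end Localization

end

noncomputable section

/-! ### Freezing the coefficients on small balls -/

section LocalizedOperator

variable {n : ℕ} {K s : ℝ} {W : Rn n → Rn n} {J : Rn n → Rn n →L[ℝ] Rn n}
  {u : PhaseSpace n → ℂ}

/-- The localization radius `⟨W⟩^{-s/2} / (2K)`. -/
def fieldRadius (K s : ℝ) (W : Rn n → Rn n) (x : Rn n) : ℝ :=
  (2 * K)⁻¹ * japaneseBracket (W x) ^ (-(s / 2))

/-- The derivative of Λ^{-s/2} is at most (s/2) K Λ^{s/2-1}, hence at most K when 0 ≤ s ≤ 2; the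
factor 1/(2K) turns this into the Lipschitz constant 1/2. -/
theorem AdmissibleField.isSlowRadius (hA : AdmissibleField K s W J) (hs0 : 0 ≤ s)
    (hs : s ≤ 2) : IsSlowRadius (fieldRadius K s W) := by
  have hK := hA.one_le
  have hK0 : 0 < K := by linarith
  refine ⟨fun x => mul_pos (by positivity) (Real.rpow_pos_of_pos (japaneseBracket_pos _) _),
    fun x z => ?_⟩
  have hd : ∀ x, HasFDerivAt W (fderiv ℝ W x) x := fun x =>
    (hA.contDiff.differentiable (by simp) x).hasFDerivAt
  have hC : ∀ x ∈ (Set.univ : Set (Rn n)),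
      ‖fderiv ℝ (fun x => japaneseBracket (W x) ^ (-(s / 2))) x‖ ≤ K := by
    intro x _
    refine ContinuousLinearMap.opNorm_le_bound _ hK0.le fun v => ?_
    rw [(hasFDerivAt_japaneseBracket_rpow (hd x) _).fderiv, Real.norm_eq_abs]
    refine (abs_fderiv_japaneseBracket_rpow_le _ _ _ _).trans ?_
    have h1 := hA.norm_fderiv_le x
    have hp := japaneseBracket_pos (W x)
    have h2 : |-(s / 2)| ≤ 1 := by rw [abs_neg, abs_of_nonneg (by linarith)]; linarith
    calc |-(s / 2)| * japaneseBracket (W x) ^ (-(s / 2) - 1) * (‖fderiv ℝ W x‖ * ‖v‖)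
        ≤ 1 * japaneseBracket (W x) ^ (-(s / 2) - 1) * (K * japaneseBracket (W x) ^ s * ‖v‖) := by
          gcongr
      _ = K * japaneseBracket (W x) ^ (s / 2 - 1) * ‖v‖ := by
          rw [show s / 2 - 1 = (-(s / 2) - 1) + s by ring, Real.rpow_add hp]; ring
      _ ≤ K * 1 * ‖v‖ := by
          gcongr
          exact Real.rpow_le_one_of_one_le_of_nonpos (one_le_japaneseBracket _) (by linarith)
      _ = K * ‖v‖ := by ring
  have h := convex_univ.norm_image_sub_le_of_norm_fderiv_le (𝕜 := ℝ)
    (fun x _ => (hasFDerivAt_japaneseBracket_rpow (hd x) _).differentiableAt) hC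
    (Set.mem_univ z) (Set.mem_univ x)
  rw [Real.norm_eq_abs] at h
  rw [fieldRadius, fieldRadius, ← mul_sub, abs_mul, abs_of_pos (by positivity)]
  calc _ ≤ (2 * K)⁻¹ * (K * ‖x - z‖) := by gcongr
    _ = 1 / 2 * ‖x - z‖ := by field_simp

/-- Slow variation of the radius is slow variation of Λ^{s/2}; all other powers of Λ follow. -/
theorem AdmissibleField.rpow_le_of_mem (hA : AdmissibleField K s W J) (hs0 : 2 / 3 ≤ s)
    (hs : s ≤ 2) {x z : Rn n} (hz : z ∈ nearCenters (fieldRadius K s W) x) :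
    japaneseBracket (W x) ^ (s / 2) ≤ 2 * japaneseBracket (W z) ^ (s / 2) ∧
    japaneseBracket (W z) ^ (2 / 3 : ℝ) ≤ 9 / 4 * japaneseBracket (W x) ^ (2 / 3 : ℝ) ∧
    japaneseBracket (W z) ^ (4 / 3 : ℝ) ≤ 6 * japaneseBracket (W x) ^ (4 / 3 : ℝ) := by
  have hK0 : 0 < K := by linarith [hA.one_le]
  have hx := japaneseBracket_pos (W x)
  have hz' := japaneseBracket_pos (W z)
  obtain ⟨h1, h2⟩ := (hA.isSlowRadius (by linarith) hs).le_of_mem hz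
  simp only [fieldRadius, Real.rpow_neg hx.le, Real.rpow_neg hz'.le] at h1 h2
  have px : 0 < japaneseBracket (W x) ^ (s / 2) := by positivity
  have pz : 0 < japaneseBracket (W z) ^ (s / 2) := by positivity
  have h3 : japaneseBracket (W x) ^ (s / 2) ≤ 2 * japaneseBracket (W z) ^ (s / 2) := by
    field_simp at h1
    linarith
  have h4 : japaneseBracket (W z) ^ (s / 2) ≤ 3 / 2 * japaneseBracket (W x) ^ (s / 2) := by
    field_simp at h2
    linarith
  -- Passing from the power s/2 to r raises 3/2 to 2r/s. With s ≥ 2/3 this exponent is at most 2 for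
  -- r = 2/3 and at most 4 for r = 4/3, which gives 9/4 and 81/16 ≤ 6.
  have key : ∀ r : ℝ, 0 ≤ r → japaneseBracket (W z) ^ r
      ≤ (3 / 2) ^ (2 * r / s) * japaneseBracket (W x) ^ r := fun r hr => by
    have hs1 : 0 < s := by linarith
    calc japaneseBracket (W z) ^ r = (japaneseBracket (W z) ^ (s / 2)) ^ (2 * r / s) := by
          rw [← Real.rpow_mul hz'.le]; congr 1; field_simp
      _ ≤ (3 / 2 * japaneseBracket (W x) ^ (s / 2)) ^ (2 * r / s) := by gcongr
      _ = _ := by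
          rw [Real.mul_rpow (by norm_num) px.le, ← Real.rpow_mul hx.le]; congr 2; field_simp
  refine ⟨h3, (key _ (by norm_num)).trans ?_, (key _ (by norm_num)).trans ?_⟩
  · gcongr
    calc (3 / 2 : ℝ) ^ (2 * (2 / 3) / s) ≤ (3 / 2 : ℝ) ^ (2 : ℝ) := by
          refine Real.rpow_le_rpow_of_exponent_le (by norm_num) ?_
          rw [div_le_iff₀ (by linarith)]; linarith
      _ = 9 / 4 := by norm_num
  · gcongr
    calc (3 / 2 : ℝ) ^ (2 * (4 / 3) / s) ≤ (3 / 2 : ℝ) ^ (4 : ℝ) := by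
          refine Real.rpow_le_rpow_of_exponent_le (by norm_num) ?_
          rw [div_le_iff₀ (by linarith)]; linarith
      _ ≤ 6 := by
          rw [show (4 : ℝ) = ((4 : ℕ) : ℝ) by norm_num, Real.rpow_natCast]; norm_num

/-- Mean value inequality on the ball of radius Λ^{-s/2}/(2K): W' = O(Λ^s) allows a change
O(Λ^{s/2}), the same size as the derivative of the cutoff, while J' = O(Λ^{s/2}) allows only a
bounded change. -/
theorem AdmissibleField.norm_sub_le_of_mem (hA : AdmissibleField K s W J) (hs0 : 2 / 3 ≤ s)
    (hs : s ≤ 2) (hJ : Differentiable ℝ J)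
    (hJ' : ∀ x, ‖fderiv ℝ J x‖ ≤ K * japaneseBracket (W x) ^ (s / 2))
    {x z : Rn n} (hz : z ∈ nearCenters (fieldRadius K s W) x) :
    ‖W x - W z‖ ≤ 2 * japaneseBracket (W z) ^ (s / 2) ∧ ‖J x - J z‖ ≤ 1 := by
  have hK0 : 0 < K := by linarith [hA.one_le]
  have hz' := japaneseBracket_pos (W z)
  have hρ := hA.isSlowRadius (by linarith) hs
  set B := Metric.closedBall z (fieldRadius K s W z)
  have hxB : x ∈ B := by rw [Metric.mem_closedBall, dist_eq_norm]; exact hz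
  have hzB : z ∈ B := Metric.mem_closedBall_self (hρ.pos z).le
  have hB : ∀ x' ∈ B, z ∈ nearCenters (fieldRadius K s W) x' := fun x' hx' => by
    rw [Metric.mem_closedBall, dist_eq_norm] at hx'; exact hx'
  have hW : ∀ x' ∈ B, ‖fderiv ℝ W x'‖ ≤ K * (4 * japaneseBracket (W z) ^ s) := fun x' hx' => by
    refine (hA.norm_fderiv_le x').trans ?_
    gcongr
    have h1 := (hA.rpow_le_of_mem hs0 hs (hB x' hx')).1
    have h2 : ∀ w : Rn n, japaneseBracket w ^ s = (japaneseBracket w ^ (s / 2)) ^ 2 := fun w => by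
      rw [← Real.rpow_natCast, ← Real.rpow_mul (japaneseBracket_pos _).le]; congr 1; push_cast; ring
    rw [h2, h2]
    have := pow_le_pow_left₀ (Real.rpow_nonneg (japaneseBracket_pos (W x')).le _) h1 2
    linarith
  have hJB : ∀ x' ∈ B, ‖fderiv ℝ J x'‖ ≤ K * (2 * japaneseBracket (W z) ^ (s / 2)) :=
    fun x' hx' => (hJ' x').trans (by gcongr; exact (hA.rpow_le_of_mem hs0 hs (hB x' hx')).1)
  have hcv : Convex ℝ B := convex_closedBall _ _
  have e1 := hcv.norm_image_sub_le_of_norm_fderiv_le (𝕜 := ℝ)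
    (fun x' _ => hA.contDiff.differentiable (by simp) x') hW hzB hxB
  have e2 := hcv.norm_image_sub_le_of_norm_fderiv_le (𝕜 := ℝ) (fun x' _ => hJ x') hJB hzB hxB
  have hxz : ‖x - z‖ ≤ (2 * K)⁻¹ * japaneseBracket (W z) ^ (-(s / 2)) := hz
  have e3 : japaneseBracket (W z) ^ s * japaneseBracket (W z) ^ (-(s / 2))
      = japaneseBracket (W z) ^ (s / 2) := by rw [← Real.rpow_add hz']; congr 1; ring
  have e4 : japaneseBracket (W z) ^ (s / 2) * japaneseBracket (W z) ^ (-(s / 2)) = 1 := by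
    rw [← Real.rpow_add hz', add_neg_cancel, Real.rpow_zero]
  constructor
  · calc ‖W x - W z‖ ≤ K * (4 * japaneseBracket (W z) ^ s) * ‖x - z‖ := e1
      _ ≤ K * (4 * japaneseBracket (W z) ^ s)
          * ((2 * K)⁻¹ * japaneseBracket (W z) ^ (-(s / 2))) := by gcongr
      _ = 2 * (K * K⁻¹)
          * (japaneseBracket (W z) ^ s * japaneseBracket (W z) ^ (-(s / 2))) := by
          rw [mul_inv]; ring
      _ = _ := by rw [e3, mul_inv_cancel₀ hK0.ne', mul_one]
  · calc ‖J x - J z‖ ≤ K * (2 * japaneseBracket (W z) ^ (s / 2)) * ‖x - z‖ := e2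
      _ ≤ K * (2 * japaneseBracket (W z) ^ (s / 2))
          * ((2 * K)⁻¹ * japaneseBracket (W z) ^ (-(s / 2))) := by gcongr
      _ = (K * K⁻¹)
          * (japaneseBracket (W z) ^ (s / 2) * japaneseBracket (W z) ^ (-(s / 2))) := by
          rw [mul_inv]; ring
      _ = _ := by rw [e4, mul_inv_cancel₀ hK0.ne', mul_one]

/-- The product of a function of `x` and a function on the phase space. -/
def cutoffX (φ : Rn n → ℝ) (u : PhaseSpace n → ℂ) (p : PhaseSpace n) : ℂ := (φ p.1 : ℂ) * u p

theorem IsTestFunction.cutoffX {φ : Rn n → ℝ} (hφ : ContDiff ℝ ∞ φ) (hu : IsTestFunction u) :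
    IsTestFunction (cutoffX φ u) :=
  ⟨(Complex.ofRealCLM.contDiff.comp (hφ.comp contDiff_fst)).mul hu.1, hu.2.mul_left⟩

theorem fderiv_cutoffX {φ : Rn n → ℝ} (hφ : Differentiable ℝ φ) (hu : Differentiable ℝ u)
    (p d : PhaseSpace n) : fderiv ℝ (cutoffX φ u) p d
      = (φ p.1 : ℂ) * fderiv ℝ u p d + ((fderiv ℝ φ p.1 d.1 : ℝ) : ℂ) * u p := by
  have h1 : HasFDerivAt (fun p : PhaseSpace n => (φ p.1 : ℂ)) _ p :=
    (Complex.ofRealCLM.hasFDerivAt).comp p ((hφ p.1).hasFDerivAt.comp p hasFDerivAt_fst)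
  have h2 : HasFDerivAt (cutoffX φ u) _ p := h1.mul (hu p).hasFDerivAt
  rw [h2.fderiv]
  simp
  ring

/-- A cutoff in x commutes with everything except y·∂_x. -/
theorem fokkerPlanckOp_cutoffX {φ : Rn n → ℝ} (hφ : ContDiff ℝ ∞ φ) (hu : IsTestFunction u)
    (W : Rn n → Rn n) (J : Rn n → Rn n →L[ℝ] Rn n) (p : PhaseSpace n) :
    fokkerPlanckOp W J (cutoffX φ u) p
      = (φ p.1 : ℂ) * fokkerPlanckOp W J u p + ((fderiv ℝ φ p.1 p.2 : ℝ) : ℂ) * u p := by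
  have hφd := hφ.differentiable (by simp)
  have h1 : ∀ (w : PhaseSpace n → ℂ) (j : Fin n), Differentiable ℝ w →
      (fun z => fderiv ℝ (cutoffX φ w) z (0, stdVec j))
        = cutoffX φ fun z => fderiv ℝ w z (0, stdVec j) := fun w j hw => by
    ext z
    rw [fderiv_cutoffX hφd hw]
    simp [cutoffX]
  have h2 : ∀ j : Fin n, fderiv ℝ (fun z => fderiv ℝ (cutoffX φ u) z (0, stdVec j)) p (0, stdVec j)
      = (φ p.1 : ℂ) * fderiv ℝ (fun z => fderiv ℝ u z (0, stdVec j)) p (0, stdVec j) := fun j => by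
    rw [h1 u j (hu.1.differentiable (by simp))]
    exact congrFun (h1 (fun z => fderiv ℝ u z (0, stdVec j)) j
      ((hu.fderiv_apply _).1.differentiable (by simp))) p
  simp only [fokkerPlanckOp, kineticOp, h2, ← Finset.mul_sum]
  rw [fderiv_cutoffX hφd (hu.1.differentiable (by simp))]
  simp only [cutoffX, transportField]
  simp
  ring

/-- Freezing changes only the force, so the error is first order in y and no derivative in x occurs
in it. -/
theorem fokkerPlanckOp_const_eq (W : Rn n → Rn n) (J : Rn n → Rn n →L[ℝ] Rn n) (z : Rn n)
    (p : PhaseSpace n) : fokkerPlanckOp (fun _ => W z) (fun _ => J z) u p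
      = fokkerPlanckOp W J u p
        + fderiv ℝ u p (0, (W p.1 - W z) + (J p.1 - J z) p.2) := by
  have : transportField (fun _ => W z) (fun _ => J z) p
      = transportField W J p + (0, (W p.1 - W z) + (J p.1 - J z) p.2) := by
    simp only [transportField, Prod.mk_add_mk, add_zero, sub_apply]
    congr 1
    abel
  simp only [fokkerPlanckOp, kineticOp, this, map_add]
  ring

theorem norm_fderiv_snd_le (hu : IsTestFunction u) (p : PhaseSpace n) (b : Rn n) :
    ‖fderiv ℝ u p (0, b)‖ ≤ ‖b‖ * Real.sqrt (gradYSq u p) := by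
  have h : ∀ b, fderiv ℝ (fun y => u (p.1, y)) p.2 b = fderiv ℝ u p (0, b) := fun b => by
    have h : HasFDerivAt (fun y => u (p.1, y)) _ p.2 :=
      ((hu.1.differentiable (by simp) (p.1, p.2)).hasFDerivAt).comp p.2
        (hasFDerivAt_prodMk_right p.1 p.2)
    rw [h.fderiv]
    simp
  have h1 := norm_fderiv_apply_le_sqrt (fun y => u (p.1, y)) p.2 b
  rw [h] at h1
  convert h1 using 3
  simp only [gradYSq, gradSq, dirDeriv, h, partialY]

/-- The density that is controlled by the weighted estimate. -/
def controlledDensity (W : Rn n → Rn n) (J : Rn n → Rn n →L[ℝ] Rn n) (u : PhaseSpace n → ℂ)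
    (p : PhaseSpace n) : ℝ :=
  ‖fokkerPlanckOp W J u p‖ ^ 2 + (japaneseBracket (W p.1) ^ (4 / 3 : ℝ) * ‖u p‖ ^ 2
    + japaneseBracket (W p.1) ^ (2 / 3 : ℝ) * (gradYSq u p + ‖p.2‖ ^ 2 * ‖u p‖ ^ 2)
    + ‖p.2‖ ^ 2 * (gradYSq u p + ‖p.2‖ ^ 2 * ‖u p‖ ^ 2))

theorem controlledDensity_nonneg (W : Rn n → Rn n) (J : Rn n → Rn n →L[ℝ] Rn n)
    (u : PhaseSpace n → ℂ) (p : PhaseSpace n) : 0 ≤ controlledDensity W J u p := by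
  have := gradYSq_nonneg u p
  have := japaneseBracket_pos (W p.1)
  unfold controlledDensity
  positivity

/-- The commutator bound for the operator with coefficients frozen at `z`. -/
theorem AdmissibleField.localized_density_le (hA : AdmissibleField K s W J) (hs0 : 2 / 3 ≤ s)
    (hs : s ≤ 2) (hJ : Differentiable ℝ J)
    (hJ' : ∀ x, ‖fderiv ℝ J x‖ ≤ K * japaneseBracket (W x) ^ (s / 2))
    (hu : IsTestFunction u) {p : PhaseSpace n} {z : Rn n}
    (hz : z ∈ nearCenters (fieldRadius K s W) p.1) :
    japaneseBracket (W z) ^ (2 / 3 - s) * ‖fokkerPlanckOp (fun _ => W z) (fun _ => J z)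
        (cutoffX (localBump (fieldRadius K s W) z) u) p‖ ^ 2
      + japaneseBracket (W z) ^ (4 / 3 : ℝ)
        * ‖cutoffX (localBump (fieldRadius K s W) z) u p‖ ^ 2
      ≤ 36 * (1 + K ^ 2 * bumpConst n ^ 2) * controlledDensity W J u p := by
  set φ := localBump (fieldRadius K s W) z with hφ
  set L : ℝ := (bumpConst n : ℝ) with hL
  have hL0 : 0 ≤ L := (bumpConst n).coe_nonneg
  have hK0 : 0 < K := by linarith [hA.one_le]
  have hρ := hA.isSlowRadius (by linarith) hs
  have hzp := japaneseBracket_pos (W z)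
  have hxp := japaneseBracket_pos (W p.1)
  obtain ⟨_, h23, h43⟩ := hA.rpow_le_of_mem hs0 hs hz
  obtain ⟨hWd, hJd⟩ := hA.norm_sub_le_of_mem hs0 hs hJ hJ' hz
  set σ := japaneseBracket (W z) ^ (s / 2) with hσ
  have hσ0 : 0 < σ := by positivity
  set g := Real.sqrt (gradYSq u p) with hg
  have hg0 : 0 ≤ g := Real.sqrt_nonneg _
  have hg2 : g ^ 2 = gradYSq u p := Real.sq_sqrt (gradYSq_nonneg u p)
  set N := ‖fokkerPlanckOp W J u p‖ with hN
  have hφ1 : ‖(φ p.1 : ℂ)‖ ≤ 1 := by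
    rw [Complex.norm_real, Real.norm_of_nonneg (localBump_nonneg _ _ _)]
    exact localBump_le_one _ _ _
  have hφ' : ‖((fderiv ℝ φ p.1 p.2 : ℝ) : ℂ)‖ ≤ 2 * K * L * σ * ‖p.2‖ := by
    rw [Complex.norm_real]
    refine ((fderiv ℝ φ p.1).le_opNorm p.2).trans ?_
    gcongr
    refine (hρ.norm_fderiv_localBump_le z p.1).trans_eq ?_
    rw [fieldRadius, Real.rpow_neg hzp.le, mul_inv, inv_inv, inv_inv]
    ring
  have hop : ‖fokkerPlanckOp (fun _ => W z) (fun _ => J z) (cutoffX φ u) p‖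
      ≤ N + (2 * σ * g + ‖p.2‖ * g) + 2 * K * L * σ * ‖p.2‖ * ‖u p‖ := by
    rw [fokkerPlanckOp_cutoffX (contDiff_localBump _ _) hu, fokkerPlanckOp_const_eq]
    refine (norm_add_le _ _).trans ?_
    rw [norm_mul, norm_mul]
    have h1 : ‖fokkerPlanckOp W J u p + fderiv ℝ u p (0, (W p.1 - W z) + (J p.1 - J z) p.2)‖
        ≤ N + (2 * σ * g + ‖p.2‖ * g) := by
      refine (norm_add_le _ _).trans ?_
      gcongr
      refine (norm_fderiv_snd_le hu _ _).trans ?_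
      rw [← add_mul]
      gcongr
      refine (norm_add_le _ _).trans (add_le_add hWd ?_)
      refine ((J p.1 - J z).le_opNorm p.2).trans ?_
      exact mul_le_of_le_one_left (norm_nonneg _) hJd
    have h2 := mul_le_mul hφ1 h1 (norm_nonneg _) zero_le_one
    have h3 := mul_le_mul_of_nonneg_right hφ' (norm_nonneg (u p))
    linarith
  have hsq : ‖fokkerPlanckOp (fun _ => W z) (fun _ => J z) (cutoffX φ u) p‖ ^ 2
      ≤ 4 * (N ^ 2 + 4 * σ ^ 2 * g ^ 2 + ‖p.2‖ ^ 2 * g ^ 2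
        + 4 * K ^ 2 * L ^ 2 * σ ^ 2 * (‖p.2‖ ^ 2 * ‖u p‖ ^ 2)) := by
    refine (pow_le_pow_left₀ (norm_nonneg _) hop 2).trans ?_
    have four : ∀ a b c d : ℝ, (a + (b + c) + d) ^ 2 ≤ 4 * (a ^ 2 + b ^ 2 + c ^ 2 + d ^ 2) :=
      fun a b c d => by
        nlinarith [sq_nonneg (a - b), sq_nonneg (a - c), sq_nonneg (a - d), sq_nonneg (b - c),
          sq_nonneg (b - d), sq_nonneg (c - d)]
    refine (four _ _ _ _).trans_eq ?_
    ring
  -- The reason for the weight Λ^{2/3-s}: it turns the squared errors of size Λ^s into Λ^{2/3}, the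
  -- weight available in the force estimate.
  have hw : japaneseBracket (W z) ^ (2 / 3 - s) * σ ^ 2 = japaneseBracket (W z) ^ (2 / 3 : ℝ) := by
    rw [hσ, ← Real.rpow_natCast, ← Real.rpow_mul hzp.le, ← Real.rpow_add hzp]
    congr 1; push_cast; ring
  set w := japaneseBracket (W z) ^ (2 / 3 - s) with hwdef
  have hw0 : 0 ≤ w := by positivity
  have hw1 : w ≤ 1 :=
    Real.rpow_le_one_of_one_le_of_nonpos (one_le_japaneseBracket _) (by linarith)
  set A := japaneseBracket (W p.1) ^ (2 / 3 : ℝ)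
  set B := japaneseBracket (W p.1) ^ (4 / 3 : ℝ)
  have hA0 : 0 ≤ A := by positivity
  have hB0 : 0 ≤ B := by positivity
  have hcut : ‖cutoffX φ u p‖ ^ 2 ≤ ‖u p‖ ^ 2 := by
    rw [cutoffX, norm_mul]
    gcongr
    exact mul_le_of_le_one_left (norm_nonneg _) hφ1
  have f1 : w * ‖fokkerPlanckOp (fun _ => W z) (fun _ => J z) (cutoffX φ u) p‖ ^ 2
      ≤ 4 * (N ^ 2 + ‖p.2‖ ^ 2 * g ^ 2 + 9 * A * g ^ 2
        + 9 * K ^ 2 * L ^ 2 * A * (‖p.2‖ ^ 2 * ‖u p‖ ^ 2)) := by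
    calc _ ≤ w * (4 * (N ^ 2 + 4 * σ ^ 2 * g ^ 2 + ‖p.2‖ ^ 2 * g ^ 2
          + 4 * K ^ 2 * L ^ 2 * σ ^ 2 * (‖p.2‖ ^ 2 * ‖u p‖ ^ 2))) := by gcongr
      _ = 4 * (w * (N ^ 2 + ‖p.2‖ ^ 2 * g ^ 2) + 4 * (w * σ ^ 2) * g ^ 2
          + 4 * K ^ 2 * L ^ 2 * (w * σ ^ 2) * (‖p.2‖ ^ 2 * ‖u p‖ ^ 2)) := by ring
      _ ≤ 4 * (1 * (N ^ 2 + ‖p.2‖ ^ 2 * g ^ 2) + 4 * (9 / 4 * A) * g ^ 2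
          + 4 * K ^ 2 * L ^ 2 * (9 / 4 * A) * (‖p.2‖ ^ 2 * ‖u p‖ ^ 2)) := by
          rw [hw]; gcongr
      _ = _ := by ring
  have f2 : japaneseBracket (W z) ^ (4 / 3 : ℝ) * ‖cutoffX φ u p‖ ^ 2 ≤ 6 * B * ‖u p‖ ^ 2 := by
    gcongr
  rw [controlledDensity, ← hg2]
  have t1 : 0 ≤ K ^ 2 * L ^ 2 := by positivity
  have t2 : 0 ≤ ‖p.2‖ ^ 2 * ‖u p‖ ^ 2 := by positivity
  have t3 : 0 ≤ A * g ^ 2 := by positivity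
  have t4 : 0 ≤ ‖p.2‖ ^ 2 * g ^ 2 := by positivity
  have t5 : 0 ≤ B * ‖u p‖ ^ 2 := by positivity
  have t6 : 0 ≤ A * (‖p.2‖ ^ 2 * ‖u p‖ ^ 2) := by positivity
  have t7 : 0 ≤ N ^ 2 := by positivity
  have t8 : 0 ≤ ‖p.2‖ ^ 2 * (‖p.2‖ ^ 2 * ‖u p‖ ^ 2) := by positivity
  have key : 0 ≤ K ^ 2 * L ^ 2 * (N ^ 2 + B * ‖u p‖ ^ 2 + A * g ^ 2 + ‖p.2‖ ^ 2 * g ^ 2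
      + ‖p.2‖ ^ 2 * (‖p.2‖ ^ 2 * ‖u p‖ ^ 2)) := by positivity
  linarith

end LocalizedOperator

end

noncomputable section

/-! ### Gluing the localized seminorms -/

section SobolevEstimate

variable {n : ℕ} {K s τ : ℝ} {W : Rn n → Rn n} {J : Rn n → Rn n →L[ℝ] Rn n}
  {u : PhaseSpace n → ℂ} {ρ : Rn n → ℝ}

theorem enorm_sub_sq_le (a b : ℂ) : ‖a - b‖ₑ ^ 2 ≤ 2 * ‖a‖ₑ ^ 2 + 2 * ‖b‖ₑ ^ 2 := by
  have h : ‖a - b‖ ^ 2 ≤ 2 * ‖a‖ ^ 2 + 2 * ‖b‖ ^ 2 := by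
    have := pow_le_pow_left₀ (norm_nonneg _) (norm_sub_le a b) 2
    nlinarith [sq_nonneg (‖a‖ - ‖b‖)]
  have := ENNReal.ofReal_le_ofReal h
  rwa [ENNReal.ofReal_add (by positivity) (by positivity), ENNReal.ofReal_mul zero_le_two,
    ENNReal.ofReal_mul zero_le_two, ENNReal.ofReal_ofNat, ENNReal.ofReal_pow (norm_nonneg _),
    ENNReal.ofReal_pow (norm_nonneg _), ENNReal.ofReal_pow (norm_nonneg _), ofReal_norm,
    ofReal_norm, ofReal_norm] at this

theorem enorm_ofReal_mul_sq (r : ℝ) (a : ℂ) :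
    ‖(r : ℂ) * a‖ₑ ^ 2 = ENNReal.ofReal (r ^ 2) * ‖a‖ₑ ^ 2 := by
  rw [enorm_mul, mul_pow, ← ofReal_norm (r : ℂ), Complex.norm_real,
    ← ENNReal.ofReal_pow (norm_nonneg _), Real.norm_eq_abs, sq_abs]

theorem IsSlowRadius.measurable_localBump (h : IsSlowRadius ρ) (x : Rn n) :
    Measurable fun z => localBump ρ z x :=
  (h.continuous_localBump.comp (by fun_prop : Continuous fun z => (z, x))).measurable

/-- A pointwise form of the localization of the Gagliardo seminorm. -/
theorem IsSlowRadius.enorm_shiftX_sub_sq_le (h : IsSlowRadius ρ) (u : PhaseSpace n → ℂ)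
    (a : Rn n) (p : PhaseSpace n) :
    ENNReal.ofReal ((1 / 8) ^ n) * ballVolume n * ‖shiftX a u p - u p‖ₑ ^ 2
      ≤ 2 * (∫⁻ z, ‖shiftX a (cutoffX (localBump ρ z) u) p - cutoffX (localBump ρ z) u p‖ₑ ^ 2
          ∂localMeasure ρ)
        + 2 * shiftConst n * (‖u p‖ₑ ^ 2
          * ENNReal.ofReal (min 1 (((ρ p.1)⁻¹ * ‖a‖) ^ 2))) := by
  have m1 := h.measurable_localBump p.1
  have m2 := h.measurable_localBump (p.1 + a)
  have hm : Measurable fun z =>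
      ‖shiftX a (cutoffX (localBump ρ z) u) p - cutoffX (localBump ρ z) u p‖ₑ ^ 2 := by
    simp only [shiftX, cutoffX]
    fun_prop
  calc _ ≤ (∫⁻ z, ENNReal.ofReal (localBump ρ z (p.1 + a) ^ 2) ∂localMeasure ρ)
          * ‖shiftX a u p - u p‖ₑ ^ 2 := by
        gcongr
        exact h.le_lintegral_localBump_sq _
    _ = ∫⁻ z, ENNReal.ofReal (localBump ρ z (p.1 + a) ^ 2) * ‖shiftX a u p - u p‖ₑ ^ 2
          ∂localMeasure ρ := (lintegral_mul_const' _ _ (by simp)).symm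
    _ ≤ ∫⁻ z, (2 * ‖shiftX a (cutoffX (localBump ρ z) u) p - cutoffX (localBump ρ z) u p‖ₑ ^ 2
          + (2 * ‖u p‖ₑ ^ 2) * ENNReal.ofReal ((localBump ρ z (p.1 + a) - localBump ρ z p.1) ^ 2))
          ∂localMeasure ρ := by
        refine lintegral_mono fun z => ?_
        -- Discrete Leibniz rule: the difference of u times the translated cutoff is the difference
        -- of the localized function minus the difference of the cutoffs times u.
        have e : ((localBump ρ z (p.1 + a) : ℝ) : ℂ) * (shiftX a u p - u p)
            = (shiftX a (cutoffX (localBump ρ z) u) p - cutoffX (localBump ρ z) u p)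
              - ((localBump ρ z (p.1 + a) - localBump ρ z p.1 : ℝ) : ℂ) * u p := by
          simp only [shiftX, cutoffX]
          push_cast
          ring
        rw [← enorm_ofReal_mul_sq, e]
        refine (enorm_sub_sq_le _ _).trans_eq ?_
        rw [enorm_ofReal_mul_sq]
        ring
    _ = 2 * (∫⁻ z, ‖shiftX a (cutoffX (localBump ρ z) u) p - cutoffX (localBump ρ z) u p‖ₑ ^ 2
          ∂localMeasure ρ) + (2 * ‖u p‖ₑ ^ 2)
          * ∫⁻ z, ENNReal.ofReal ((localBump ρ z (p.1 + a) - localBump ρ z p.1) ^ 2)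
          ∂localMeasure ρ := by
        rw [lintegral_add_left (hm.const_mul 2), lintegral_const_mul' _ _ (by simp),
          lintegral_const_mul' _ _ (by simp [ENNReal.mul_eq_top])]
    _ ≤ _ := by
        refine add_le_add le_rfl ?_
        calc _ ≤ (2 * ‖u p‖ₑ ^ 2) * (shiftConst n
              * ENNReal.ofReal (min 1 (((ρ p.1)⁻¹ * ‖a‖) ^ 2))) := by
              gcongr
              exact h.lintegral_localBump_sub_sq_le _ _
          _ = _ := by ring

theorem scaleIntegral_lintegral {α : Type*} [MeasurableSpace α] (μ : Measure α) [SFinite μ]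
    {H : ℝ → α → ENNReal} (hH : Measurable fun q : ℝ × α => H q.1 q.2) :
    scaleIntegral τ (fun t => ∫⁻ a, H t a ∂μ) = ∫⁻ a, scaleIntegral τ (fun t => H t a) ∂μ := by
  have hwm : Measurable fun t : ℝ => ENNReal.ofReal (t ^ (-1 - 2 * τ)) := by fun_prop
  simp only [scaleIntegral, ← lintegral_const_mul' _ _ ENNReal.ofReal_ne_top]
  exact lintegral_lintegral_swap ((hwm.comp measurable_fst).mul hH).aemeasurable

theorem scaleIntegral_add {f g : ℝ → ENNReal} (hf : Measurable f) :
    scaleIntegral τ (fun t => f t + g t) = scaleIntegral τ f + scaleIntegral τ g := by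
  have hwm : Measurable fun t : ℝ => ENNReal.ofReal (t ^ (-1 - 2 * τ)) := by fun_prop
  simp only [scaleIntegral, mul_add]
  exact lintegral_add_left (hwm.mul hf) _

theorem IsSlowRadius.measurable_enorm_shiftX_cutoffX (h : IsSlowRadius ρ) (hu : IsTestFunction u)
    (j : Fin n) : Measurable fun q : (ℝ × Rn n) × PhaseSpace n =>
      ‖shiftX (q.1.1 • stdVec j) (cutoffX (localBump ρ q.1.2) u) q.2
        - cutoffX (localBump ρ q.1.2) u q.2‖ₑ ^ 2 := by
  have huc := hu.1.continuous
  have hφc := h.continuous_localBump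
  have hc : Continuous fun q : (ℝ × Rn n) × PhaseSpace n =>
      shiftX (q.1.1 • stdVec j) (cutoffX (localBump ρ q.1.2) u) q.2
        - cutoffX (localBump ρ q.1.2) u q.2 := by
    have h1 : Continuous fun q : (ℝ × Rn n) × PhaseSpace n =>
        localBump ρ q.1.2 (q.2.1 + q.1.1 • stdVec j) :=
      hφc.comp (f := fun q : (ℝ × Rn n) × PhaseSpace n => (q.1.2, q.2.1 + q.1.1 • stdVec j))
        (by fun_prop)
    have h2 : Continuous fun q : (ℝ × Rn n) × PhaseSpace n => localBump ρ q.1.2 q.2.1 :=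
      hφc.comp (f := fun q : (ℝ × Rn n) × PhaseSpace n => (q.1.2, q.2.1)) (by fun_prop)
    simp only [shiftX, cutoffX]
    fun_prop
  exact hc.measurable.enorm.pow_const 2

theorem IsSlowRadius.measurable_enorm_mul_min (h : IsSlowRadius ρ) (hu : IsTestFunction u) :
    Measurable fun q : ℝ × PhaseSpace n =>
      ‖u q.2‖ₑ ^ 2 * ENNReal.ofReal (min 1 (((ρ q.2.1)⁻¹ * q.1) ^ 2)) := by
  have huc := hu.1.continuous
  have h1 : Continuous fun q : ℝ × PhaseSpace n => min 1 (((ρ q.2.1)⁻¹ * q.1) ^ 2) := by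
    have : Continuous fun q : ℝ × PhaseSpace n => (ρ q.2.1)⁻¹ :=
      (h.continuous.comp (by fun_prop)).inv₀ fun p => (h.pos _).ne'
    fun_prop
  have h2 : Continuous fun q : ℝ × PhaseSpace n => u q.2 := by fun_prop
  exact (h2.measurable.enorm.pow_const 2).mul h1.measurable.ennreal_ofReal

theorem measurable_slice {α β γ : Type*} [MeasurableSpace α] [MeasurableSpace β]
    [MeasurableSpace γ] {F : α → β → γ → ENNReal}
    (hF : Measurable fun q : (α × β) × γ => F q.1.1 q.1.2 q.2) (a : α) :
    Measurable fun q : γ × β => F a q.2 q.1 :=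
  hF.comp ((measurable_const.prodMk measurable_snd).prodMk measurable_fst)

theorem IsSlowRadius.lintegral_enorm_shiftX_sub_sq_le (h : IsSlowRadius ρ) (hu : IsTestFunction u)
    (j : Fin n) {t : ℝ} (ht : 0 < t) :
    ENNReal.ofReal ((1 / 8) ^ n) * ballVolume n * ∫⁻ p, ‖shiftX (t • stdVec j) u p - u p‖ₑ ^ 2
      ≤ 2 * (∫⁻ z, (∫⁻ p, ‖shiftX (t • stdVec j) (cutoffX (localBump ρ z) u) p
          - cutoffX (localBump ρ z) u p‖ₑ ^ 2) ∂localMeasure ρ)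
        + 2 * shiftConst n * ∫⁻ p : PhaseSpace n,
          ‖u p‖ₑ ^ 2 * ENNReal.ofReal (min 1 (((ρ p.1)⁻¹ * t) ^ 2)) := by
  have hb : ENNReal.ofReal ((1 / 8) ^ n) * ballVolume n ≠ ⊤ :=
    (ENNReal.mul_lt_top ENNReal.ofReal_lt_top (ballVolume_lt_top n)).ne
  have hsc : 2 * shiftConst n ≠ ⊤ := (ENNReal.mul_lt_top (by simp) (shiftConst_lt_top n)).ne
  have hFt : Measurable fun q : PhaseSpace n × Rn n =>
      ‖shiftX (t • stdVec j) (cutoffX (localBump ρ q.2) u) q.1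
        - cutoffX (localBump ρ q.2) u q.1‖ₑ ^ 2 :=
    measurable_slice (F := fun t z p => ‖shiftX (t • stdVec j) (cutoffX (localBump ρ z) u) p
      - cutoffX (localBump ρ z) u p‖ₑ ^ 2) (h.measurable_enorm_shiftX_cutoffX hu j) t
  have hswap : ∫⁻ z, (∫⁻ p, ‖shiftX (t • stdVec j) (cutoffX (localBump ρ z) u) p
      - cutoffX (localBump ρ z) u p‖ₑ ^ 2) ∂localMeasure ρ
      = ∫⁻ p, (∫⁻ z, ‖shiftX (t • stdVec j) (cutoffX (localBump ρ z) u) p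
      - cutoffX (localBump ρ z) u p‖ₑ ^ 2 ∂localMeasure ρ) :=
    (lintegral_lintegral_swap hFt.aemeasurable).symm
  have hA : Measurable fun p => ∫⁻ z, ‖shiftX (t • stdVec j) (cutoffX (localBump ρ z) u) p
      - cutoffX (localBump ρ z) u p‖ₑ ^ 2 ∂localMeasure ρ := hFt.lintegral_prod_right'
  have hnorm : ‖t • (stdVec j : Rn n)‖ = t := by simp [norm_smul, ht.le]
  rw [hswap]
  generalize hAdef : (fun p => ∫⁻ z, ‖shiftX (t • stdVec j) (cutoffX (localBump ρ z) u) p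
      - cutoffX (localBump ρ z) u p‖ₑ ^ 2 ∂localMeasure ρ) = A at hA
  have hle : ∀ p : PhaseSpace n, ENNReal.ofReal ((1 / 8) ^ n) * ballVolume n
      * ‖shiftX (t • stdVec j) u p - u p‖ₑ ^ 2 ≤ 2 * A p + 2 * shiftConst n
        * (‖u p‖ₑ ^ 2 * ENNReal.ofReal (min 1 (((ρ p.1)⁻¹ * t) ^ 2))) := fun p => by
    have := h.enorm_shiftX_sub_sq_le u (t • stdVec j) p
    rw [hnorm] at this
    rw [← hAdef]
    exact this
  calc _ = ∫⁻ p, ENNReal.ofReal ((1 / 8) ^ n) * ballVolume n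
        * ‖shiftX (t • stdVec j) u p - u p‖ₑ ^ 2 := (lintegral_const_mul' _ _ hb).symm
    _ ≤ ∫⁻ p, (2 * A p + 2 * shiftConst n
        * (‖u p‖ₑ ^ 2 * ENNReal.ofReal (min 1 (((ρ p.1)⁻¹ * t) ^ 2)))) := lintegral_mono hle
    _ = 2 * (∫⁻ p, A p) + 2 * shiftConst n * ∫⁻ p : PhaseSpace n,
          ‖u p‖ₑ ^ 2 * ENNReal.ofReal (min 1 (((ρ p.1)⁻¹ * t) ^ 2)) := by
        rw [lintegral_add_left (hA.const_mul 2), lintegral_const_mul _ hA,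
          lintegral_const_mul' _ _ hsc]

/-- At each point the substitution t ↦ t/ρ(x) extracts ρ(x)^{-2τ} and leaves a universal constant.
-/
theorem IsSlowRadius.scaleIntegral_lintegral_min (h : IsSlowRadius ρ) (hu : IsTestFunction u) :
    scaleIntegral τ (fun t => ∫⁻ p : PhaseSpace n,
        ‖u p‖ₑ ^ 2 * ENNReal.ofReal (min 1 (((ρ p.1)⁻¹ * t) ^ 2)))
      = scaleIntegral τ (fun t => ENNReal.ofReal (min 1 (t ^ 2)))
        * ∫⁻ p : PhaseSpace n, ENNReal.ofReal ((ρ p.1)⁻¹ ^ (2 * τ)) * ‖u p‖ₑ ^ 2 := by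
  have huc := hu.1.continuous
  have hρm : Measurable fun p : PhaseSpace n => (ρ p.1)⁻¹ :=
    (h.continuous.measurable.comp measurable_fst).inv
  rw [scaleIntegral_lintegral volume (H := fun t (p : PhaseSpace n) =>
    ‖u p‖ₑ ^ 2 * ENNReal.ofReal (min 1 (((ρ p.1)⁻¹ * t) ^ 2))) (h.measurable_enorm_mul_min hu)]
  have hm : Measurable fun p : PhaseSpace n =>
      ENNReal.ofReal ((ρ p.1)⁻¹ ^ (2 * τ)) * ‖u p‖ₑ ^ 2 :=
    (hρm.pow_const _).ennreal_ofReal.mul (huc.measurable.enorm.pow_const 2)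
  rw [← lintegral_const_mul _ hm]
  refine lintegral_congr fun p => ?_
  have hs := scaleIntegral_comp_mul (τ := τ) (f := fun t => ENNReal.ofReal (min 1 (t ^ 2)))
    (by fun_prop) (inv_pos.2 (h.pos p.1))
  rw [scaleIntegral_const_mul (by simp), hs]
  ring

/-- Localization of the Gagliardo seminorm. -/
theorem IsSlowRadius.gagliardo_le (h : IsSlowRadius ρ) (hu : IsTestFunction u) (j : Fin n) :
    ENNReal.ofReal ((1 / 8) ^ n) * ballVolume n * gagliardo τ j u
      ≤ 2 * (∫⁻ z, gagliardo τ j (cutoffX (localBump ρ z) u) ∂localMeasure ρ)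
        + 2 * shiftConst n * (scaleIntegral τ (fun t => ENNReal.ofReal (min 1 (t ^ 2)))
          * ∫⁻ p : PhaseSpace n, ENNReal.ofReal ((ρ p.1)⁻¹ ^ (2 * τ)) * ‖u p‖ₑ ^ 2) := by
  have hb : ENNReal.ofReal ((1 / 8) ^ n) * ballVolume n ≠ ⊤ :=
    (ENNReal.mul_lt_top ENNReal.ofReal_lt_top (ballVolume_lt_top n)).ne
  have hsc : 2 * shiftConst n ≠ ⊤ := (ENNReal.mul_lt_top (by simp) (shiftConst_lt_top n)).ne
  have hF : Measurable fun q : ℝ × Rn n => ∫⁻ p, ‖shiftX (q.1 • stdVec j)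
      (cutoffX (localBump ρ q.2) u) p - cutoffX (localBump ρ q.2) u p‖ₑ ^ 2 :=
    (h.measurable_enorm_shiftX_cutoffX hu j).lintegral_prod_right'
  rw [← h.scaleIntegral_lintegral_min hu, ← scaleIntegral_const_mul hsc, gagliardo,
    ← scaleIntegral_const_mul hb]
  have e : ∫⁻ z, gagliardo τ j (cutoffX (localBump ρ z) u) ∂localMeasure ρ
      = scaleIntegral τ (fun t => ∫⁻ z, (∫⁻ p, ‖shiftX (t • stdVec j)
        (cutoffX (localBump ρ z) u) p - cutoffX (localBump ρ z) u p‖ₑ ^ 2) ∂localMeasure ρ) :=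
    (scaleIntegral_lintegral (localMeasure ρ) hF).symm
  rw [e, ← scaleIntegral_const_mul (by simp), ← scaleIntegral_add
    ((hF.lintegral_prod_right' (ν := localMeasure ρ)).const_mul 2)]
  exact scaleIntegral_mono fun t ht => h.lintegral_enorm_shiftX_sub_sq_le hu j ht

theorem exists_lintegral_controlledDensity_le (n : ℕ) (hK : 1 ≤ K) (hs : s < 4 / 3) :
    ∃ C : ℝ, 0 ≤ C ∧ ∀ (W : Rn n → Rn n) (J : Rn n → Rn n →L[ℝ] Rn n),
      AdmissibleField K s W J → ∀ u, IsTestFunction u →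
      ∫⁻ p, ENNReal.ofReal (controlledDensity W J u p)
        ≤ ENNReal.ofReal C * ((∫⁻ p, ‖fokkerPlanckOp W J u p‖ₑ ^ 2) + ∫⁻ p, ‖u p‖ₑ ^ 2) := by
  obtain ⟨C, hC, h⟩ := exists_weighted_estimate n hK hs
  refine ⟨1 + C, by positivity, fun W J hA u hu => ?_⟩
  have hP := continuous_fokkerPlanckOp hA hu
  have hPs : HasCompactSupport (fokkerPlanckOp W J u) :=
    HasCompactSupport.intro hu.2.isCompact fun q hq => by
      simp [fokkerPlanckOp, kineticOp_eq_zero_off_tsupport hq]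
  have i1 : Integrable fun p => ‖fokkerPlanckOp W J u p‖ ^ 2 :=
    integrable_of_eq_zero_off_tsupport hPs (hP.norm.pow 2) fun x hx => by
      simp [image_eq_zero_of_notMem_tsupport hx]
  have i1' : Integrable fun p => ‖u p‖ ^ 2 :=
    integrable_of_eq_zero_off_tsupport hu.2 (hu.1.continuous.norm.pow 2) fun x hx => by
      simp [image_eq_zero_of_notMem_tsupport hx]
  have hW := hA.contDiff.continuous
  have i2 := integrable_weight_mul_norm_sq hu (continuous_japaneseBracket_rpow hW (4 / 3))
  have i3 := integrable_weight_mul_energy hu (continuous_japaneseBracket_rpow hW (2 / 3))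
  have i4 := integrable_weight_mul_energy hu (w := fun p => ‖p.2‖ ^ 2) (by fun_prop)
  have hi : Integrable (controlledDensity W J u) := i1.add ((i2.add i3).add i4)
  have hR : ∫ p, controlledDensity W J u p = (∫ p, ‖fokkerPlanckOp W J u p‖ ^ 2)
      + ((∫ p : PhaseSpace n, japaneseBracket (W p.1) ^ (4 / 3 : ℝ) * ‖u p‖ ^ 2)
      + (∫ p : PhaseSpace n, japaneseBracket (W p.1) ^ (2 / 3 : ℝ)
        * (gradYSq u p + ‖p.2‖ ^ 2 * ‖u p‖ ^ 2))
      + ∫ p : PhaseSpace n, ‖p.2‖ ^ 2 * (gradYSq u p + ‖p.2‖ ^ 2 * ‖u p‖ ^ 2)) := by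
    rw [← integral_add i2 i3]
    exact (integral_add i1 ((i2.add i3).add i4)).trans
      (congrArg (_ + ·) (integral_add (i2.add i3) i4))
  have h1 := h W J hA u hu
  rw [integral_add i1 i1'] at h1
  rw [← ofReal_integral_eq_lintegral_ofReal hi
    (Filter.Eventually.of_forall (controlledDensity_nonneg W J u)),
    lintegral_enorm_sq_eq_ofReal hP hPs, lintegral_enorm_sq_eq_ofReal hu.1.continuous hu.2,
    ← ENNReal.ofReal_add (by positivity) (by positivity), ← ENNReal.ofReal_mul (by positivity)]
  refine ENNReal.ofReal_le_ofReal ?_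
  rw [hR]
  have : 0 ≤ ∫ p, ‖u p‖ ^ 2 := by positivity
  linarith

end SobolevEstimate

end

noncomputable section

/-! ### The Sobolev bound for variable coefficients -/

section SobolevBound

variable {n : ℕ} {K s τ : ℝ} {W : Rn n → Rn n} {J : Rn n → Rn n →L[ℝ] Rn n}
  {u : PhaseSpace n → ℂ}

theorem continuous_controlledDensity (hA : AdmissibleField K s W J) (hu : IsTestFunction u) :
    Continuous (controlledDensity W J u) := by
  have h1 := continuous_fokkerPlanckOp hA hu
  have h2 := continuous_gradYSq hu
  have h3 := continuous_japaneseBracket_rpow hA.contDiff.continuous (4 / 3)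
  have h4 := continuous_japaneseBracket_rpow hA.contDiff.continuous (2 / 3)
  have h5 := hu.1.continuous
  unfold controlledDensity
  fun_prop

/-- The pointwise commutator bound integrated for a fixed center. The indicator remembers the
support of the cutoff and will pay for the integration over centers. -/
theorem AdmissibleField.weighted_localized_le (hA : AdmissibleField K s W J) (hs0 : 2 / 3 ≤ s)
    (hs : s ≤ 2) (hJ : Differentiable ℝ J)
    (hJ' : ∀ x, ‖fderiv ℝ J x‖ ≤ K * japaneseBracket (W x) ^ (s / 2))
    (hu : IsTestFunction u) (z : Rn n) :
    ENNReal.ofReal (japaneseBracket (W z) ^ (2 / 3 - s))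
        * (∫⁻ p, ‖fokkerPlanckOp (fun _ => W z) (fun _ => J z)
          (cutoffX (localBump (fieldRadius K s W) z) u) p‖ₑ ^ 2)
      + ENNReal.ofReal (japaneseBracket (W z) ^ (4 / 3 : ℝ))
        * (∫⁻ p, ‖cutoffX (localBump (fieldRadius K s W) z) u p‖ₑ ^ 2)
      ≤ ∫⁻ p : PhaseSpace n, (nearCenters (fieldRadius K s W) p.1).indicator
        (fun _ => ENNReal.ofReal
          (36 * (1 + K ^ 2 * bumpConst n ^ 2) * controlledDensity W J u p)) z := by
  have hρ := hA.isSlowRadius (by linarith) hs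
  have hzp := japaneseBracket_pos (W z)
  have hcut := hu.cutoffX (contDiff_localBump (fieldRadius K s W) z)
  have hPc := (hcut.fokkerPlanckOp_const (W z) (J z)).1.continuous
  set v := cutoffX (localBump (fieldRadius K s W) z) u with hv
  rw [← lintegral_const_mul' _ _ ENNReal.ofReal_ne_top,
    ← lintegral_const_mul' _ _ ENNReal.ofReal_ne_top,
    ← lintegral_add_left ((hPc.measurable.enorm.pow_const 2).const_mul _)]
  refine lintegral_mono fun p => ?_
  have e : ∀ {r : ℝ} (a : ℂ), 0 ≤ r →
      ENNReal.ofReal r * ‖a‖ₑ ^ 2 = ENNReal.ofReal (r * ‖a‖ ^ 2) := fun a hr => by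
    rw [ENNReal.ofReal_mul hr, ENNReal.ofReal_pow (norm_nonneg _), ofReal_norm]
  rw [e _ (by positivity), e _ (by positivity), ← ENNReal.ofReal_add (by positivity) (by positivity)]
  by_cases hz : z ∈ nearCenters (fieldRadius K s W) p.1
  · rw [Set.indicator_of_mem hz]
    exact ENNReal.ofReal_le_ofReal (hA.localized_density_le hs0 hs hJ hJ' hu hz)
  · have h1 : v p = 0 := by rw [hv, cutoffX, hρ.localBump_eq_zero hz]; simp
    have h2 : fokkerPlanckOp (fun _ => W z) (fun _ => J z) v p = 0 := by
      rw [hv, fokkerPlanckOp_cutoffX (contDiff_localBump _ _) hu, hρ.localBump_eq_zero hz,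
        hρ.fderiv_localBump_eq_zero hz]
      simp
    simp [h1, h2]

/-- After exchanging the integrals, bounded overlap removes the integration over centers. -/
theorem AdmissibleField.lintegral_indicator_nearCenters_le (hA : AdmissibleField K s W J)
    (hs0 : 0 ≤ s) (hs : s ≤ 2) (hu : IsTestFunction u) {c : ℝ} (hc : 0 ≤ c) :
    ∫⁻ z, (∫⁻ p : PhaseSpace n, (nearCenters (fieldRadius K s W) p.1).indicator
        (fun _ => ENNReal.ofReal (c * controlledDensity W J u p)) z)
          ∂localMeasure (fieldRadius K s W)
      ≤ ENNReal.ofReal c * (ENNReal.ofReal (3 ^ n) * ballVolume n)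
        * ∫⁻ p, ENNReal.ofReal (controlledDensity W J u p) := by
  have hρ := hA.isSlowRadius hs0 hs
  have hρc := hρ.continuous
  have hR := continuous_controlledDensity hA hu
  have hm : Measurable fun q : Rn n × PhaseSpace n =>
      (nearCenters (fieldRadius K s W) q.2.1).indicator
        (fun _ => ENNReal.ofReal (c * controlledDensity W J u q.2)) q.1 := by
    have hS : MeasurableSet {q : Rn n × PhaseSpace n | ‖q.2.1 - q.1‖ ≤ fieldRadius K s W q.1} :=
      (isClosed_le (by fun_prop) (by fun_prop)).measurableSet
    have hf : Continuous fun q : Rn n × PhaseSpace n => c * controlledDensity W J u q.2 := by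
      fun_prop
    exact hf.measurable.ennreal_ofReal.indicator hS
  rw [lintegral_lintegral_swap hm.aemeasurable,
    ← lintegral_const_mul _ hR.measurable.ennreal_ofReal]
  refine lintegral_mono fun p => ?_
  rw [lintegral_indicator_const (hρ.measurableSet_nearCenters p.1), ENNReal.ofReal_mul hc,
    mul_right_comm]
  gcongr
  exact hρ.localMeasure_nearCenters_le p.1

/-- The gluing error carries Λ^{sτ}, and sτ ≤ 4/3 when s ≤ 2 and τ ≤ 2/3. -/
theorem AdmissibleField.inv_fieldRadius_rpow_le (hA : AdmissibleField K s W J) (hs0 : 0 ≤ s)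
    (hτ0 : 0 < τ) (hτ : τ ≤ 2 / 3) (hs : s ≤ 2) (x : Rn n) :
    (fieldRadius K s W x)⁻¹ ^ (2 * τ) ≤ 4 * K ^ 2 * japaneseBracket (W x) ^ (4 / 3 : ℝ) := by
  have hK := hA.one_le
  have hx := japaneseBracket_pos (W x)
  rw [fieldRadius, mul_inv, inv_inv, Real.rpow_neg hx.le, inv_inv,
    Real.mul_rpow (by positivity) (by positivity), ← Real.rpow_mul hx.le]
  gcongr
  · calc (2 * K) ^ (2 * τ) ≤ (2 * K) ^ (2 : ℝ) :=
          Real.rpow_le_rpow_of_exponent_le (by linarith) (by linarith)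
      _ = 4 * K ^ 2 := by norm_num; ring
  · exact one_le_japaneseBracket _
  · nlinarith

/-- Assembly: Sobolev norm, Gagliardo seminorms, localized seminorms, frozen estimates with
interpolation, commutator bounds, force estimate. -/
theorem exists_lintegral_japaneseBracket_le_of_two_thirds_le (n : ℕ) (hK : 1 ≤ K)
    (hs0 : 2 / 3 ≤ s) (hs : s < 4 / 3) (hτ0 : 0 < τ) (hτ : τ ≤ 2 / 3) (hτs : τ ≤ 4 / 3 - s) :
    ∃ C : ENNReal, C ≠ ⊤ ∧ ∀ (W : Rn n → Rn n) (J : Rn n → Rn n →L[ℝ] Rn n),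
      AdmissibleField K s W J → Differentiable ℝ J →
      (∀ x, ‖fderiv ℝ J x‖ ≤ K * japaneseBracket (W x) ^ (s / 2)) → ∀ u, IsTestFunction u →
      ∫⁻ p : PhaseSpace n, ENNReal.ofReal (japaneseBracket ((2 * Real.pi) • p.1) ^ (2 * τ))
          * ‖partialFourier u p‖ₑ ^ 2
        ≤ C * ((∫⁻ p, ‖fokkerPlanckOp W J u p‖ₑ ^ 2) + ∫⁻ p, ‖u p‖ₑ ^ 2) := by
  obtain ⟨C₁, hC₁, h₁⟩ := exists_interpolated_estimate n K
  obtain ⟨C₂, hC₂, h₂⟩ := exists_lintegral_controlledDensity_le n hK hs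
  set c₀ := scaleIntegral τ chordSq with hc₀
  have hc₀pos : c₀ ≠ 0 := (scaleIntegral_chordSq_pos τ).ne'
  have hc₀top : c₀ ≠ ⊤ := (scaleIntegral_chordSq_lt_top hτ0 (by linarith)).ne
  set b₀ := ENNReal.ofReal ((1 / 8) ^ n) * ballVolume n with hb₀
  have hb₀pos : b₀ ≠ 0 :=
    (ENNReal.mul_pos (ENNReal.ofReal_pos.2 (by positivity)).ne' (ballVolume_pos n).ne').ne'
  have hb₀top : b₀ ≠ ⊤ := (ENNReal.mul_lt_top ENNReal.ofReal_lt_top (ballVolume_lt_top n)).ne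
  set m₀ := scaleIntegral τ (fun t => ENNReal.ofReal (min 1 (t ^ 2))) with hm₀
  have hm₀top : m₀ ≠ ⊤ := (scaleIntegral_min_one_sq_lt_top hτ0 (by linarith)).ne
  set c : ℝ := 36 * (1 + K ^ 2 * bumpConst n ^ 2) with hc
  have hc0 : 0 ≤ c := by positivity
  set B : ENNReal := ENNReal.ofReal c * (ENNReal.ofReal (3 ^ n) * ballVolume n) with hB
  have hBtop : B ≠ ⊤ := ENNReal.mul_ne_top ENNReal.ofReal_ne_top
    (ENNReal.mul_ne_top ENNReal.ofReal_ne_top (ballVolume_lt_top n).ne)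
  have hsc : shiftConst n ≠ ⊤ := (shiftConst_lt_top n).ne
  -- The two summands are the localized seminorms and the gluing error; b₀ is the lower bound for
  -- the mass of the squared cutoffs.
  set D : ENNReal := b₀⁻¹ * (2 * (c₀ * (ENNReal.ofReal C₁ * B))
    + 2 * shiftConst n * (m₀ * ENNReal.ofReal (4 * K ^ 2))) with hD
  have hDtop : D ≠ ⊤ := by
    refine ENNReal.mul_ne_top (ENNReal.inv_ne_top.2 hb₀pos) (ENNReal.add_ne_top.2 ⟨?_, ?_⟩)
    · exact ENNReal.mul_ne_top (by simp)
        (ENNReal.mul_ne_top hc₀top (ENNReal.mul_ne_top ENNReal.ofReal_ne_top hBtop))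
    · exact ENNReal.mul_ne_top (ENNReal.mul_ne_top (by simp) hsc)
        (ENNReal.mul_ne_top hm₀top ENNReal.ofReal_ne_top)
  refine ⟨1 + c₀⁻¹ * (n * (D * ENNReal.ofReal C₂)), ?_, fun W J hA hJ hJ' u hu => ?_⟩
  · exact ENNReal.add_ne_top.2 ⟨by simp, ENNReal.mul_ne_top (ENNReal.inv_ne_top.2 hc₀pos)
      (ENNReal.mul_ne_top (by simp) (ENNReal.mul_ne_top hDtop ENNReal.ofReal_ne_top))⟩
  have hρ := hA.isSlowRadius (by linarith) (by linarith)
  set ρ := fieldRadius K s W with hρdef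
  set R : ENNReal := ∫⁻ p, ENNReal.ofReal (controlledDensity W J u p) with hR
  set F : ENNReal := (∫⁻ p, ‖fokkerPlanckOp W J u p‖ₑ ^ 2) + ∫⁻ p, ‖u p‖ₑ ^ 2 with hF
  have hloc : ∀ j, ∫⁻ z, gagliardo τ j (cutoffX (localBump ρ z) u) ∂localMeasure ρ
      ≤ c₀ * (ENNReal.ofReal C₁ * B) * R := by
    intro j
    calc _ ≤ ∫⁻ z, c₀ * ENNReal.ofReal C₁ * (∫⁻ p : PhaseSpace n, (nearCenters ρ p.1).indicator
          (fun _ => ENNReal.ofReal (c * controlledDensity W J u p)) z) ∂localMeasure ρ := by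
          refine lintegral_mono fun z => ?_
          have hv := hu.cutoffX (contDiff_localBump ρ z)
          refine (gagliardo_le hτ0 hv j).trans ?_
          rw [mul_assoc]
          refine mul_le_mul_right ((h₁ (J z) (japaneseBracket (W z)) s τ (hA.skew z)
            (one_le_japaneseBracket _) (hA.norm_le z) hs0 hτ0 hτ hτs (W z) _ hv).trans ?_) _
          exact mul_le_mul_right
            (hA.weighted_localized_le hs0 (by linarith) hJ hJ' hu z) _
      _ = c₀ * ENNReal.ofReal C₁ * ∫⁻ z, (∫⁻ p : PhaseSpace n, (nearCenters ρ p.1).indicator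
          (fun _ => ENNReal.ofReal (c * controlledDensity W J u p)) z) ∂localMeasure ρ :=
          lintegral_const_mul' _ _ (ENNReal.mul_ne_top hc₀top ENNReal.ofReal_ne_top)
      _ ≤ c₀ * ENNReal.ofReal C₁ * (B * R) := by
          gcongr
          exact hA.lintegral_indicator_nearCenters_le (by linarith) (by linarith) hu hc0
      _ = _ := by ring
  have hweight : ∫⁻ p : PhaseSpace n, ENNReal.ofReal ((ρ p.1)⁻¹ ^ (2 * τ)) * ‖u p‖ₑ ^ 2
      ≤ ENNReal.ofReal (4 * K ^ 2) * R := by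
    rw [hR, ← lintegral_const_mul' _ _ ENNReal.ofReal_ne_top]
    refine lintegral_mono fun p => ?_
    have hpos := hρ.pos p.1
    rw [← ofReal_norm, ← ENNReal.ofReal_pow (norm_nonneg _), ← ENNReal.ofReal_mul (by positivity),
      ← ENNReal.ofReal_mul (by positivity)]
    refine ENNReal.ofReal_le_ofReal ?_
    have h1 := hA.inv_fieldRadius_rpow_le (by linarith) hτ0 hτ (by linarith) p.1
    have hg := gradYSq_nonneg u p
    have hjp := japaneseBracket_pos (W p.1)
    calc _ ≤ 4 * K ^ 2 * japaneseBracket (W p.1) ^ (4 / 3 : ℝ) * ‖u p‖ ^ 2 := by gcongr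
      _ = 4 * K ^ 2 * (0 + (japaneseBracket (W p.1) ^ (4 / 3 : ℝ) * ‖u p‖ ^ 2 + 0 + 0)) := by ring
      _ ≤ 4 * K ^ 2 * controlledDensity W J u p := by
          unfold controlledDensity
          gcongr <;> positivity
  have hgag : ∀ j, gagliardo τ j u ≤ D * ENNReal.ofReal C₂ * F := by
    intro j
    have h3 : b₀ * gagliardo τ j u ≤ (2 * (c₀ * (ENNReal.ofReal C₁ * B))
        + 2 * shiftConst n * (m₀ * ENNReal.ofReal (4 * K ^ 2))) * R := by
      refine (hρ.gagliardo_le hu j).trans ?_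
      calc _ ≤ 2 * (c₀ * (ENNReal.ofReal C₁ * B) * R)
            + 2 * shiftConst n * (m₀ * (ENNReal.ofReal (4 * K ^ 2) * R)) := by
            gcongr
            exact hloc j
        _ = _ := by ring
    calc gagliardo τ j u = b₀⁻¹ * (b₀ * gagliardo τ j u) := by
          rw [← mul_assoc, ENNReal.inv_mul_cancel hb₀pos hb₀top, one_mul]
      _ ≤ b₀⁻¹ * ((2 * (c₀ * (ENNReal.ofReal C₁ * B))
        + 2 * shiftConst n * (m₀ * ENNReal.ofReal (4 * K ^ 2))) * R) := by gcongr
      _ = D * R := (mul_assoc _ _ _).symm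
      _ ≤ D * (ENNReal.ofReal C₂ * F) := by gcongr; exact h₂ W J hA u hu
      _ = _ := by ring
  have hfin := scaleIntegral_mul_lintegral_japaneseBracket_le hτ0 (by linarith) hu
  rw [← hc₀] at hfin
  set X := ∫⁻ p : PhaseSpace n, ENNReal.ofReal (japaneseBracket ((2 * Real.pi) • p.1) ^ (2 * τ))
    * ‖partialFourier u p‖ₑ ^ 2
  calc X = c₀⁻¹ * (c₀ * X) := by
        rw [← mul_assoc, ENNReal.inv_mul_cancel hc₀pos hc₀top, one_mul]
    _ ≤ c₀⁻¹ * (c₀ * (∫⁻ p, ‖u p‖ₑ ^ 2) + ∑ j, gagliardo τ j u) := by gcongr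
    _ ≤ c₀⁻¹ * (c₀ * F + ∑ _j : Fin n, D * ENNReal.ofReal C₂ * F) := by
        gcongr with j
        · exact le_add_self
        · exact hgag j
    _ = (c₀⁻¹ * c₀) * F + c₀⁻¹ * (n * (D * ENNReal.ofReal C₂)) * F := by
        rw [Finset.sum_const, Finset.card_univ, Fintype.card_fin, nsmul_eq_mul]
        ring
    _ = _ := by rw [ENNReal.inv_mul_cancel hc₀pos hc₀top]; ring

theorem AdmissibleField.mono {s' : ℝ} (hA : AdmissibleField K s W J) (h : s ≤ s') :
    AdmissibleField K s' W J where
  one_le := hA.one_le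
  contDiff := hA.contDiff
  continuous := hA.continuous
  skew := hA.skew
  norm_fderiv_le x := (hA.norm_fderiv_le x).trans (mul_le_mul_of_nonneg_left
    (Real.rpow_le_rpow_of_exponent_le (one_le_japaneseBracket _) h) (by linarith [hA.one_le]))
  norm_le := hA.norm_le

/-- These bounds are all that the proof uses about τ. For s ≥ 2/3 the admissible value is 4/3 - s,
and the last range asks only for half of it. -/
theorem subellipticExponent_bounds (hs : s < 4 / 3) : 0 < subellipticExponent s ∧
    subellipticExponent s ≤ 2 / 3 ∧ subellipticExponent s ≤ 4 / 3 - max s (2 / 3) := by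
  unfold subellipticExponent
  rcases le_total s (2 / 3) with h | h
  · rw [max_eq_right h]; split_ifs <;> refine ⟨?_, ?_, ?_⟩ <;> linarith
  · rw [max_eq_left h]; split_ifs <;> refine ⟨?_, ?_, ?_⟩ <;> linarith

/-- For s below 2/3 the hypotheses also hold with 2/3 in place of s, because the bracket is at least
1, and τ = 2/3 is then still allowed. -/
theorem exists_lintegral_japaneseBracket_le (n : ℕ) (hK : 1 ≤ K) (hs : s < 4 / 3) :
    ∃ C : ENNReal, C ≠ ⊤ ∧ ∀ (W : Rn n → Rn n) (J : Rn n → Rn n →L[ℝ] Rn n),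
      AdmissibleField K s W J → Differentiable ℝ J →
      (∀ x, ‖fderiv ℝ J x‖ ≤ K * japaneseBracket (W x) ^ (s / 2)) → ∀ u, IsTestFunction u →
      ∫⁻ p : PhaseSpace n, ENNReal.ofReal
          (japaneseBracket ((2 * Real.pi) • p.1) ^ (2 * subellipticExponent s))
          * ‖partialFourier u p‖ₑ ^ 2
        ≤ C * ((∫⁻ p, ‖fokkerPlanckOp W J u p‖ₑ ^ 2) + ∫⁻ p, ‖u p‖ₑ ^ 2) := by
  obtain ⟨h1, h2, h3⟩ := subellipticExponent_bounds hs
  obtain ⟨C, hC, h⟩ := exists_lintegral_japaneseBracket_le_of_two_thirds_le n hK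
    (le_max_right s (2 / 3)) (max_lt hs (by norm_num)) h1 h2 h3
  refine ⟨C, hC, fun W J hA hJ hJ' u hu =>
    h W J (hA.mono (le_max_left _ _)) hJ (fun x => (hJ' x).trans ?_) u hu⟩
  exact mul_le_mul_of_nonneg_left (Real.rpow_le_rpow_of_exponent_le (one_le_japaneseBracket _)
    (div_le_div_of_nonneg_right (le_max_left _ _) zero_le_two)) (by linarith)

end SobolevBound

end

noncomputable section

/-! ### The Bessel potential in x and its L² norm -/

section BesselPotential

variable {n : ℕ} {u : PhaseSpace n → ℂ}

theorem normL2_sq (f : PhaseSpace n → ℂ) : normL2 f ^ 2 = ∫⁻ p, ‖f p‖ₑ ^ 2 := by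
  rw [normL2, eLpNorm_eq_lintegral_rpow_enorm_toReal two_ne_zero ENNReal.ofNat_ne_top,
    ← ENNReal.rpow_natCast, ← ENNReal.rpow_mul]
  simp

theorem le_of_sq_le_mul_add_sq {a b c d : ENNReal} (h : a ^ 2 ≤ c * (b ^ 2 + d ^ 2)) :
    a ≤ (1 + c) * (b + d) := by
  refine (ENNReal.pow_right_strictMono two_ne_zero).le_iff_le.1 (h.trans ?_)
  calc c * (b ^ 2 + d ^ 2) ≤ (1 + c) ^ 2 * (b + d) ^ 2 := by
        gcongr
        · calc c ≤ 1 + 2 * c + c ^ 2 := by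
                rw [two_mul, add_right_comm, ← add_assoc]; exact le_add_self
            _ = (1 + c) ^ 2 := by ring
        · calc b ^ 2 + d ^ 2 ≤ b ^ 2 + d ^ 2 + 2 * b * d := le_self_add
            _ = (b + d) ^ 2 := by ring
    _ = ((1 + c) * (b + d)) ^ 2 := by ring

theorem hasTemperateGrowth_japaneseBracket_rpow (r : ℝ) :
    (fun ξ : Rn n => japaneseBracket ((2 * Real.pi) • ξ) ^ r).HasTemperateGrowth := by
  simp only [japaneseBracket_rpow]
  exact (Function.hasTemperateGrowth_one_add_norm_sq_rpow (Rn n) (r / 2)).comp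
    (f := fun ξ : Rn n => (2 * Real.pi) • ξ) (by fun_prop)

theorem SchwartzMap.lintegral_enorm_sq_fourierInv (f : SchwartzMap (Rn n) ℂ) :
    ∫⁻ x, ‖𝓕⁻ (f : Rn n → ℂ) x‖ₑ ^ 2 = ∫⁻ ξ, ‖f ξ‖ₑ ^ 2 := by
  rw [← SchwartzMap.lintegral_enorm_sq_fourier,
    ← lintegral_neg_eq_self fun ξ => ‖𝓕 (f : Rn n → ℂ) ξ‖ₑ ^ 2]
  exact lintegral_congr fun x => by rw [Real.fourierInv_eq_fourier_neg]

theorem lintegral_enorm_sq_besselX_slice (r : ℝ) (hu : IsTestFunction u) (y : Rn n) :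
    ∫⁻ x, ‖besselX r u (x, y)‖ₑ ^ 2 = ∫⁻ ξ, ENNReal.ofReal
      (japaneseBracket ((2 * Real.pi) • ξ) ^ (2 * r)) * ‖partialFourier u (ξ, y)‖ₑ ^ 2 := by
  obtain ⟨h1, h2⟩ := hu.slice y
  set f : SchwartzMap (Rn n) ℂ := SchwartzMap.smulLeftCLM ℂ
    (fun ξ : Rn n => japaneseBracket ((2 * Real.pi) • ξ) ^ r) (𝓕 (h2.toSchwartzMap h1)) with hf
  have hfξ : ∀ ξ, f ξ = ((japaneseBracket ((2 * Real.pi) • ξ) ^ r : ℝ) : ℂ)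
      * partialFourier u (ξ, y) := fun ξ => by
    rw [hf, SchwartzMap.smulLeftCLM_apply_apply (hasTemperateGrowth_japaneseBracket_rpow r),
      SchwartzMap.fourier_coe]
    rfl
  have h := SchwartzMap.lintegral_enorm_sq_fourierInv f
  have e : (f : Rn n → ℂ) = fun ξ => ((japaneseBracket ((2 * Real.pi) • ξ) ^ r : ℝ) : ℂ)
      * 𝓕 (fun x : Rn n => u (x, y)) ξ := funext hfξ
  rw [e] at h
  refine h.trans (lintegral_congr fun ξ => ?_)
  rw [enorm_ofReal_mul_sq, ← Real.rpow_natCast, ← Real.rpow_mul (japaneseBracket_pos _).le,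
    mul_comm r]
  rfl

/-- Needed for Tonelli's theorem, since Plancherel is applied slice by slice in y. The inverse
transform is a parameter integral with continuous integrand. -/
theorem measurable_besselX (r : ℝ) (hu : IsTestFunction u) : Measurable (besselX r u) := by
  have hc := (contDiff_partialFourier hu).continuous
  have hk : Continuous fun q : PhaseSpace n × Rn n =>
      fourierKernel (-q.2) q.1.1 * (((japaneseBracket ((2 * Real.pi) • q.2) ^ r : ℝ) : ℂ)
        * partialFourier u (q.2, q.1.2)) := by
    have h1 : Continuous fun q : PhaseSpace n × Rn n => fourierKernel (-q.2) q.1.1 :=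
      (contDiff_fourierKernel (k := 0) (by fun_prop) (by fun_prop)).continuous
    have h2 : Continuous fun q : PhaseSpace n × Rn n =>
        japaneseBracket ((2 * Real.pi) • q.2) ^ r :=
      (contDiff_japaneseBracket_rpow (k := 0) (by fun_prop) r).continuous
    fun_prop
  have he : besselX r u = fun p : PhaseSpace n => ∫ ξ : Rn n, fourierKernel (-ξ) p.1
      * (((japaneseBracket ((2 * Real.pi) • ξ) ^ r : ℝ) : ℂ) * partialFourier u (ξ, p.2)) := by
    ext p
    rw [besselX, Real.fourierInv_eq']
    refine integral_congr_ae (Filter.Eventually.of_forall fun ξ => ?_)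
    simp only [fourierKernel, smul_eq_mul, partialFourier, inner_neg_right]
    rw [real_inner_comm]
    congr 4
    ring
  rw [he]
  exact (hk.stronglyMeasurable.integral_prod_right').measurable

theorem normL2_besselX_sq (r : ℝ) (hu : IsTestFunction u) :
    normL2 (besselX r u) ^ 2 = ∫⁻ p : PhaseSpace n, ENNReal.ofReal
      (japaneseBracket ((2 * Real.pi) • p.1) ^ (2 * r)) * ‖partialFourier u p‖ₑ ^ 2 := by
  have hc := (contDiff_partialFourier hu).continuous
  have hw : Continuous fun p : PhaseSpace n =>
      japaneseBracket ((2 * Real.pi) • p.1) ^ (2 * r) :=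
    (contDiff_japaneseBracket_rpow (k := 0) (by fun_prop) _).continuous
  have hm : Measurable fun p : PhaseSpace n => ENNReal.ofReal
      (japaneseBracket ((2 * Real.pi) • p.1) ^ (2 * r)) * ‖partialFourier u p‖ₑ ^ 2 :=
    (hw.measurable.ennreal_ofReal).mul (hc.measurable.enorm.pow_const 2)
  rw [normL2_sq, Measure.volume_eq_prod,
    lintegral_prod_symm _ ((measurable_besselX r hu).enorm.pow_const 2).aemeasurable,
    lintegral_prod_symm _ hm.aemeasurable]
  exact lintegral_congr fun y => lintegral_enorm_sq_besselX_slice r hu y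

end BesselPotential

/-! ### Gradient force and coordinate rotations -/

section GradientField

variable {n : ℕ} {V : Rn n → ℝ}

theorem gradient_apply (V : Rn n → ℝ) (x : Rn n) (j : Fin n) :
    gradient V x j = fderiv ℝ V x (stdVec j) := by
  have h : ⟪gradient V x, stdVec j⟫ = fderiv ℝ V x (stdVec j) := by
    rw [gradient, InnerProductSpace.toDual_symm_apply]
  rw [← h, stdVec, EuclideanSpace.inner_single_right]
  simp

theorem gradient_eq_sum (V : Rn n → ℝ) :
    gradient V = fun x => ∑ j, fderiv ℝ V x (stdVec j) • (stdVec j : Rn n) := by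
  ext1 x
  rw [← sum_smul_stdVec (gradient V x)]
  simp only [gradient_apply]

theorem contDiff_gradient (hV : ContDiff ℝ 2 V) : ContDiff ℝ 1 (gradient V) := by
  rw [gradient_eq_sum]
  exact ContDiff.sum fun j _ => ((hV.fderiv_right (m := 1) (by norm_num)).clm_apply
    contDiff_const).smul contDiff_const

theorem norm_fderiv_gradient_le (hV : ContDiff ℝ 2 V) {x : Rn n} {c : ℝ}
    (h : ∀ i j, |secondPartial V i j x| ≤ c) : ‖fderiv ℝ (gradient V) x‖ ≤ n ^ 2 * |c| := by
  have hd : ∀ j : Fin n, DifferentiableAt ℝ (fun z => fderiv ℝ V z (stdVec j)) x := fun j =>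
    ((hV.fderiv_right (m := 1) (by norm_num)).clm_apply contDiff_const).differentiable (by simp) x
  refine ContinuousLinearMap.opNorm_le_bound _ (by positivity) fun v => ?_
  have e : fderiv ℝ (gradient V) x v
      = ∑ j : Fin n, (∑ i, v i * secondPartial V i j x) • (stdVec j : Rn n) := by
    rw [gradient_eq_sum, fderiv_fun_sum fun j _ => (hd j).smul_const _, sum_apply]
    refine Finset.sum_congr rfl fun j _ => ?_
    rw [((hd j).hasFDerivAt.smul_const _).fderiv]
    conv_lhs => rw [← sum_smul_stdVec v]
    simp [secondPartial, Finset.sum_smul, smul_smul]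
  have hv : ∀ i, |v i| ≤ ‖v‖ := fun i => by simpa using PiLp.norm_apply_le v i
  rw [e]
  calc _ ≤ ∑ j : Fin n, ‖(∑ i, v i * secondPartial V i j x) • (stdVec j : Rn n)‖ :=
        norm_sum_le _ _
    _ ≤ ∑ _j : Fin n, ∑ _i : Fin n, ‖v‖ * |c| := by
        gcongr with j
        rw [norm_smul]
        simp only [stdVec, PiLp.norm_single, norm_one, mul_one]
        refine (norm_sum_le _ _).trans ?_
        gcongr with i
        rw [norm_mul]
        gcongr
        · exact hv i
        · exact (h i j).trans (le_abs_self c)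
    _ = _ := by simp; ring

/-- The magnetic term enters the transport field as -Jy, in agreement with the minus sign of H·(y ∧
∂_y) in P. -/
theorem fokkerPlanckOp_gradient (V : Rn n → ℝ) (J : Rn n → Rn n →L[ℝ] Rn n)
    (u : PhaseSpace n → ℂ) (p : PhaseSpace n) : fokkerPlanckOp (gradient V) J u p
      = fokkerPlanckElectric V u p - fderiv ℝ u p (0, J p.1 p.2) := by
  have h1 : fderiv ℝ u p (transportField (gradient V) J p)
      = (∑ j, (p.2 j : ℂ) * partialX j u p) - (∑ j, (gradient V p.1 j : ℂ) * partialY j u p)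
        - fderiv ℝ u p (0, J p.1 p.2) := by
    have e : transportField (gradient V) J p
        = (p.2, -gradient V p.1) - ((0 : Rn n), J p.1 p.2) := by
      simp [transportField]
    rw [e, map_sub, map_phaseSpace_eq_sum]
    simp [partialX, partialY, sub_eq_add_neg]
  rw [fokkerPlanckOp, kineticOp, h1, fokkerPlanckElectric]
  have h2 : ∀ j : Fin n, partialY j (partialY j u) p
      = fderiv ℝ (fun z => fderiv ℝ u z (0, stdVec j)) p (0, stdVec j) := fun j => rfl
  simp only [oscillatorPotential, h2, Pi.zero_apply]
  push_cast
  ring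

/-- The field `y ↦ y_i e_j - y_j e_i`, the generator of the rotations of a coordinate plane. -/
def rotationField (i j : Fin n) : Rn n →L[ℝ] Rn n :=
  (EuclideanSpace.proj (𝕜 := ℝ) i).smulRight (stdVec j)
    - (EuclideanSpace.proj (𝕜 := ℝ) j).smulRight (stdVec i)

theorem rotationField_apply (i j : Fin n) (y : Rn n) :
    rotationField i j y = y i • stdVec j - y j • stdVec i := by
  simp [rotationField]

theorem inner_rotationField_self (i j : Fin n) (y : Rn n) : ⟪rotationField i j y, y⟫ = 0 := by
  rw [rotationField_apply, inner_sub_left, real_inner_smul_left, real_inner_smul_left]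
  simp [stdVec, EuclideanSpace.inner_single_left, mul_comm]

theorem fderiv_rotationField (i j : Fin n) (u : PhaseSpace n → ℂ) (p : PhaseSpace n) :
    fderiv ℝ u p (0, rotationField i j p.2) = rotationY i j u p := by
  have e : ((0 : Rn n), rotationField i j p.2)
      = p.2 i • ((0 : Rn n), (stdVec j : Rn n)) - p.2 j • ((0 : Rn n), (stdVec i : Rn n)) := by
    simp [rotationField_apply]
  rw [e, map_sub, map_smul, map_smul]
  simp [rotationY, partialY]

end GradientField

/-! ### Both estimates for magnetic fields acting by skew matrices -/

section MainEstimate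

variable {n : ℕ} {F : Type*} [NormedAddCommGroup F] [NormedSpace ℝ F]

/-- The bound on H with exponent δ is weakened to 2/3, which keeps K, and with it every later
constant, independent of δ. -/
theorem admissibleField_gradient (L : F →L[ℝ] Rn n →L[ℝ] Rn n) (hL : ∀ a y, ⟪L a y, y⟫ = 0)
    {C₀ s δ : ℝ} {V : Rn n → ℝ} {H : Rn n → F} (hδ : δ < 2 / 3) (hV : ContDiff ℝ 2 V)
    (hH : Continuous H) (hHb : ∀ x, ‖H x‖ ≤ C₀ * gradWeight V x ^ δ)
    (hVb : ∀ i j x, |secondPartial V i j x| ≤ C₀ * gradWeight V x ^ s) :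
    AdmissibleField (1 + n ^ 2 * |C₀| + ‖L‖ * |C₀|) s (gradient V) fun x => L (H x) where
  one_le := by
    have : 0 ≤ n ^ 2 * |C₀| + ‖L‖ * |C₀| := by positivity
    linarith
  contDiff := contDiff_gradient hV
  continuous := L.continuous.comp hH
  skew x := hL _
  norm_fderiv_le x := by
    have hp := japaneseBracket_pos (gradient V x)
    refine (norm_fderiv_gradient_le hV fun i j => hVb i j x).trans ?_
    have h0 : 0 ≤ ‖L‖ * |C₀| := by positivity
    rw [abs_mul, gradWeight, abs_of_pos (by positivity : 0 < japaneseBracket (gradient V x) ^ s),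
      ← mul_assoc]
    gcongr
    linarith
  norm_le x := by
    have hp := japaneseBracket_pos (gradient V x)
    have h0 : 0 ≤ n ^ 2 * |C₀| := by positivity
    calc ‖L (H x)‖ ≤ ‖L‖ * ‖H x‖ := L.le_opNorm _
      _ ≤ ‖L‖ * (|C₀| * japaneseBracket (gradient V x) ^ (2 / 3 : ℝ)) := by
          gcongr
          refine (hHb x).trans (mul_le_mul (le_abs_self _) ?_ (by unfold gradWeight; positivity)
            (abs_nonneg _))
          exact Real.rpow_le_rpow_of_exponent_le (one_le_japaneseBracket _) hδ.le
      _ = ‖L‖ * |C₀| * japaneseBracket (gradient V x) ^ (2 / 3 : ℝ) := by ring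
      _ ≤ _ := by gcongr; linarith

/-- The two estimates for a magnetic field with values in a normed space `F` that acts on `ℝⁿ`
by skew-symmetric matrices. -/
theorem exists_normL2_estimate (L : F →L[ℝ] Rn n →L[ℝ] Rn n) (hL : ∀ a y, ⟪L a y, y⟫ = 0)
    (C₀ : ℝ) {s : ℝ} (hs : s < 4 / 3) : ∃ C : ℝ≥0,
      ∀ (δ : ℝ) (V : Rn n → ℝ) (H : Rn n → F), δ < 2 / 3 →
        ContDiff ℝ 2 V → Continuous H →
        (∀ x, ‖H x‖ ≤ C₀ * gradWeight V x ^ δ) →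
        (∀ i j x, |secondPartial V i j x| ≤ C₀ * gradWeight V x ^ s) →
        (∀ u : PhaseSpace n → ℂ, IsTestFunction u →
          normL2 (fun p => ((gradWeight V p.1 ^ (2 / 3 : ℝ) : ℝ) : ℂ) * u p)
            ≤ C * (normL2 (fokkerPlanckOp (gradient V) (fun x => L (H x)) u) + normL2 u)) ∧
        (ContDiff ℝ 1 H → (∀ x, ‖fderiv ℝ H x‖ ≤ C₀ * gradWeight V x ^ (s / 2)) →
          ∀ u : PhaseSpace n → ℂ, IsTestFunction u →
            normL2 (besselX (subellipticExponent s) u)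
              ≤ C * (normL2 (fokkerPlanckOp (gradient V) (fun x => L (H x)) u) + normL2 u)) := by
  have hK : 1 ≤ 1 + (n : ℝ) ^ 2 * |C₀| + ‖L‖ * |C₀| := by
    have : 0 ≤ (n : ℝ) ^ 2 * |C₀| + ‖L‖ * |C₀| := by positivity
    linarith
  obtain ⟨C₁, hC₁, h₁⟩ := exists_lintegral_controlledDensity_le n hK hs
  obtain ⟨C₂, hC₂, h₂⟩ := exists_lintegral_japaneseBracket_le n hK hs
  -- One constant for both estimates: passing from squared norms to norms replaces each C by 1 + C,
  -- and the two are added.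
  refine ⟨(1 + C₁.toNNReal) + (1 + C₂.toNNReal), fun δ V H hδ hV hH hHb hVb => ?_⟩
  have hA := admissibleField_gradient L hL hδ hV hH hHb hVb
  have hC : ((((1 + C₁.toNNReal) + (1 + C₂.toNNReal) : ℝ≥0)) : ENNReal)
      = (1 + ENNReal.ofReal C₁) + (1 + C₂) := by
    push_cast
    rw [ENNReal.coe_toNNReal hC₂]
    rfl
  rw [hC]
  refine ⟨fun u hu => ?_, fun hH1 hH' u hu => ?_⟩
  · have h : normL2 (fun p => ((gradWeight V p.1 ^ (2 / 3 : ℝ) : ℝ) : ℂ) * u p) ^ 2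
        ≤ ENNReal.ofReal C₁ * (normL2 (fokkerPlanckOp (gradient V) (fun x => L (H x)) u) ^ 2
          + normL2 u ^ 2) := by
      rw [normL2_sq, normL2_sq, normL2_sq]
      refine le_trans (lintegral_mono fun p => ?_) (h₁ _ _ hA u hu)
      have hp := japaneseBracket_pos (gradient V p.1)
      have hg := gradYSq_nonneg u p
      rw [← ofReal_norm, ← ENNReal.ofReal_pow (norm_nonneg _)]
      refine ENNReal.ofReal_le_ofReal ?_
      rw [norm_mul, mul_pow, Complex.norm_real, gradWeight, Real.norm_of_nonneg (by positivity),
        ← Real.rpow_natCast, ← Real.rpow_mul hp.le]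
      calc _ = 0 + (japaneseBracket (gradient V p.1) ^ (4 / 3 : ℝ) * ‖u p‖ ^ 2 + 0 + 0) := by
            norm_num
        _ ≤ _ := by unfold controlledDensity; gcongr <;> positivity
    exact (le_of_sq_le_mul_add_sq h).trans (mul_le_mul' le_self_add le_rfl)
  · have hJ : Differentiable ℝ fun x => L (H x) :=
      L.differentiable.comp (hH1.differentiable (by simp))
    have hJ' : ∀ x, ‖fderiv ℝ (fun x => L (H x)) x‖
        ≤ (1 + n ^ 2 * |C₀| + ‖L‖ * |C₀|) * japaneseBracket (gradient V x) ^ (s / 2) := fun x => by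
      have hp := japaneseBracket_pos (gradient V x)
      have h0 : 0 ≤ (n : ℝ) ^ 2 * |C₀| := by positivity
      have e : fderiv ℝ (fun x => L (H x)) x = L.comp (fderiv ℝ H x) :=
        (L.hasFDerivAt.comp x (hH1.differentiable (by simp) x).hasFDerivAt).fderiv
      rw [e]
      calc ‖L.comp (fderiv ℝ H x)‖ ≤ ‖L‖ * ‖fderiv ℝ H x‖ := L.opNorm_comp_le _
        _ ≤ ‖L‖ * (|C₀| * japaneseBracket (gradient V x) ^ (s / 2)) := by
            gcongr
            refine (hH' x).trans (mul_le_mul_of_nonneg_right (le_abs_self _) ?_)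
            unfold gradWeight
            positivity
        _ = ‖L‖ * |C₀| * japaneseBracket (gradient V x) ^ (s / 2) := by ring
        _ ≤ _ := by gcongr; linarith
    have h : normL2 (besselX (subellipticExponent s) u) ^ 2
        ≤ C₂ * (normL2 (fokkerPlanckOp (gradient V) (fun x => L (H x)) u) ^ 2
          + normL2 u ^ 2) := by
      rw [normL2_besselX_sq _ hu, normL2_sq, normL2_sq]
      exact h₂ _ _ hA hJ hJ' u hu
    exact (le_of_sq_le_mul_add_sq h).trans (mul_le_mul' le_add_self le_rfl)

/-- The action of scalar magnetic fields on `ℝ²`. -/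
def magneticMatrix2 : ℝ →L[ℝ] Rn 2 →L[ℝ] Rn 2 :=
  ContinuousLinearMap.toSpanSingleton ℝ (rotationField 0 1)

/-- The action of magnetic vector fields on `ℝ³`. -/
def magneticMatrix3 : Rn 3 →L[ℝ] Rn 3 →L[ℝ] Rn 3 :=
  (EuclideanSpace.proj (𝕜 := ℝ) 0).smulRight (rotationField 1 2)
    + (EuclideanSpace.proj (𝕜 := ℝ) 1).smulRight (rotationField 2 0)
    + (EuclideanSpace.proj (𝕜 := ℝ) 2).smulRight (rotationField 0 1)

theorem magneticMatrix2_apply (a : ℝ) (y : Rn 2) :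
    magneticMatrix2 a y = a • rotationField 0 1 y := by
  simp [magneticMatrix2]

theorem magneticMatrix3_apply (a y : Rn 3) : magneticMatrix3 a y
    = a 0 • rotationField 1 2 y + a 1 • rotationField 2 0 y + a 2 • rotationField 0 1 y := by
  simp [magneticMatrix3]

theorem fokkerPlanck2_eq (V H : Rn 2 → ℝ) (u : PhaseSpace 2 → ℂ) :
    fokkerPlanck2 V H u = fokkerPlanckOp (gradient V) (fun x => magneticMatrix2 (H x)) u := by
  ext p
  rw [fokkerPlanckOp_gradient, fokkerPlanck2, magneticTerm2, magneticMatrix2_apply,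
    ← fderiv_rotationField]
  have e : ((0 : Rn 2), H p.1 • rotationField 0 1 p.2)
      = H p.1 • ((0 : Rn 2), rotationField 0 1 p.2) := by simp
  rw [e, map_smul, Complex.real_smul]

theorem fokkerPlanck3_eq (V : Rn 3 → ℝ) (H : Rn 3 → Rn 3) (u : PhaseSpace 3 → ℂ) :
    fokkerPlanck3 V H u = fokkerPlanckOp (gradient V) (fun x => magneticMatrix3 (H x)) u := by
  ext p
  rw [fokkerPlanckOp_gradient, fokkerPlanck3, magneticTerm3, magneticMatrix3_apply,
    ← fderiv_rotationField, ← fderiv_rotationField, ← fderiv_rotationField]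
  have e : ((0 : Rn 3), H p.1 0 • rotationField 1 2 p.2 + H p.1 1 • rotationField 2 0 p.2
        + H p.1 2 • rotationField 0 1 p.2)
      = H p.1 0 • ((0 : Rn 3), rotationField 1 2 p.2) + H p.1 1 • ((0 : Rn 3), rotationField 2 0 p.2)
        + H p.1 2 • ((0 : Rn 3), rotationField 0 1 p.2) := by simp
  rw [e, map_add, map_add, map_smul, map_smul, map_smul]
  simp only [Complex.real_smul]

end MainEstimate

theorem theorem1p1 :
    -- the case of dimension two, with a scalar magnetic field
    (∀ C₀ s : ℝ, s < 4 / 3 → ∃ C : ℝ≥0,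
      ∀ (δ : ℝ) (V : Rn 2 → ℝ) (H : Rn 2 → ℝ), δ < 2 / 3 →
        ContDiff ℝ 2 V → Continuous H →
        (∀ x, |H x| ≤ C₀ * gradWeight V x ^ δ) →
        (∀ i j x, |secondPartial V i j x| ≤ C₀ * gradWeight V x ^ s) →
        (∀ u : PhaseSpace 2 → ℂ, IsTestFunction u →
          normL2 (fun p => ((gradWeight V p.1 ^ (2 / 3 : ℝ) : ℝ) : ℂ) * u p)
            ≤ C * (normL2 (fokkerPlanck2 V H u) + normL2 u)) ∧
        (ContDiff ℝ 1 H → (∀ x, ‖fderiv ℝ H x‖ ≤ C₀ * gradWeight V x ^ (s / 2)) →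
          ∀ u : PhaseSpace 2 → ℂ, IsTestFunction u →
            normL2 (besselX (subellipticExponent s) u)
              ≤ C * (normL2 (fokkerPlanck2 V H u) + normL2 u))) ∧
    -- the case of dimension three, with a vector magnetic field
    (∀ C₀ s : ℝ, s < 4 / 3 → ∃ C : ℝ≥0,
      ∀ (δ : ℝ) (V : Rn 3 → ℝ) (H : Rn 3 → Rn 3), δ < 2 / 3 →
        ContDiff ℝ 2 V → Continuous H →
        (∀ x, ‖H x‖ ≤ C₀ * gradWeight V x ^ δ) →
        (∀ i j x, |secondPartial V i j x| ≤ C₀ * gradWeight V x ^ s) →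
        (∀ u : PhaseSpace 3 → ℂ, IsTestFunction u →
          normL2 (fun p => ((gradWeight V p.1 ^ (2 / 3 : ℝ) : ℝ) : ℂ) * u p)
            ≤ C * (normL2 (fokkerPlanck3 V H u) + normL2 u)) ∧
        (ContDiff ℝ 1 H → (∀ x, ‖fderiv ℝ H x‖ ≤ C₀ * gradWeight V x ^ (s / 2)) →
          ∀ u : PhaseSpace 3 → ℂ, IsTestFunction u →
            normL2 (besselX (subellipticExponent s) u)
              ≤ C * (normL2 (fokkerPlanck3 V H u) + normL2 u))) := by
  refine ⟨fun C₀ s hs => ?_, fun C₀ s hs => ?_⟩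
  · simp only [fokkerPlanck2_eq, ← Real.norm_eq_abs (_ : ℝ)]
    exact exists_normL2_estimate magneticMatrix2 (fun a y => by
      rw [magneticMatrix2_apply, real_inner_smul_left, inner_rotationField_self, mul_zero]) C₀ hs
  · simp only [fokkerPlanck3_eq]
    exact exists_normL2_estimate magneticMatrix3 (fun a y => by
      simp only [magneticMatrix3_apply, inner_add_left, real_inner_smul_left,
        inner_rotationField_self, mul_zero, add_zero]) C₀ hs

end
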